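/- Let $G$ be a connected reductive algebraic group over an algebraically closed field $\mathbb K$ of characteristic $p>0$, with maximal torus $T$ of rank $d$, Borel subgroup $B\supseteq T$, character group $X=X(T)$, Lie algebras $\mathfrak g=\mathrm{Lie}(G)$, $\mathfrak h=\mathrm{Lie}(T)$, $\mathfrak b=\mathrm{Lie}(B)$, $p$-th power map $x\mapsto x^{[p]}$, roots $R\subset X$, and positive roots $R^+$ and simple roots $\Pi$ corresponding to $B$. Assume that $p$ is good for $G$. Fix a basis $\{e_\alpha,h_i\mid\alpha\in R,\ 1\le i\le d\}$ of $\mathfrak g$ with $e_\alpha\in\mathfrak g_\alpha$, $h_i\in\mathfrak h$, $h_i^{[p]}=h_i$. Let $I\subseteq\Pi$ and let $\chi\in\mathfrak g^*$ be in standard Levi form with associated set $I$: $\chi(\mathfrak b)=0$ and, for $\alpha\in R^+$, $\chi(e_{-\alpha})=1$ if $\alpha\in I$ and $\chi(e_{-\alpha})=0$ otherwise. Put $$U_\chi=U(\mathfrak g)/\langle e_\alpha^p-\chi(e_\alpha)^p\mid\alpha\in R\rangle,\qquad U^0=U(\mathfrak h),$$ and let $U^0U^+\subseteq U_\chi$ be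 the subalgebra generated by $\mathfrak h$ and the $e_\alpha$ with $\alpha\in R^+$. The algebra $U_\chi$ is $X/\mathbb ZI$-graded with $e_\alpha$ in degree $\alpha+\mathbb ZI$ and $\mathfrak h$ in degree $0$. For $\mu\in X$ let $d\mu\in\mathfrak h^*$ be its differential and $\widetilde\mu$ the algebra endomorphism of $U^0$ with $\widetilde\mu(h)=h+d\mu(h)$ for $h\in\mathfrak h$. Let $F$ be a field which is a $U^0$-algebra, with structure map $\pi:U^0\to F$. Let $\mathcal C_F$ be the category whose objects are the $U_\chi\otimes F$-modules $M$ (left $U_\chi$-action, right $F$-action) with a decomposition $M=\bigoplus_{\sigma\in X/\mathbb ZI}M_\sigma$ such that: (A) $M_\sigma F\subseteq M_\sigma$; (B) only finitely many $M_\sigma$ are non-zero, and each is finite-dimensional over $F$; (C) $(U_\chi)_\sigma M_\tau\subseteq M_{\sigma+\tau}$; (D) $M_\sigma=\bigoplus_{d\mu,\ \mu\in\sigma+pX}M_\sigma^{d\mu}$ with $sm=m\,\pi(\widetilde\mu(s))$ for $s\in U^0$, $m\in M_\sigma^{d\mu}$, with $e_\alpha M_\sigma^{d\mu}\subseteq M_{\sigma+\alpha}^{d(\mu+\alpha)}$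 for $\alpha\in R$, and with $M_\sigma^{d\mu}F\subseteq M_\sigma^{d\mu}$. Morphisms are the $U_\chi\otimes F$-linear maps sending each $M_\sigma^{d\mu}$ into $N_\sigma^{d\mu}$. For $\lambda\in X$ let $F^\lambda$ be $F$ with $U^0$ acting by $sa=a\,\pi(\widetilde\lambda(s))$ and with $e_\alpha$ acting by $0$ for $\alpha\in R^+$, and let $Z_{F,\chi}(\lambda)=U_\chi\otimes_{U^0U^+}F^\lambda$, where $Z_{F,\chi}(\lambda)_\sigma$ and $Z_{F,\chi}(\lambda)_\sigma^{d\mu}$ are the images of $(U_\chi)_{\sigma-\lambda}\otimes F$ and of the part of $(U_\chi)_{\sigma-\lambda}\otimes F$ of weight $d(\mu-\lambda)$ for the adjoint action of $\mathfrak h$. Then $Z_{F,\chi}(\lambda)$ is an object of $\mathcal C_F$, and it has a unique irreducible quotient in $\mathcal C_F$: there are an irreducible object $L_{F,\chi}(\lambda)$ and a surjective morphism $q:Z_{F,\chi}(\lambda)\to L_{F,\chi}(\lambda)$ in $\mathcal C_F$ such that for every surjective morphism $q':Z_{F,\chi}(\lambda)\to L'$ onto an irreducible object $L'$ of $\mathcal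 C_F$ there is an isomorphism $\varphi:L_{F,\chi}(\lambda)\to L'$ in $\mathcal C_F$ with $\varphi\circ q=q'$. -/

import Mathlib

open scoped TensorProduct
open WithConv

attribute [local instance 100] LieRing.ofAssociativeRing

noncomputable section

namespace BabyVerma

universe u v w x

/-! ### Linear algebraic groups

An affine algebraic group `G` over `K` is given by its coordinate ring `O = K[G]`, a commutative Hopf
algebra. Its group of `K`-points is the group of algebra homomorphisms `O → K` under convolution, and
all functionals `O → K` form an associative algebra under convolution, which contains both the points
of `G` and the Lie algebra of `G`. -/

section Groups

variable (K : Type u) [Field K] (O : Type v) [CommRing O] [HopfAlgebra K O]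

/-- The group `G(K)`. -/
abbrev Points : Type (max u v) := WithConv (O →ₐ[K] K)

/-- The full dual of `K[G]` with the convolution product. -/
abbrev ConvDual : Type (max u v) := WithConv (O →ₗ[K] K)

variable {K O}

/-- A point of `G` as a functional on `K[G]`. -/
def Points.toDual (g : Points K O) : ConvDual K O := toConv g.ofConv.toLinearMap

/-- The closed connected subgroups of `G`: over an algebraically closed field they are the subgroups
of `G(K)` which are the zero locus of a prime ideal of `K[G]` (irreducible closed subsets). -/
def IsClosedConnected (H : Subgroup (Points K O)) : Prop :=
  ∃ J : Ideal O, J.IsPrime ∧ ∀ g : Points K O, g ∈ H ↔ ∀ f ∈ J, g.ofConv f = 0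

/-- Right translation of functions, `(translate g f)(x) = f(xg)`. -/
def translate (g : Points K O) : O →ₗ[K] O :=
  (TensorProduct.rid K O).toLinearMap ∘ₗ
    (LinearMap.lTensor O g.ofConv.toLinearMap) ∘ₗ Coalgebra.comul

/-- `g` is unipotent: right translation by `g` is a locally unipotent operator on `K[G]`. -/
def IsUnipotent (g : Points K O) : Prop :=
  ∀ f : O, ∃ k : ℕ, ((translate g - 1 : Module.End K O) ^ k) f = 0

variable (K O) in
/-- `G` is a connected reductive algebraic group: its coordinate ring is a finitely generated
domain, and every closed connected normal unipotent subgroup is trivial. -/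
structure IsConnectedReductive : Prop where
  finiteType : Algebra.FiniteType K O
  isDomain : IsDomain O
  unipotentRadical_trivial : ∀ N : Subgroup (Points K O), IsClosedConnected N → N.Normal →
    (∀ g ∈ N, IsUnipotent g) → N = ⊥

/-- Borel subgroups: maximal closed connected solvable subgroups. -/
def IsBorel (B : Subgroup (Points K O)) : Prop :=
  Maximal (fun H : Subgroup (Points K O) => IsClosedConnected H ∧ Group.IsSolvable H) B

/-- The product rule for a convolution product of two point derivations. -/
lemma convMul_mul_apply (a b : ConvDual K O)
    (ha : ∀ f g : O, a.ofConv (f * g) =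
      Coalgebra.counit (R := K) f * a.ofConv g + a.ofConv f * Coalgebra.counit (R := K) g)
    (hb : ∀ f g : O, b.ofConv (f * g) =
      Coalgebra.counit (R := K) f * b.ofConv g + b.ofConv f * Coalgebra.counit (R := K) g)
    (f g : O) :
    (a * b).ofConv (f * g) =
      Coalgebra.counit (R := K) f * (a * b).ofConv g + b.ofConv f * a.ofConv g
        + a.ofConv f * b.ofConv g + (a * b).ofConv f * Coalgebra.counit (R := K) g := by
  have e1 : ∀ y : O, (1 : ConvDual K O).ofConv y = Coalgebra.counit (R := K) y := fun y => rfl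
  let rf := Coalgebra.Repr.arbitrary K f
  let rg := Coalgebra.Repr.arbitrary K g
  have h0 : (a * b).ofConv (f * g) = ∑ i ∈ rf.index, ∑ j ∈ rg.index,
      a.ofConv (rf.left i * rg.left j) * b.ofConv (rf.right i * rg.right j) := by
    rw [LinearMap.convMul_apply, Bialgebra.comul_mul, ← rf.eq, ← rg.eq, Finset.sum_mul_sum]
    simp [Algebra.TensorProduct.tmul_mul_tmul]
  have h1 : Coalgebra.counit (R := K) f * (a * b).ofConv g =
      (1 * 1 : ConvDual K O).ofConv f * (a * b).ofConv g := by rw [mul_one, e1]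
  have h2 : b.ofConv f * a.ofConv g = (1 * b).ofConv f * (a * 1).ofConv g := by
    rw [mul_one, one_mul]
  have h3 : a.ofConv f * b.ofConv g = (a * 1).ofConv f * (1 * b).ofConv g := by
    rw [mul_one, one_mul]
  have h4 : (a * b).ofConv f * Coalgebra.counit (R := K) g =
      (a * b).ofConv f * (1 * 1 : ConvDual K O).ofConv g := by rw [mul_one, e1]
  rw [h0, h1, h2, h3, h4]
  simp only [rf.convMul_apply, rg.convMul_apply, Finset.sum_mul_sum, ← Finset.sum_add_distrib]
  refine Finset.sum_congr rfl fun i _ => Finset.sum_congr rfl fun j _ => ?_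
  rw [ha, hb, e1, e1, e1, e1]
  ring

variable (K O) in
/-- The Lie algebra `Lie(G)`: point derivations of `K[G]` at the identity, with the bracket
`[x, y] = x * y - y * x` of the convolution algebra. The `p`-th power map `x ↦ x^{[p]}` is the `p`-th
power in the convolution algebra. -/
def lieAlg : LieSubalgebra K (ConvDual K O) where
  carrier := {D | ∀ f g : O, D.ofConv (f * g) =
    Coalgebra.counit (R := K) f * D.ofConv g + D.ofConv f * Coalgebra.counit (R := K) g}
  add_mem' := by
    intro a b ha hb f g
    simp only [ofConv_add, LinearMap.add_apply, ha f g, hb f g]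
    ring
  zero_mem' := by
    intro f g
    simp
  smul_mem' := by
    intro c a ha f g
    simp only [ofConv_smul, LinearMap.smul_apply, ha f g, smul_eq_mul]
    ring
  lie_mem' := by
    intro a b ha hb f g
    rw [LieRing.of_associative_ring_bracket, ofConv_sub, LinearMap.sub_apply, LinearMap.sub_apply,
      LinearMap.sub_apply, convMul_mul_apply a b ha hb, convMul_mul_apply b a hb ha]
    ring

/-- The differential `Lie(H) → Lie(G)` of a homomorphism `H → G` given by `φ : K[G] → K[H]`. -/
def lieMap {O' : Type w} [CommRing O'] [HopfAlgebra K O'] (φ : O →ₐc[K] O') :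
    lieAlg K O' →ₗ⁅K⁆ lieAlg K O where
  toFun D := ⟨toConv (D.1.ofConv ∘ₗ (φ : O →ₗc[K] O').toLinearMap), by
    intro f g
    have h := D.2 (φ f) (φ g)
    have hc : ∀ y : O, Coalgebra.counit (R := K) (φ y) = Coalgebra.counit (R := K) y :=
      fun y => CoalgHomClass.counit_comp_apply φ y
    rw [hc, hc, ← map_mul] at h
    exact h⟩
  map_add' _ _ := rfl
  map_smul' _ _ := rfl
  map_lie' := by
    intro D E
    apply Subtype.ext
    apply ofConv_injective
    have h1 := LinearMap.convMul_comp_coalgHom_distrib D.1 E.1 (φ : O →ₗc[K] O')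
    have h2 := LinearMap.convMul_comp_coalgHom_distrib E.1 D.1 (φ : O →ₗc[K] O')
    change (D.1 * E.1 - E.1 * D.1).ofConv ∘ₗ _ = (_ * _ - _ * _ : ConvDual K O).ofConv
    rw [ofConv_sub, ofConv_sub, LinearMap.sub_comp, h1, h2]

/-- The Lie algebra of a subgroup of `G(K)`, as a subspace of `Lie(G)`: the point derivations which
kill every function vanishing on the subgroup. -/
def lieOf (H : Subgroup (Points K O)) : Submodule K (lieAlg K O) where
  carrier := {D | ∀ f : O, (∀ g ∈ H, g.ofConv f = 0) → D.1.ofConv f = 0}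
  add_mem' := by
    intro a b ha hb f hf
    simp [ha f hf, hb f hf]
  zero_mem' := by
    intro f _
    simp
  smul_mem' := by
    intro c a ha f hf
    simp [ha f hf]

end Groups

/-! ### Maximal torus, roots

A torus with character group `X` (a lattice) is `T = Spec K[X]`; an embedding `T ≤ G` is a
surjective Hopf algebra map `K[G] → K[X]`. -/

section Torus

variable {K : Type u} [Field K] {O : Type v} [CommRing O] [HopfAlgebra K O]
variable {X : Type w} [AddCommGroup X]

/-- The inclusion `T(K) → G(K)`. -/
def torPoint (r : O →ₐc[K] AddMonoidAlgebra K X) (t : Points K (AddMonoidAlgebra K X)) :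
    Points K O :=
  toConv (t.ofConv.comp (r : O →ₐ[K] AddMonoidAlgebra K X))

/-- The value `lam(t)` of a character at a point of the torus. -/
def charValue (lam : X) (t : Points K (AddMonoidAlgebra K X)) : K :=
  t.ofConv (AddMonoidAlgebra.single lam 1)

/-- The weight space of weight `lam` in `Lie(G)` for the adjoint action `Ad(t) x = t x t⁻¹`. -/
def weightSpace (r : O →ₐc[K] AddMonoidAlgebra K X) (lam : X) : Submodule K (lieAlg K O) where
  carrier := {D | ∀ t : Points K (AddMonoidAlgebra K X),
    (torPoint r t).toDual * D.1 * ((torPoint r t)⁻¹).toDual = charValue lam t • D.1}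
  add_mem' := by
    intro a b ha hb t
    have h1 := ha t
    have h2 := hb t
    change _ * (a.1 + b.1) * _ = _ • (a.1 + b.1)
    rw [mul_add, add_mul, smul_add, h1, h2]
  zero_mem' := by
    intro t
    simp
  smul_mem' := by
    intro c a ha t
    have h1 := ha t
    change _ * (c • a.1) * _ = _ • (c • a.1)
    rw [mul_smul_comm, smul_mul_assoc, h1, smul_comm]

/-- The roots: non-zero weights of `T` on `Lie(G)`. -/
def roots (r : O →ₐc[K] AddMonoidAlgebra K X) : Set X :=
  {α | α ≠ 0 ∧ weightSpace r α ≠ ⊥}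

/-- The roots of `T` on the Lie algebra of a subgroup `B`. -/
def rootsOf (r : O →ₐc[K] AddMonoidAlgebra K X) (B : Subgroup (Points K O)) : Set X :=
  {α | α ≠ 0 ∧ weightSpace r α ⊓ lieOf B ≠ ⊥}

/-- `T` is a maximal torus of `G`: it is closed in `G` and is not properly contained in a larger
torus. -/
def IsMaximalTorus (r : O →ₐc[K] AddMonoidAlgebra K X) : Prop :=
  Function.Surjective r ∧
    ∀ (n : ℕ) (r' : O →ₐc[K] AddMonoidAlgebra K (Fin n → ℤ)), Function.Surjective r' →
      (∀ f : O, r' f = 0 → r f = 0) → ∀ f : O, r f = 0 → r' f = 0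

variable (K X) in
/-- `𝔥 = Lie(T)`. -/
abbrev Cartan : Type (max u w) := lieAlg K (AddMonoidAlgebra K X)

/-- The differential `d lam ∈ 𝔥*` of a character. -/
def dchar (lam : X) : Module.Dual K (Cartan K X) where
  toFun h := h.1.ofConv (AddMonoidAlgebra.single lam 1)
  map_add' _ _ := rfl
  map_smul' _ _ := rfl

variable (K X) in
/-- `U⁰ = U(𝔥)`. -/
abbrev U0 : Type (max u w) := UniversalEnvelopingAlgebra K (Cartan K X)

lemma dchar_lie (lam : X) (h h' : Cartan K X) : dchar lam ⁅h, h'⁆ = 0 := by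
  change (h.1 * h'.1 - h'.1 * h.1).ofConv (AddMonoidAlgebra.single lam 1) = 0
  rw [ofConv_sub, LinearMap.sub_apply, LinearMap.convMul_apply, LinearMap.convMul_apply]
  simp [mul_comm]

/-- The algebra endomorphism of `U⁰` with `h ↦ h + d lam(h)` for `h ∈ 𝔥`. -/
def tilde (lam : X) : U0 K X →ₐ[K] U0 K X :=
  UniversalEnvelopingAlgebra.lift K
    { ((UniversalEnvelopingAlgebra.ι K : Cartan K X →ₗ⁅K⁆ U0 K X) : Cartan K X →ₗ[K] U0 K X) +
        Algebra.linearMap K (U0 K X) ∘ₗ dchar lam with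
      map_lie' := by
        intro a b
        change UniversalEnvelopingAlgebra.ι K ⁅a, b⁆ + algebraMap K (U0 K X) (dchar lam ⁅a, b⁆) =
          (UniversalEnvelopingAlgebra.ι K a + algebraMap K (U0 K X) (dchar lam a)) *
            (UniversalEnvelopingAlgebra.ι K b + algebraMap K (U0 K X) (dchar lam b)) -
          (UniversalEnvelopingAlgebra.ι K b + algebraMap K (U0 K X) (dchar lam b)) *
            (UniversalEnvelopingAlgebra.ι K a + algebraMap K (U0 K X) (dchar lam a))
        rw [dchar_lie, map_zero, add_zero, LieHom.map_lie, LieRing.of_associative_ring_bracket]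
        rw [mul_add, mul_add, add_mul, add_mul, add_mul, add_mul,
          Algebra.commutes (dchar lam a) (UniversalEnvelopingAlgebra.ι K b),
          Algebra.commutes (dchar lam b) (UniversalEnvelopingAlgebra.ι K a),
          Algebra.commutes (dchar lam a) (algebraMap K (U0 K X) (dchar lam b))]
        abel }

end Torus

/-! ### The group-theoretic set-up -/

/-- The choices attached to a connected reductive group `G` with coordinate ring `O`: a maximal torus
`T` with character group `X`, a Borel subgroup `B` containing `T`, a basis
`{e_α, h_i | α ∈ R, 1 ≤ i ≤ d}` of `𝔤 = Lie(G)` with `e_α ∈ 𝔤_α`, `h_i ∈ 𝔥` and `h_i^{[p]} = h_i`, and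
the set `Π` of simple roots of the positive system `R⁺` given by `B`. -/
structure Setting (K : Type u) [Field K] (p : ℕ) (O : Type v) [CommRing O] [HopfAlgebra K O]
    (X : Type w) [AddCommGroup X] where
  torus : O →ₐc[K] AddMonoidAlgebra K X
  torus_max : IsMaximalTorus torus
  borel : Subgroup (Points K O)
  borel_isBorel : IsBorel borel
  torus_le_borel : ∀ t, torPoint torus t ∈ borel
  basis : Module.Basis (roots torus ⊕ Fin (Module.finrank ℤ X)) K (lieAlg K O)
  basis_root : ∀ α : roots torus, basis (Sum.inl α) ∈ weightSpace torus α.1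
  basis_cartan : ∀ i, ∃ h : Cartan K X, basis (Sum.inr i) = lieMap torus h
  basis_cartan_pow : ∀ i, (basis (Sum.inr i)).1 ^ p = (basis (Sum.inr i)).1
  simple : Set X
  simple_pos : simple ⊆ rootsOf torus borel
  simple_indep : LinearIndepOn ℤ id simple
  pos_sum : ∀ α ∈ rootsOf torus borel, α ∈ AddSubmonoid.closure simple
  pos_or_neg : ∀ α ∈ roots torus, α ∈ rootsOf torus borel ∨ -α ∈ rootsOf torus borel

namespace Setting

variable {K : Type u} [Field K] {p : ℕ} {O : Type v} [CommRing O] [HopfAlgebra K O]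
variable {X : Type w} [AddCommGroup X] (S : Setting K p O X)

/-- The set `R` of roots. -/
abbrev R : Set X := roots S.torus

/-- The set `R⁺` of positive roots. -/
abbrev pos : Set X := rootsOf S.torus S.borel

/-- The root vector `e_α`. -/
def e (α : S.R) : lieAlg K O := S.basis (Sum.inl α)

/-- `p` is good for `G`: it divides no non-zero coefficient of a positive root written as a
combination of simple roots. (This excludes `2` for components of type `B`, `C`, `D`; `2, 3` for
`E₆, E₇, F₄, G₂`; `2, 3, 5` for `E₈`; and no prime in type `A`.) -/
def IsGood : Prop :=
  ∀ c : S.simple →₀ ℕ, (c.sum fun β n => n • β.1) ∈ S.pos → ∀ β, p ∣ c β → c β = 0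

/-- `χ` is in standard Levi form with associated set `I` of simple roots. -/
structure IsStandardLevi (χ : Module.Dual K (lieAlg K O)) (I : Set X) : Prop where
  subset : I ⊆ S.simple
  borel : ∀ x ∈ lieOf S.borel, χ x = 0
  mem : ∀ α : S.R, -α.1 ∈ S.pos → -α.1 ∈ I → χ (S.e α) = 1
  not_mem : ∀ α : S.R, -α.1 ∈ S.pos → -α.1 ∉ I → χ (S.e α) = 0

/-- `X / ℤI`. -/
abbrev XI (_S : Setting K p O X) (I : Set X) : Type w := X ⧸ AddSubgroup.closure I

/-- The class `μ + ℤI`. -/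
abbrev cls (I : Set X) (μ : X) : S.XI I := QuotientAddGroup.mk μ

/-- The set of all `dμ ∈ 𝔥*` with `μ ∈ σ + pX`, for a coset `σ` of `ℤI`. -/
def weights (I : Set X) (σ : S.XI I) : Set (Module.Dual K (Cartan K X)) :=
  {ξ | ∃ μ τ : X, S.cls I (μ - p • τ) = σ ∧ dchar μ = ξ}

/-! ### The algebra `U_χ` -/

variable (χ : Module.Dual K (lieAlg K O)) (I : Set X)

/-- The relations `e_α ^ p = χ(e_α) ^ p` for `α ∈ R`. -/
def uRel (a b : UniversalEnvelopingAlgebra K (lieAlg K O)) : Prop :=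
  ∃ α : S.R, a = UniversalEnvelopingAlgebra.ι K (S.e α) ^ p ∧ b = algebraMap K _ (χ (S.e α) ^ p)

/-- `U_χ = U(𝔤) / ⟨e_α ^ p - χ(e_α) ^ p | α ∈ R⟩`. -/
def U : Type (max u v) := RingQuot (S.uRel χ)

instance : Ring (S.U χ) := inferInstanceAs (Ring (RingQuot (S.uRel χ)))

instance : Algebra K (S.U χ) := inferInstanceAs (Algebra K (RingQuot (S.uRel χ)))

/-- The quotient map `U(𝔤) → U_χ`. -/
def toU : UniversalEnvelopingAlgebra K (lieAlg K O) →ₐ[K] S.U χ := RingQuot.mkAlgHom K (S.uRel χ)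

/-- The image of `e_α` in `U_χ`. -/
def ue (α : S.R) : S.U χ := S.toU χ (UniversalEnvelopingAlgebra.ι K (S.e α))

/-- The map `U⁰ = U(𝔥) → U_χ`. -/
def u0 : U0 K X →ₐ[K] S.U χ :=
  (S.toU χ).comp (UniversalEnvelopingAlgebra.lift K
    ((UniversalEnvelopingAlgebra.ι K).comp (lieMap S.torus)))

/-- The image of `h ∈ 𝔥` in `U_χ`. -/
def uh (h : Cartan K X) : S.U χ := S.u0 χ (UniversalEnvelopingAlgebra.ι K h)

/-- The generators `e_α` and `h` of `U_χ`. -/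
def gen : S.R ⊕ Cartan K X → S.U χ := Sum.elim (S.ue χ) (S.uh χ)

/-- Their degrees: `α + ℤI` and `0 + ℤI`. -/
def genDeg : S.R ⊕ Cartan K X → S.XI I := Sum.elim (fun α => S.cls I α.1) fun _ => 0

/-- The `X/ℤI`-grading of `U_χ`: the component of degree `σ` is spanned by the monomials in the
generators whose degrees add up to `σ`. -/
def uGr (σ : S.XI I) : Submodule K (S.U χ) :=
  Submodule.span K {y | ∃ l : List (S.R ⊕ Cartan K X),
    (l.map (S.genDeg I)).sum = σ ∧ (l.map (S.gen χ)).prod = y}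

/-- The subspace of weight `ξ ∈ 𝔥*` in the component of degree `σ` of `U_χ`, for the adjoint
action of `𝔥`. -/
def uWt (σ : S.XI I) (ξ : Module.Dual K (Cartan K X)) : Set (S.U χ) :=
  {y | y ∈ S.uGr χ I σ ∧ ∀ h : Cartan K X, S.uh χ h * y - y * S.uh χ h = ξ h • y}

/-! ### The category `𝒞_A` -/

variable (A : Type x) [CommRing A] [Algebra K A] (π : U0 K X →ₐ[K] A)

/-- A `U_χ ⊗ A`-module with subspaces `M_σ` (`σ ∈ X/ℤI`) and `M_σ^ξ` (`ξ ∈ 𝔥*`). -/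
structure GrMod where
  carrier : Type (max u v x)
  [addCommGroup : AddCommGroup carrier]
  [module : Module (S.U χ ⊗[K] A) carrier]
  gr : S.XI I → AddSubgroup carrier
  wt : S.XI I → Module.Dual K (Cartan K X) → AddSubgroup carrier

attribute [instance] GrMod.addCommGroup GrMod.module

variable {S χ I A}

/-- The conditions (A), (B), (C), (D) for an object of `𝒞_A`. -/
structure GrMod.IsObject (M : S.GrMod χ I A) : Prop where
  /-- `M = ⨁ M_σ`. -/
  gr_indep : iSupIndep M.gr
  gr_top : ⨆ σ, M.gr σ = ⊤
  /-- (A) -/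
  gr_smul : ∀ (σ) (a : A), ∀ m ∈ M.gr σ, ((1 : S.U χ) ⊗ₜ[K] a) • m ∈ M.gr σ
  /-- (B) -/
  gr_finite : {σ | M.gr σ ≠ ⊥}.Finite
  gr_fg : ∀ σ, ∃ s : Finset M.carrier,
    M.gr σ = AddSubgroup.closure {m | ∃ a : A, ∃ y ∈ s, m = ((1 : S.U χ) ⊗ₜ[K] a) • y}
  /-- (C) -/
  gr_mul : ∀ σ τ, ∀ y ∈ S.uGr χ I σ, ∀ m ∈ M.gr τ, (y ⊗ₜ[K] (1 : A)) • m ∈ M.gr (σ + τ)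
  /-- (D): `M_σ` is the direct sum of the `M_σ^{dμ}` with `μ ∈ σ + pX` (there is no summand for
  other elements of `𝔥*`) -/
  wt_indep : ∀ σ, iSupIndep (M.wt σ)
  wt_sum : ∀ σ, ⨆ ξ, M.wt σ ξ = M.gr σ
  wt_bot : ∀ σ, ∀ ξ ∉ S.weights I σ, M.wt σ ξ = ⊥
  wt_act : ∀ (σ) (μ : X), dchar μ ∈ S.weights I σ → ∀ (s : U0 K X), ∀ m ∈ M.wt σ (dchar μ),
    (S.u0 χ s ⊗ₜ[K] (1 : A)) • m = ((1 : S.U χ) ⊗ₜ[K] π (tilde μ s)) • m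
  wt_root : ∀ (σ) (μ : X) (α : S.R), dchar μ ∈ S.weights I σ → ∀ m ∈ M.wt σ (dchar μ),
    (S.ue χ α ⊗ₜ[K] (1 : A)) • m ∈ M.wt (S.cls I α.1 + σ) (dchar (μ + α.1))
  wt_smul : ∀ (σ ξ) (a : A), ∀ m ∈ M.wt σ ξ, ((1 : S.U χ) ⊗ₜ[K] a) • m ∈ M.wt σ ξ

variable (S χ I A)

/-- Objects of `𝒞_A`, where `A` is a commutative algebra over `U⁰` with structure map `π`. -/
structure Cat where
  obj : S.GrMod χ I A
  isObject : obj.IsObject π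

variable {S χ I A π}

/-- Morphisms of `𝒞_A`: `U_χ ⊗ A`-linear maps which send `M_σ^ξ` to `N_σ^ξ`. -/
@[ext]
structure Cat.Hom (M N : S.Cat χ I A π) where
  map : M.obj.carrier →ₗ[S.U χ ⊗[K] A] N.obj.carrier
  map_wt : ∀ σ, ∀ ξ ∈ S.weights I σ, ∀ m ∈ M.obj.wt σ ξ, map m ∈ N.obj.wt σ ξ

instance : CategoryTheory.Category (S.Cat χ I A π) where
  Hom := Cat.Hom
  id M := ⟨LinearMap.id, fun _ _ _ _ hm => hm⟩
  comp f g := ⟨g.map ∘ₗ f.map, fun σ ξ hξ m hm => g.map_wt σ ξ hξ _ (f.map_wt σ ξ hξ m hm)⟩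

/-- A submodule is a subobject in the category if it is the sum of its intersections with the
components `M_σ^ξ`. -/
def Cat.IsSubobject (M : S.Cat χ I A π) (N : Submodule (S.U χ ⊗[K] A) M.obj.carrier) : Prop :=
  N.toAddSubgroup ≤ ⨆ (σ) (ξ), N.toAddSubgroup ⊓ M.obj.wt σ ξ

/-- Irreducible objects: non-zero, without subobjects other than `0` and the whole object. -/
def Cat.IsIrreducible (M : S.Cat χ I A π) : Prop :=
  Nontrivial M.obj.carrier ∧ ∀ N, M.IsSubobject N → N = ⊥ ∨ N = ⊤

/-! ### Baby Verma modules -/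

variable (S χ A π)

/-- The relations defining `U_χ ⊗_{U⁰U⁺} A^lam` as a quotient of `U_χ ⊗ A`. On `A^lam` the algebra
`U⁰` acts by `s a = a π(tilde lam s)` and `e_α` acts as `0` for `α ∈ R⁺`; as `U⁰` and these `e_α`
generate the algebra `U⁰U⁺`, the tensor product has to be balanced over these elements. -/
def verRel (lam : X) : Submodule (S.U χ ⊗[K] A) (S.U χ ⊗[K] A) :=
  Submodule.span _
    ({z | ∃ (y : S.U χ) (α : S.R) (a : A), α.1 ∈ S.pos ∧ z = (y * S.ue χ α) ⊗ₜ[K] a} ∪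
     {z | ∃ (y : S.U χ) (s : U0 K X) (a : A),
        z = (y * S.u0 χ s) ⊗ₜ[K] a - y ⊗ₜ[K] (a * π (tilde lam s))})

variable (I)

/-- The baby Verma module `Z_{A,χ}(lam) = U_χ ⊗_{U⁰U⁺} A^lam` with its graded components, the images
of `(U_χ)_{σ - lam} ⊗ A` and of `(U_χ)_{σ - lam}^{ξ - d lam} ⊗ A`. -/
def babyVerma (lam : X) : S.GrMod χ I A where
  carrier := (S.U χ ⊗[K] A) ⧸ S.verRel χ A π lam
  gr σ := AddSubgroup.closure
    {z | ∃ y ∈ S.uGr χ I (σ - S.cls I lam), ∃ a : A, z = Submodule.Quotient.mk (y ⊗ₜ[K] a)}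
  wt σ ξ := AddSubgroup.closure
    {z | ∃ y ∈ S.uWt χ I (σ - S.cls I lam) (ξ - dchar lam), ∃ a : A,
      z = Submodule.Quotient.mk (y ⊗ₜ[K] a)}

end Setting

end BabyVerma

/-!
For a negative root `α` put `y_α = e_α - χ(e_α)`. Then `y_α ^ p = 0` in `U_χ`, and since `χ`
vanishes on `[𝔫⁻, 𝔫⁻]`, the commutators of the `y_α` are again multiples of them; it follows that
all sufficiently long products of the `y_α` vanish. The module `Z(λ)` is spanned by such products
applied to the highest weight vectors `F v`, so `Z(λ) = F v + ∑ y_α Z(λ)`, and by Nakayama's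
argument every proper submodule is contained in `∑ y_α Z(λ)`, which is itself proper as soon as
`Z(λ) ≠ 0`. Hence the sum of all proper subobjects is proper, and the quotient by it is the only
irreducible one.

That `Z(λ) ≠ 0` is shown without the Poincaré–Birkhoff–Witt theorem. As `p` is good, `p α` is not
a root; thus `e_α ^ [p] = 0`, and `e_α ^ p` is central in `U(𝔤)`. On the module induced from a
character of `𝔟`, constructed directly as an action of `𝔤` on `F ⊗ U(𝔫⁻)`, the character `χ` of
`𝔫⁻` gives a functional `θ` on `U(𝔤)` with `θ(1) = 1` on which `𝔫⁻` acts from the left and `𝔟`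
from the right by characters. It kills the central elements `e_α ^ p - χ(e_α) ^ p`, hence descends
to `Z(λ)`.
-/

namespace BabyVerma

universe u v w x

/-! ### Points of a torus and differentials of characters -/

section Torus

variable {K : Type u} [Field K] {O : Type v} [CommRing O] [HopfAlgebra K O]
variable {X : Type w} [AddCommGroup X]

lemma Points.toDual_mul (g h : Points K O) : (g * h).toDual = g.toDual * h.toDual := rfl

lemma Points.toDual_one : (1 : Points K O).toDual = 1 := rfl

lemma Points.toDual_inv_mul (g : Points K O) : (g⁻¹).toDual * g.toDual = 1 := by
  rw [← toDual_mul, inv_mul_cancel, toDual_one]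

lemma Points.toDual_mul_inv (g : Points K O) : g.toDual * (g⁻¹).toDual = 1 := by
  rw [← toDual_mul, mul_inv_cancel, toDual_one]

lemma charValue_add (a b : X) (t : Points K (AddMonoidAlgebra K X)) :
    charValue (a + b) t = charValue a t * charValue b t := by
  simp only [charValue, ← map_mul, AddMonoidAlgebra.single_mul_single, one_mul]

lemma charValue_zero (t : Points K (AddMonoidAlgebra K X)) : charValue 0 t = 1 :=
  map_one t.ofConv

lemma charValue_one (a : X) : charValue a (1 : Points K (AddMonoidAlgebra K X)) = 1 := by
  change (1 : Points K (AddMonoidAlgebra K X)).toDual.ofConv _ = _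
  simp [Points.toDual_one]

lemma charValue_mul (a : X) (s t : Points K (AddMonoidAlgebra K X)) :
    charValue a (s * t) = charValue a s * charValue a t := by
  change (s * t).toDual.ofConv _ = s.toDual.ofConv _ * t.toDual.ofConv _
  rw [Points.toDual_mul, LinearMap.convMul_apply]
  simp

variable (K) in
/-- The character `a ∈ X` of the torus `T = Spec K[X]` as a homomorphism `T(K) → K`. -/
def charHom (a : X) : Points K (AddMonoidAlgebra K X) →* K where
  toFun := charValue a
  map_one' := charValue_one a
  map_mul' := charValue_mul a

/-- The point of `T` with `charValue a t = ψ a` for all `a ∈ X`. -/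
def pointOfHom (ψ : Multiplicative X →* K) : Points K (AddMonoidAlgebra K X) :=
  toConv (AddMonoidAlgebra.lift K K X ψ)

lemma charValue_pointOfHom (ψ : Multiplicative X →* K) (a : X) :
    charValue a (pointOfHom ψ) = ψ (Multiplicative.ofAdd a) := by
  simp [charValue, pointOfHom]

lemma exists_zpow_ne_one [Infinite K] {n : ℤ} (hn : n ≠ 0) : ∃ c : Kˣ, c ^ n ≠ 1 := by
  by_contra! h
  have : NeZero n.natAbs := ⟨Int.natAbs_ne_zero.mpr hn⟩
  have rootsOfUnity_eq_top : rootsOfUnity n.natAbs K = ⊤ :=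
    eq_top_iff.mpr fun c _ => pow_natAbs_eq_one.mpr (h c)
  have : Finite (⊤ : Subgroup Kˣ) := rootsOfUnity_eq_top ▸ inferInstance
  have : Finite Kˣ := Finite.of_equiv _ Subgroup.topEquiv.toEquiv
  classical
  have : Finite (WithZero Kˣ) := inferInstanceAs (Finite (Option Kˣ))
  exact not_finite_iff_infinite.mpr ‹_› (Finite.of_equiv _ WithZero.withZeroUnitsEquiv.toEquiv)

section Infinite

variable [Infinite K] [Module.Free ℤ X]

lemma exists_charValue_ne {a b : X} (hab : a ≠ b) :
    ∃ t : Points K (AddMonoidAlgebra K X), charValue a t ≠ charValue b t := by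
  let B := Module.Free.chooseBasis ℤ X
  obtain ⟨i, hi⟩ : ∃ i, B.repr a i ≠ B.repr b i := by
    by_contra! h
    exact hab (B.repr.injective (Finsupp.ext h))
  obtain ⟨c, hc⟩ := exists_zpow_ne_one (K := K) (sub_ne_zero.mpr hi)
  let ψ : Multiplicative X →* Kˣ := AddMonoidHom.toMultiplicativeLeft
    ((zmultiplesHom (Additive Kˣ) (Additive.ofMul c)).comp (B.coord i).toAddMonoidHom)
  refine ⟨pointOfHom ((Units.coeHom K).comp ψ), fun h => hc ?_⟩
  rw [charValue_pointOfHom, charValue_pointOfHom] at h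
  have zpow_eq : c ^ B.repr a i = c ^ B.repr b i := Units.ext h
  rw [zpow_sub, zpow_eq, mul_inv_cancel]

lemma charHom_injective : Function.Injective (charHom K (X := X)) := fun a b hab => by
  by_contra hne
  obtain ⟨t, ht⟩ := exists_charValue_ne (K := K) hne
  exact ht (DFunLike.congr_fun hab t)

lemma eq_of_forall_point {f g : AddMonoidAlgebra K X}
    (h : ∀ t : Points K (AddMonoidAlgebra K X), t.ofConv f = t.ofConv g) : f = g := by
  have independent := (linearIndependent_monoidHom (Points K (AddMonoidAlgebra K X)) K).comp _
    (charHom_injective (K := K) (X := X))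
  have evaluation : ∀ (q : AddMonoidAlgebra K X) (t : Points K (AddMonoidAlgebra K X)),
      t.ofConv q = Finsupp.linearCombination K (fun a => ⇑(charHom K a)) q.coeff t := by
    intro q t
    induction q using AddMonoidAlgebra.induction_linear with
    | zero => simp
    | add a b ha hb => simp only [map_add, AddMonoidAlgebra.coeff_add, Pi.add_apply, ha, hb]
    | single a c =>
      rw [← mul_one c, ← AddMonoidAlgebra.smul_single', map_smul]
      simp [charHom, charValue]
  refine AddMonoidAlgebra.coeff_injective (independent ?_)
  funext t
  exact (evaluation f t).symm.trans ((h t).trans (evaluation g t))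

end Infinite

lemma dchar_apply (a : X) (h : Cartan K X) :
    dchar a h = h.1.ofConv (AddMonoidAlgebra.single a 1) := rfl

lemma dchar_add (a b : X) : dchar (K := K) (a + b) = dchar a + dchar b := by
  ext h
  have leibniz := h.2 (AddMonoidAlgebra.single a 1) (AddMonoidAlgebra.single b 1)
  rw [AddMonoidAlgebra.single_mul_single, one_mul] at leibniz
  simp [dchar_apply, leibniz, add_comm]

variable (K X) in
/-- The differential of characters as a homomorphism `X → 𝔥*`. -/
def dcharHom : X →+ Module.Dual K (Cartan K X) := AddMonoidHom.mk' dchar dchar_add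

lemma dchar_zero : dchar (K := K) (0 : X) = 0 := map_zero (dcharHom K X)

lemma dchar_sub (a b : X) : dchar (K := K) (a - b) = dchar a - dchar b :=
  map_sub (dcharHom K X) a b

lemma cartan_ext {h h' : Cartan K X} (eq : ∀ a, dchar a h = dchar a h') : h = h' := by
  refine Subtype.ext (ofConv_injective ?_)
  ext a
  exact eq a

lemma cartan_lie (h h' : Cartan K X) : ⁅h, h'⁆ = 0 :=
  cartan_ext fun a => by rw [dchar_lie, map_zero]

lemma tilde_ι (a : X) (h : Cartan K X) :
    tilde a (UniversalEnvelopingAlgebra.ι K h) =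
      UniversalEnvelopingAlgebra.ι K h + algebraMap K (U0 K X) (dchar a h) := by
  rw [tilde, UniversalEnvelopingAlgebra.lift_ι_apply]
  rfl

lemma tilde_tilde (a b : X) (s : U0 K X) : tilde a (tilde b s) = tilde (a + b) s := by
  refine AlgHom.congr_fun (φ₁ := (tilde a).comp (tilde b)) ?_ s
  refine UniversalEnvelopingAlgebra.hom_ext K (LieHom.ext fun h => ?_)
  change tilde a (tilde b (UniversalEnvelopingAlgebra.ι K h)) =
    tilde (a + b) (UniversalEnvelopingAlgebra.ι K h)
  simp only [tilde_ι, map_add, AlgHom.commutes, dchar_add, LinearMap.add_apply]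
  abel

lemma lieMap_injective {r : O →ₐc[K] AddMonoidAlgebra K X} (hr : Function.Surjective r) :
    Function.Injective (lieMap r) := by
  intro h h' eq
  refine cartan_ext fun a => ?_
  obtain ⟨f, hf⟩ := hr (AddMonoidAlgebra.single a 1)
  have eq_on_f : h.1.ofConv (r f) = h'.1.ofConv (r f) :=
    congrArg (fun D : lieAlg K O => D.1.ofConv f) eq
  rwa [hf] at eq_on_f

end Torus

/-! ### Weight spaces of the Lie algebra and its `p`-th power map -/

lemma add_pow_char_of_algebra (K : Type u) [CommRing K] (p : ℕ) [Fact p.Prime] [CharP K p]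
    {A : Type v} [Ring A] [Algebra K A] {a b : A} (h : Commute a b) :
    (a + b) ^ p = a ^ p + b ^ p := by
  have cast_eq_zero : (p : A) = 0 := by
    rw [← map_natCast (algebraMap K A), CharP.cast_eq_zero, map_zero]
  rw [h.add_pow_prime_eq Fact.out, cast_eq_zero, zero_mul, zero_mul, zero_mul, add_zero]

lemma sub_pow_char_of_algebra (K : Type u) [CommRing K] (p : ℕ) [Fact p.Prime] [CharP K p]
    {A : Type v} [Ring A] [Algebra K A] {a b : A} (h : Commute a b) :
    (a - b) ^ p = a ^ p - b ^ p := by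
  rw [eq_sub_iff_add_eq, ← add_pow_char_of_algebra K p (h.sub_left (Commute.refl b)),
    sub_add_cancel]

lemma ad_pow_char (K : Type u) [CommRing K] (p : ℕ) [Fact p.Prime] [CharP K p]
    {A : Type v} [Ring A] [Algebra K A] (a : A) :
    LieAlgebra.ad K A a ^ p = LieAlgebra.ad K A (a ^ p) := by
  simp only [LieAlgebra.ad_eq_lmul_left_sub_lmul_right, Pi.sub_apply]
  rw [sub_pow_char_of_algebra K p (LinearMap.commute_mulLeft_right a a),
    LinearMap.pow_mulLeft, LinearMap.pow_mulRight]

lemma map_ad_pow_apply {K : Type u} [CommRing K] {L : Type v} [LieRing L] [LieAlgebra K L]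
    {L' : Type w} [LieRing L'] [LieAlgebra K L'] (f : L →ₗ⁅K⁆ L') (x y : L) (n : ℕ) :
    f ((LieAlgebra.ad K L x ^ n) y) = (LieAlgebra.ad K L' (f x) ^ n) (f y) := by
  induction n with
  | zero => rfl
  | succ n ih => rw [pow_succ', pow_succ', Module.End.mul_apply, Module.End.mul_apply,
      LieAlgebra.ad_apply, LieAlgebra.ad_apply, LieHom.map_lie, ih]

section PointDerivations

variable {K : Type u} [Field K] {O : Type v} [CommRing O] [HopfAlgebra K O]

/-- Pulling back functionals along a homomorphism of coalgebras, as a homomorphism of convolution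
algebras. -/
def convPullback {C D : Type*} [AddCommGroup C] [Module K C] [Coalgebra K C] [AddCommGroup D]
    [Module K D] [Coalgebra K D] (φ : C →ₗc[K] D) :
    WithConv (D →ₗ[K] K) →+* WithConv (C →ₗ[K] K) where
  toFun a := toConv (a.ofConv ∘ₗ φ.toLinearMap)
  map_one' := by
    ext c
    simp [LinearMap.convOne_def]
  map_mul' a b := congrArg toConv (LinearMap.convMul_comp_coalgHom_distrib a b φ)
  map_zero' := rfl
  map_add' _ _ := rfl

lemma convPullback_apply {C D : Type*} [AddCommGroup C] [Module K C] [Coalgebra K C]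
    [AddCommGroup D] [Module K D] [Coalgebra K D] (φ : C →ₗc[K] D) (a : WithConv (D →ₗ[K] K))
    (c : C) : (convPullback φ a).ofConv c = a.ofConv (φ c) := rfl

variable (K O) in
/-- The comorphism `f ⊗ g ↦ f ε(g)` of the inclusion of the first factor of `G × G`. -/
def fstCoalgHom : O ⊗[K] O →ₗc[K] O :=
  (Coalgebra.TensorProduct.rid K K O).toCoalgHom.comp
    (Coalgebra.TensorProduct.map (.id K O) (Coalgebra.counitCoalgHom K O))

variable (K O) in
/-- The comorphism `f ⊗ g ↦ ε(f) g` of the inclusion of the second factor of `G × G`. -/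
def sndCoalgHom : O ⊗[K] O →ₗc[K] O :=
  (Coalgebra.TensorProduct.lid K O).toCoalgHom.comp
    (Coalgebra.TensorProduct.map (Coalgebra.counitCoalgHom K O) (.id K O))

lemma fstCoalgHom_tmul (f g : O) :
    fstCoalgHom K O (f ⊗ₜ g) = Coalgebra.counit (R := K) g • f := by
  simp [fstCoalgHom]

lemma sndCoalgHom_tmul (f g : O) :
    sndCoalgHom K O (f ⊗ₜ g) = Coalgebra.counit (R := K) f • g := by
  simp [sndCoalgHom]

lemma mem_lieAlg_iff (D : ConvDual K O) : D ∈ lieAlg K O ↔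
    convPullback (Bialgebra.mulCoalgHom K O) D =
      convPullback (fstCoalgHom K O) D + convPullback (sndCoalgHom K O) D := by
  constructor
  · intro hD
    apply ofConv_injective
    ext f g
    change D.ofConv (f * g) =
      D.ofConv (fstCoalgHom K O (f ⊗ₜ g)) + D.ofConv (sndCoalgHom K O (f ⊗ₜ g))
    rw [hD f g, fstCoalgHom_tmul, sndCoalgHom_tmul, map_smul, map_smul, smul_eq_mul, smul_eq_mul]
    ring
  · intro hD f g
    have leibniz := congrArg (fun a : ConvDual K (O ⊗[K] O) => a.ofConv (f ⊗ₜ g)) hD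
    simp only [convPullback_apply, fstCoalgHom_tmul, sndCoalgHom_tmul, ofConv_add,
      LinearMap.add_apply, map_smul, smul_eq_mul] at leibniz
    rw [add_comm, mul_comm (D.ofConv f)]
    exact leibniz

lemma convPullback_fst_mul_snd_apply (a b : ConvDual K O) (f g : O) :
    (convPullback (fstCoalgHom K O) a * convPullback (sndCoalgHom K O) b).ofConv (f ⊗ₜ g) =
      a.ofConv f * b.ofConv g := by
  let rf := Coalgebra.Repr.arbitrary K f
  let rg := Coalgebra.Repr.arbitrary K g
  rw [← mul_one a, ← one_mul b, rf.convMul_apply, rg.convMul_apply, mul_one, one_mul,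
    (rf.tmul rg).convMul_apply, Finset.sum_mul_sum, ← Finset.sum_product']
  refine Finset.sum_congr rfl fun i _ => ?_
  simp only [Coalgebra.Repr.tmul_left, Coalgebra.Repr.tmul_right, convPullback_apply,
    fstCoalgHom_tmul, sndCoalgHom_tmul, map_smul, smul_eq_mul, LinearMap.convOne_apply,
    Algebra.algebraMap_self_apply]
  ring

lemma convPullback_snd_mul_fst_apply (a b : ConvDual K O) (f g : O) :
    (convPullback (sndCoalgHom K O) b * convPullback (fstCoalgHom K O) a).ofConv (f ⊗ₜ g) =
      a.ofConv f * b.ofConv g := by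
  let rf := Coalgebra.Repr.arbitrary K f
  let rg := Coalgebra.Repr.arbitrary K g
  rw [← one_mul a, ← mul_one b, rf.convMul_apply, rg.convMul_apply, mul_one, one_mul,
    (rf.tmul rg).convMul_apply, Finset.sum_mul_sum, ← Finset.sum_product']
  refine Finset.sum_congr rfl fun i _ => ?_
  simp only [Coalgebra.Repr.tmul_left, Coalgebra.Repr.tmul_right, convPullback_apply,
    fstCoalgHom_tmul, sndCoalgHom_tmul, map_smul, smul_eq_mul, LinearMap.convOne_apply,
    Algebra.algebraMap_self_apply]
  ring

lemma commute_convPullback_fst_snd (a b : ConvDual K O) :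
    Commute (convPullback (fstCoalgHom K O) a) (convPullback (sndCoalgHom K O) b) := by
  apply ofConv_injective
  ext f g
  exact (convPullback_fst_mul_snd_apply a b f g).trans
    (convPullback_snd_mul_fst_apply a b f g).symm

/-- Elements of `Lie(G)` are the primitive elements of the convolution algebra, and in
characteristic `p` the `p`-th power is additive on commuting elements. -/
lemma pow_mem_lieAlg (p : ℕ) [Fact p.Prime] [CharP K p] {D : ConvDual K O}
    (hD : D ∈ lieAlg K O) : D ^ p ∈ lieAlg K O := by
  rw [mem_lieAlg_iff] at hD ⊢
  rw [map_pow, hD, add_pow_char_of_algebra K p (commute_convPullback_fst_snd D D), map_pow,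
    map_pow]

lemma finite_lieAlg [Algebra.FiniteType K O] : Module.Finite K (lieAlg K O) := by
  obtain ⟨s, hs⟩ := (inferInstance : Algebra.FiniteType K O).out
  let evalOnGenerators : lieAlg K O →ₗ[K] (s → K) :=
    { toFun := fun D f => D.1.ofConv f.1
      map_add' := fun _ _ => rfl
      map_smul' := fun _ _ => rfl }
  apply Module.Finite.of_injective evalOnGenerators
  rw [← LinearMap.ker_eq_bot, LinearMap.ker_eq_bot']
  intro D hD
  have apply_one : D.1.ofConv 1 = 0 := by simpa using D.2 1 1
  apply Subtype.ext
  apply ofConv_injective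
  ext f
  have hf : f ∈ Algebra.adjoin K (s : Set O) := hs ▸ Algebra.mem_top
  change D.1.ofConv f = 0
  induction hf using Algebra.adjoin_induction with
  | mem x hx => exact congrFun hD ⟨x, hx⟩
  | algebraMap c => rw [Algebra.algebraMap_eq_smul_one, map_smul, apply_one, smul_zero]
  | add x y _ _ hx hy => rw [map_add, hx, hy, add_zero]
  | mul x y _ _ hx hy => rw [D.2, hx, hy, mul_zero, zero_mul, add_zero]

end PointDerivations

section WeightSpaces

variable {K : Type u} [Field K] {O : Type v} [CommRing O] [HopfAlgebra K O]
variable {X : Type w} [AddCommGroup X] (r : O →ₐc[K] AddMonoidAlgebra K X)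

lemma mem_weightSpace_iff {a : X} {D : lieAlg K O} : D ∈ weightSpace r a ↔
    ∀ t : Points K (AddMonoidAlgebra K X),
      (torPoint r t).toDual * D.1 = charValue a t • (D.1 * (torPoint r t).toDual) := by
  constructor
  · intro h t
    rw [← smul_mul_assoc, ← h t, mul_assoc, Points.toDual_inv_mul, mul_one]
  · intro h t
    rw [h t, smul_mul_assoc, mul_assoc, Points.toDual_mul_inv, mul_one]

lemma torPoint_mul_mul {a b : X} {x y : ConvDual K O} {t : Points K (AddMonoidAlgebra K X)}
    (hx : (torPoint r t).toDual * x = charValue a t • (x * (torPoint r t).toDual))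
    (hy : (torPoint r t).toDual * y = charValue b t • (y * (torPoint r t).toDual)) :
    (torPoint r t).toDual * (x * y) = charValue (a + b) t • (x * y * (torPoint r t).toDual) := by
  rw [← mul_assoc, hx, smul_mul_assoc, mul_assoc, hy, mul_smul_comm, smul_smul, charValue_add,
    mul_assoc]

lemma torPoint_mul_pow {a : X} {x : ConvDual K O} {t : Points K (AddMonoidAlgebra K X)}
    (hx : (torPoint r t).toDual * x = charValue a t • (x * (torPoint r t).toDual)) (n : ℕ) :
    (torPoint r t).toDual * x ^ n = charValue (n • a) t • (x ^ n * (torPoint r t).toDual) := by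
  induction n with
  | zero => simp [charValue_zero]
  | succ n ih =>
    rw [pow_succ, succ_nsmul]
    exact torPoint_mul_mul r ih hx

lemma lie_mem_weightSpace {a b : X} {x y : lieAlg K O} (hx : x ∈ weightSpace r a)
    (hy : y ∈ weightSpace r b) : ⁅x, y⁆ ∈ weightSpace r (a + b) := by
  rw [mem_weightSpace_iff] at hx hy ⊢
  intro t
  change _ * (x.1 * y.1 - y.1 * x.1) = _ • ((x.1 * y.1 - y.1 * x.1) * _)
  rw [mul_sub, sub_mul, smul_sub, torPoint_mul_mul r (hx t) (hy t),
    torPoint_mul_mul r (hy t) (hx t), add_comm b a]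

lemma pow_mem_weightSpace (p : ℕ) [Fact p.Prime] [CharP K p] {a : X} {D : lieAlg K O}
    (hD : D ∈ weightSpace r a) :
    (⟨D.1 ^ p, pow_mem_lieAlg p D.2⟩ : lieAlg K O) ∈ weightSpace r (p • a) := by
  rw [mem_weightSpace_iff] at hD ⊢
  exact fun t => torPoint_mul_pow r (hD t) p

lemma lieMap_mem_weightSpace (h : Cartan K X) : lieMap r h ∈ weightSpace r 0 := by
  rw [mem_weightSpace_iff]
  intro t
  rw [charValue_zero, one_smul]
  have torus_commutes : t.toDual * h.1 = h.1 * t.toDual := mul_comm _ _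
  have pullback := congrArg (convPullback (r : O →ₗc[K] AddMonoidAlgebra K X)) torus_commutes
  rwa [map_mul, map_mul] at pullback

section

variable [Infinite K] [Module.Free ℤ X] {a : X} {D : lieAlg K O}

/-- The identity `t D = a(t) D t`, for all points `t` of the torus, as an identity in `K[X]`. -/
lemma sum_smul_torus_left_eq (hD : D ∈ weightSpace r a) {f : O} {ι : Type*}
    (rf : Coalgebra.Repr K f ι) :
    ∑ i ∈ rf.index, D.1.ofConv (rf.right i) • r (rf.left i) =
      AddMonoidAlgebra.single a 1 *
        ∑ i ∈ rf.index, D.1.ofConv (rf.left i) • r (rf.right i) := by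
  refine eq_of_forall_point fun t => ?_
  have apply_f := congrArg (fun z : ConvDual K O => z.ofConv f)
    ((mem_weightSpace_iff r).mp hD t)
  simp only [ofConv_smul, LinearMap.smul_apply, rf.convMul_apply, smul_eq_mul] at apply_f
  simp only [map_mul, map_sum, map_smul, smul_eq_mul]
  exact (Finset.sum_congr rfl fun i _ => mul_comm _ _).trans apply_f

lemma lie_weightSpace (hD : D ∈ weightSpace r a) (h : Cartan K X) :
    ⁅lieMap r h, D⁆ = dchar a h • D := by
  apply Subtype.ext
  apply ofConv_injective
  ext f
  let rf := Coalgebra.Repr.arbitrary K f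
  have apply_h := congrArg h.1.ofConv (sum_smul_torus_left_eq r hD rf)
  have counit_r (y : O) : Coalgebra.counit (R := K) (r y) = Coalgebra.counit (R := K) y :=
    CoalgHomClass.counit_comp_apply r y
  simp only [h.2 (AddMonoidAlgebra.single a 1), map_sum, map_smul, smul_eq_mul,
    counit_r] at apply_h
  have h_mul_D : ((lieMap r h).1 * D.1).ofConv f =
      ∑ i ∈ rf.index, D.1.ofConv (rf.right i) * h.1.ofConv (r (rf.left i)) := by
    rw [rf.convMul_apply]
    exact Finset.sum_congr rfl fun i _ => mul_comm _ _
  have D_mul_h : (D.1 * (lieMap r h).1).ofConv f =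
      ∑ i ∈ rf.index, D.1.ofConv (rf.left i) * h.1.ofConv (r (rf.right i)) :=
    rf.convMul_apply ..
  have D_mul_one : D.1.ofConv f = ∑ i ∈ rf.index,
      D.1.ofConv (rf.left i) * Coalgebra.counit (R := K) (rf.right i) := by
    rw [← mul_one D.1]
    exact (rf.convMul_apply ..).trans (by simp)
  change ((lieMap r h).1 * D.1).ofConv f - (D.1 * (lieMap r h).1).ofConv f = _
  rw [h_mul_D, apply_h, ← D_mul_h, ← D_mul_one]
  simp [dchar_apply]

end

end WeightSpaces

/-! ### Root vectors and the centrality of their `p`-th powers -/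

section EnvelopingAlgebra

open UniversalEnvelopingAlgebra

variable {K : Type u} [CommRing K] {L : Type v} [LieRing L] [LieAlgebra K L]

lemma subalgebra_eq_top_of_ι_mem (B : Subalgebra K (UniversalEnvelopingAlgebra K L))
    (hB : ∀ x, ι K x ∈ B) : B = ⊤ := by
  let inclB : L →ₗ⁅K⁆ B :=
    { toFun := fun x => ⟨ι K x, hB x⟩
      map_add' := fun x y => Subtype.ext (map_add _ x y)
      map_smul' := fun c x => Subtype.ext (map_smul _ c x)
      map_lie' := fun {x y} => Subtype.ext (LieHom.map_lie _ x y) }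
  have val_comp_lift : B.val.comp (lift K inclB) = AlgHom.id K _ := by
    apply hom_ext
    ext x
    simp [inclB]
  refine Algebra.eq_top_iff.mpr fun y => ?_
  have hy : (lift K inclB y : UniversalEnvelopingAlgebra K L) = y :=
    AlgHom.congr_fun val_comp_lift y
  exact hy ▸ (lift K inclB y).2

@[elab_as_elim]
lemma ι_mul_induction {P : UniversalEnvelopingAlgebra K L → Prop} (one : P 1)
    (add : ∀ u v, P u → P v → P (u + v)) (smul : ∀ (c : K) u, P u → P (c • u))
    (ι_mul : ∀ x u, P u → P (ι K x * u)) (u : UniversalEnvelopingAlgebra K L) : P u := by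
  let B : Subalgebra K (UniversalEnvelopingAlgebra K L) :=
    { carrier := {a | ∀ u, P u → P (a * u)}
      mul_mem' := fun {a b} ha hb u hu => by rw [mul_assoc]; exact ha _ (hb _ hu)
      add_mem' := fun {a b} ha hb u hu => by rw [add_mul]; exact add _ _ (ha _ hu) (hb _ hu)
      algebraMap_mem' := fun c u hu => by rw [← Algebra.smul_def]; exact smul _ _ hu }
  have hu : u ∈ B := subalgebra_eq_top_of_ι_mem B ι_mul ▸ Algebra.mem_top
  simpa using hu 1 one

end EnvelopingAlgebra

namespace Setting

variable {K : Type u} [Field K] {p : ℕ} {O : Type v} [CommRing O] [HopfAlgebra K O]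
variable {X : Type w} [AddCommGroup X] (S : Setting K p O X)

lemma finite_roots [Algebra.FiniteType K O] : Finite S.R := by
  have : Module.Finite K (lieAlg K O) := finite_lieAlg
  have : Finite (S.R ⊕ Fin (Module.finrank ℤ X)) := Module.Finite.finite_basis S.basis
  exact Finite.sum_left (Fin (Module.finrank ℤ X))

/-- The weight of an element of the basis of `𝔤`. -/
def idxWt : S.R ⊕ Fin (Module.finrank ℤ X) → X := Sum.elim Subtype.val fun _ => 0

lemma basis_mem_weightSpace (b) : S.basis b ∈ weightSpace S.torus (S.idxWt b) := by
  rcases b with α | i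
  · exact S.basis_root α
  · obtain ⟨h, hh⟩ := S.basis_cartan i
    rw [hh]
    exact lieMap_mem_weightSpace _ h

lemma e_mem_weightSpace (α : S.R) : S.e α ∈ weightSpace S.torus α.1 := S.basis_root α

lemma repr_conj_torPoint (t : Points K (AddMonoidAlgebra K X)) {x y : lieAlg K O}
    (hxy : (torPoint S.torus t).toDual * x.1 * ((torPoint S.torus t)⁻¹).toDual = y.1) (b) :
    S.basis.repr y b = charValue (S.idxWt b) t * S.basis.repr x b := by
  let Ad : lieAlg K O →ₗ[K] lieAlg K O :=
    S.basis.constr K fun b => charValue (S.idxWt b) t • S.basis b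
  have Ad_basis (b) : Ad (S.basis b) = charValue (S.idxWt b) t • S.basis b :=
    S.basis.constr_basis K _ b
  have coe_Ad : (LinearMap.mulRight K ((torPoint S.torus t)⁻¹).toDual ∘ₗ
      LinearMap.mulLeft K (torPoint S.torus t).toDual) ∘ₗ (lieAlg K O).toSubmodule.subtype =
      (lieAlg K O).toSubmodule.subtype ∘ₗ Ad := by
    refine S.basis.ext fun b => ?_
    change (torPoint S.torus t).toDual * (S.basis b).1 * ((torPoint S.torus t)⁻¹).toDual =
      (Ad (S.basis b)).1
    rw [S.basis_mem_weightSpace b t, Ad_basis]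
    rfl
  have coord_Ad : S.basis.coord b ∘ₗ Ad = charValue (S.idxWt b) t • S.basis.coord b := by
    refine S.basis.ext fun b' => ?_
    obtain rfl | hb := eq_or_ne b' b
    · simp [Ad_basis]
    · simp [Ad_basis, hb]
  have y_eq : y = Ad x := Subtype.ext (hxy.symm.trans (LinearMap.congr_fun coe_Ad x))
  rw [y_eq]
  exact LinearMap.congr_fun coord_Ad x

lemma eq_zero_of_not_root {γ : X} (h0 : γ ≠ 0) (hγ : γ ∉ S.R) {x : lieAlg K O}
    (hx : x ∈ weightSpace S.torus γ) : x = 0 := by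
  by_contra hne
  exact hγ ⟨h0, fun hbot => hne ((Submodule.mem_bot K).mp (hbot ▸ hx))⟩

section

variable [Infinite K] [Module.Free ℤ X]

lemma repr_eq_zero_of_idxWt_ne {γ : X} {x : lieAlg K O} (hx : x ∈ weightSpace S.torus γ) {b}
    (hb : S.idxWt b ≠ γ) : S.basis.repr x b = 0 := by
  obtain ⟨t, ht⟩ := exists_charValue_ne (K := K) hb
  have two_values := S.repr_conj_torPoint t (y := charValue γ t • x) (hx t) b
  rw [map_smul, Finsupp.smul_apply, smul_eq_mul] at two_values
  by_contra hne
  exact ht (mul_right_cancel₀ hne two_values).symm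

lemma eq_smul_e_of_mem_weightSpace {α : S.R} {x : lieAlg K O}
    (hx : x ∈ weightSpace S.torus α.1) : x = S.basis.repr x (Sum.inl α) • S.e α := by
  apply S.basis.repr.injective
  ext b
  obtain rfl | hb := eq_or_ne b (Sum.inl α)
  · simp [e]
  · rw [S.repr_eq_zero_of_idxWt_ne hx]
    · simp [e, hb.symm]
    · rcases b with β | i
      · exact fun h => hb (congrArg _ (Subtype.ext h))
      · exact fun h => α.2.1 h.symm

lemma e_mem_borel {α : S.R} (hα : α.1 ∈ S.pos) : S.e α ∈ lieOf S.borel := by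
  obtain ⟨x, ⟨x_mem, x_mem_borel⟩, hne⟩ := Submodule.exists_mem_ne_zero_of_ne_bot hα.2
  have x_eq := S.eq_smul_e_of_mem_weightSpace x_mem
  have hc : S.basis.repr x (Sum.inl α) ≠ 0 := fun h => hne (by rw [x_eq, h, zero_smul])
  have smul_mem : S.basis.repr x (Sum.inl α) • S.e α ∈ lieOf S.borel := x_eq ▸ x_mem_borel
  exact (Submodule.smul_mem_iff _ hc).mp smul_mem

end

lemma exists_height : ∃ f : X →ₗ[ℤ] ℚ, ∀ s ∈ S.simple, f s = 1 := by
  let b := Module.Basis.span S.simple_indep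
  obtain ⟨f, hf⟩ := (Module.Baer.of_divisible ℚ).extension_property
    (Submodule.subtype _) Subtype.val_injective (b.constr ℤ fun _ => (1 : ℚ))
  refine ⟨f, fun s hs => ?_⟩
  have coe_b : (b ⟨s, hs⟩ : X) = s :=
    congrArg Subtype.val (Module.Basis.span_apply S.simple_indep ⟨s, hs⟩)
  rw [← coe_b]
  exact (LinearMap.congr_fun hf (b ⟨s, hs⟩)).trans (b.constr_basis ℤ _ _)

/-- The height of a character, extended from `ℤΠ` to `X` with rational values. -/
def ht : X →ₗ[ℤ] ℚ := S.exists_height.choose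

lemma ht_simple {s : X} (hs : s ∈ S.simple) : S.ht s = 1 := S.exists_height.choose_spec s hs

lemma one_le_ht {α : X} (hα : α ∈ S.pos) : 1 ≤ S.ht α := by
  suffices ∀ a ∈ AddSubmonoid.closure S.simple, a = 0 ∨ 1 ≤ S.ht a from
    (this α (S.pos_sum α hα)).resolve_left hα.1
  intro a ha
  induction ha using AddSubmonoid.closure_induction with
  | mem s hs => exact Or.inr (S.ht_simple hs).ge
  | zero => exact Or.inl rfl
  | add a b _ _ iha ihb =>
    rcases iha with rfl | iha
    · rwa [zero_add]
    · rcases ihb with rfl | ihb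
      · exact Or.inr (by rwa [add_zero])
      · exact Or.inr (by rw [map_add]; linarith)

lemma ht_le_neg_one {α : X} (hα : α ∈ S.R) (hneg : α ∉ S.pos) : S.ht α ≤ -1 := by
  have one_le := S.one_le_ht ((S.pos_or_neg α hα).resolve_left hneg)
  rw [map_neg] at one_le
  linarith

lemma mem_pos_iff {α : X} (hα : α ∈ S.R) : α ∈ S.pos ↔ 0 < S.ht α := by
  refine ⟨fun hpos => by linarith [S.one_le_ht hpos], fun hht => ?_⟩
  by_contra hneg
  linarith [S.ht_le_neg_one hα hneg]

lemma ht_ne_zero {α : X} (hα : α ∈ S.R) : S.ht α ≠ 0 := by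
  by_cases hpos : α ∈ S.pos
  · linarith [S.one_le_ht hpos]
  · linarith [S.ht_le_neg_one hα hpos]

lemma exists_finsupp_of_mem_closure {α : X} (hα : α ∈ AddSubmonoid.closure S.simple) :
    ∃ c : S.simple →₀ ℕ, (c.sum fun β n => n • β.1) = α := by
  induction hα using AddSubmonoid.closure_induction with
  | mem s hs => exact ⟨Finsupp.single ⟨s, hs⟩ 1, by simp⟩
  | zero => exact ⟨0, by simp⟩
  | add a b _ _ iha ihb =>
    obtain ⟨c, hc⟩ := iha
    obtain ⟨d, hd⟩ := ihb
    refine ⟨c + d, ?_⟩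
    rw [Finsupp.sum_add_index' (by simp) (by intros; rw [add_smul]), hc, hd]

variable {S}

lemma IsGood.nsmul_notMem_pos (hp : S.IsGood) {α : X} (hα : α ∈ S.pos) : p • α ∉ S.pos := by
  intro hpα
  obtain ⟨c, hc⟩ := S.exists_finsupp_of_mem_closure (S.pos_sum α hα)
  have sum_nsmul : ((p • c).sum fun β n => n • β.1) = p • α := by
    rw [Finsupp.sum_smul_index' (by simp), ← hc, Finsupp.smul_sum]
    exact Finsupp.sum_congr fun _ _ => by rw [smul_assoc]
  have coeff_eq_zero : p • c = 0 :=
    Finsupp.ext fun β => hp (p • c) (sum_nsmul ▸ hpα) β ⟨c β, by simp⟩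
  rw [coeff_eq_zero, Finsupp.sum_zero_index] at sum_nsmul
  exact hpα.1 sum_nsmul.symm

lemma IsGood.nsmul_notMem_roots (hp : S.IsGood) {α : X} (hα : α ∈ S.R) : p • α ∉ S.R := by
  intro hpα
  have ht_nsmul : S.ht (p • α) = p * S.ht α := by rw [map_nsmul, nsmul_eq_mul]
  have ht_ne := S.ht_ne_zero hpα
  rcases S.pos_or_neg _ hα with hpos | hneg
  · refine hp.nsmul_notMem_pos hpos ((S.mem_pos_iff hpα).mpr (ht_ne.symm.lt_of_le ?_))
    rw [ht_nsmul]
    have := S.one_le_ht hpos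
    positivity
  · refine hp.nsmul_notMem_pos hneg ?_
    rw [smul_neg]
    refine (S.pos_or_neg _ hpα).resolve_left fun hpos => ?_
    have ht_pos := S.one_le_ht hpos
    have ht_neg := S.one_le_ht hneg
    rw [ht_nsmul] at ht_pos
    rw [map_neg] at ht_neg
    nlinarith [(Nat.cast_nonneg p : (0 : ℚ) ≤ p)]

variable [Fact p.Prime] [CharP K p]

lemma IsGood.e_pow_eq_zero (hp : S.IsGood) (α : S.R) : (S.e α).1 ^ p = 0 := by
  have nsmul_ne_zero : p • α.1 ≠ 0 := by
    intro h
    have ht_nsmul := congrArg S.ht h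
    rw [map_nsmul, nsmul_eq_mul, map_zero, mul_eq_zero] at ht_nsmul
    exact ht_nsmul.elim (Nat.cast_ne_zero.mpr (Fact.out : p.Prime).ne_zero) (S.ht_ne_zero α.2)
  exact congrArg Subtype.val (S.eq_zero_of_not_root nsmul_ne_zero (hp.nsmul_notMem_roots α.2)
    (pow_mem_weightSpace S.torus p (S.e_mem_weightSpace α)))

lemma IsGood.ad_e_pow_eq_zero (hp : S.IsGood) (α : S.R) :
    LieAlgebra.ad K (lieAlg K O) (S.e α) ^ p = 0 := by
  ext1 x
  apply Subtype.val_injective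
  refine (map_ad_pow_apply (lieAlg K O).incl (S.e α) x p).trans ?_
  rw [ad_pow_char, LieSubalgebra.coe_incl, hp.e_pow_eq_zero, map_zero]
  rfl

lemma IsGood.commute_ι_e_pow (hp : S.IsGood) (α : S.R)
    (y : UniversalEnvelopingAlgebra K (lieAlg K O)) :
    Commute (UniversalEnvelopingAlgebra.ι K (S.e α) ^ p) y := by
  have centralizer_eq_top := subalgebra_eq_top_of_ι_mem
    (Subalgebra.centralizer K {UniversalEnvelopingAlgebra.ι K (S.e α) ^ p}) fun x => by
      rw [Subalgebra.mem_centralizer_iff]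
      rintro _ rfl
      rw [← sub_eq_zero, ← LieRing.of_associative_ring_bracket, ← LieAlgebra.ad_apply (R := K),
        ← ad_pow_char, ← map_ad_pow_apply, hp.ad_e_pow_eq_zero, LinearMap.zero_apply, map_zero]
  have hy : y ∈ Subalgebra.centralizer K {UniversalEnvelopingAlgebra.ι K (S.e α) ^ p} :=
    centralizer_eq_top ▸ Algebra.mem_top
  exact Subalgebra.mem_centralizer_iff K |>.mp hy _ rfl

end Setting

/-! ### Whittaker functionals on Lie algebras which are a sum of two subalgebras -/

section Whittaker

open UniversalEnvelopingAlgebra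

variable {K : Type u} [CommRing K] {L : Type v} [LieRing L] [LieAlgebra K L]

variable {𝔫 : LieSubalgebra K L} (pr : L →ₗ[K] 𝔫)

/-- The projection of `L` along `𝔫` onto the complement `ker pr`. -/
def coproj : L →ₗ[K] L := LinearMap.id - 𝔫.toSubmodule.subtype ∘ₗ pr

lemma coproj_apply (x : L) : coproj pr x = x - pr x := rfl

lemma pr_add_coproj (x : L) : pr x + coproj pr x = x := by
  rw [coproj_apply, add_sub_cancel]

variable {pr}

lemma coproj_eq_self {y : L} (hy : pr y = 0) : coproj pr y = y := by
  rw [coproj_apply, hy, ZeroMemClass.coe_zero, sub_zero]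

lemma coproj_coe (hpr : ∀ x : 𝔫, pr x = x) (x : 𝔫) : coproj pr x = 0 := by
  rw [coproj_apply, hpr, sub_self]

lemma coproj_coproj (hpr : ∀ x : 𝔫, pr x = x) (x : L) :
    coproj pr (coproj pr x) = coproj pr x :=
  coproj_eq_self (by rw [coproj_apply, map_sub, hpr, sub_self])

variable (pr) in
lemma lie_lie_coe_eq (q : L) (x x' : 𝔫) : ⁅q, ((⁅x, x'⁆ : 𝔫) : L)⁆ =
    ((⁅pr ⁅q, (x : L)⁆, x'⁆ - ⁅pr ⁅q, (x' : L)⁆, x⁆ : 𝔫) : L) +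
      (⁅coproj pr ⁅q, (x : L)⁆, (x' : L)⁆ - ⁅coproj pr ⁅q, (x' : L)⁆, (x : L)⁆) := by
  have lie_decomp (x x' : 𝔫) : ⁅⁅q, (x : L)⁆, (x' : L)⁆ =
      ((⁅pr ⁅q, (x : L)⁆, x'⁆ : 𝔫) : L) + ⁅coproj pr ⁅q, (x : L)⁆, (x' : L)⁆ := by
    rw [LieSubalgebra.coe_bracket, ← add_lie, pr_add_coproj]
  rw [LieSubalgebra.coe_bracket, leibniz_lie q, ← lie_skew (x : L), lie_decomp, lie_decomp,
    AddSubgroupClass.coe_sub]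
  abel

variable (𝔫) (F : Type w) [CommRing F] [Algebra K F]

/-- The `F`-module `F ⊗ U(𝔫)` underlying the `L`-module induced from a character of a complement
of `𝔫`. -/
abbrev IndMod : Type _ := F ⊗[K] UniversalEnvelopingAlgebra K 𝔫

/-- Left multiplication on `F ⊗ U(𝔫)`. -/
def lmulBase : UniversalEnvelopingAlgebra K 𝔫 →ₐ[K] Module.End F (IndMod 𝔫 F) :=
  (Module.End.baseChangeHom K F (UniversalEnvelopingAlgebra K 𝔫)).comp
    (Algebra.lmul K (UniversalEnvelopingAlgebra K 𝔫))

lemma lmulBase_tmul (u : UniversalEnvelopingAlgebra K 𝔫) (a : F)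
    (v : UniversalEnvelopingAlgebra K 𝔫) : lmulBase 𝔫 F u (a ⊗ₜ v) = a ⊗ₜ (u * v) := rfl

variable {𝔫} (pr)

/-- The action of `x ∈ 𝔫` on pairs `(m, φ)` with `m ∈ F ⊗ U(𝔫)` and `φ : L → F ⊗ U(𝔫)`, where `φ y`
stands for the still undefined `y m` with `y` in the complement: the formula is the one forced by
`y (x m) = x (y m) + [y, x] m`. -/
def prolong (x : 𝔫) : Module.End K (IndMod 𝔫 F × (L →ₗ[K] IndMod 𝔫 F)) where
  toFun z := (lmulBase 𝔫 F (ι K x) z.1,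
    { toFun := fun y => lmulBase 𝔫 F (ι K x) (z.2 y) +
        lmulBase 𝔫 F (ι K (pr ⁅coproj pr y, (x : L)⁆)) z.1 +
        z.2 (coproj pr ⁅coproj pr y, (x : L)⁆)
      map_add' := fun y y' => by simp only [map_add, add_lie, LinearMap.add_apply]; abel
      map_smul' := fun c y => by simp [smul_add] })
  map_add' z z' := by
    ext y
    · simp
    · simp only [Prod.fst_add, Prod.snd_add, LinearMap.add_apply, map_add, LinearMap.coe_mk,
        AddHom.coe_mk]
      abel
  map_smul' c z := by
    ext y
    · simp
    · simp [smul_add]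

lemma prolong_fst (x : 𝔫) (z) : (prolong pr F x z).1 = lmulBase 𝔫 F (ι K x) z.1 := rfl

lemma prolong_snd (x : 𝔫) (z) (y : L) : (prolong pr F x z).2 y =
    lmulBase 𝔫 F (ι K x) (z.2 y) + lmulBase 𝔫 F (ι K (pr ⁅coproj pr y, (x : L)⁆)) z.1 +
      z.2 (coproj pr ⁅coproj pr y, (x : L)⁆) := rfl

variable {pr}

lemma prolong_lie (hpr : ∀ x : 𝔫, pr x = x) (x x' : 𝔫) :
    prolong pr F ⁅x, x'⁆ = prolong pr F x * prolong pr F x' - prolong pr F x' * prolong pr F x := by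
  refine LinearMap.ext fun z => ?_
  rw [LinearMap.sub_apply, Module.End.mul_apply, Module.End.mul_apply]
  refine Prod.ext ?_ (LinearMap.ext fun y => ?_)
  · rw [Prod.fst_sub]
    simp only [prolong_fst]
    rw [LieHom.map_lie, LieRing.of_associative_ring_bracket, map_sub, map_mul, map_mul]
    rfl
  · rw [Prod.snd_sub, LinearMap.sub_apply]
    simp only [prolong_snd, prolong_fst, coproj_coproj hpr, lie_lie_coe_eq pr (coproj pr y),
      map_add, map_sub, map_zero, hpr, coproj_coe hpr, LieHom.map_lie,
      LieRing.of_associative_ring_bracket, map_mul, LinearMap.add_apply, LinearMap.sub_apply,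
      Module.End.mul_apply]
    abel

/-- The prolonged action, as an action of the Lie algebra `𝔫`. -/
def prolongHom (hpr : ∀ x : 𝔫, pr x = x) :
    𝔫 →ₗ⁅K⁆ Module.End K (IndMod 𝔫 F × (L →ₗ[K] IndMod 𝔫 F)) where
  toFun := prolong pr F
  map_add' x y := by
    refine LinearMap.ext fun z => Prod.ext ?_ (LinearMap.ext fun q => ?_)
    · simp [prolong_fst]
    · simp only [LinearMap.add_apply, Prod.snd_add, prolong_snd, map_add,
        AddMemClass.coe_add, lie_add]
      abel
  map_smul' c x := by
    refine LinearMap.ext fun z => Prod.ext ?_ (LinearMap.ext fun q => ?_)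
    · simp [prolong_fst]
    · simp [prolong_snd, smul_add]
  map_lie' := prolong_lie F hpr _ _

variable {F} (hpr : ∀ x : 𝔫, pr x = x) (lam : L →ₗ[K] F)

/-- The orbit map of the pair `(1, lam)` under the prolonged action. -/
def orbitMap : UniversalEnvelopingAlgebra K 𝔫 →ₗ[K] IndMod 𝔫 F × (L →ₗ[K] IndMod 𝔫 F) :=
  LinearMap.applyₗ ((1 ⊗ₜ 1, (TensorProduct.mk K F _).flip 1 ∘ₗ lam) :
    IndMod 𝔫 F × (L →ₗ[K] IndMod 𝔫 F)) ∘ₗ (lift K (prolongHom F hpr)).toLinearMap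

lemma orbitMap_one :
    orbitMap hpr lam 1 = (1 ⊗ₜ 1, (TensorProduct.mk K F _).flip 1 ∘ₗ lam) := by
  simp [orbitMap]

lemma orbitMap_ι_mul (x : 𝔫) (u : UniversalEnvelopingAlgebra K 𝔫) :
    orbitMap hpr lam (ι K x * u) = prolong pr F x (orbitMap hpr lam u) := by
  have lift_ι : lift K (prolongHom F hpr) (ι K x) = prolong pr F x := lift_ι_apply' ..
  simp only [orbitMap, LinearMap.comp_apply, AlgHom.toLinearMap_apply, map_mul, lift_ι]
  rfl

lemma orbitMap_fst (u : UniversalEnvelopingAlgebra K 𝔫) :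
    (orbitMap hpr lam u).1 = (1 : F) ⊗ₜ u := by
  induction u using ι_mul_induction with
  | one => rw [orbitMap_one]
  | add u v hu hv => rw [map_add, Prod.fst_add, hu, hv, TensorProduct.tmul_add]
  | smul c u hu => rw [map_smul, Prod.smul_fst, hu, TensorProduct.tmul_smul]
  | ι_mul x u hu => rw [orbitMap_ι_mul, prolong_fst, hu, lmulBase_tmul]

/-- The action of the complement of `𝔫` on `F ⊗ U(𝔫)` (meaningful on the image of `coproj`). -/
def complAct : L →ₗ[K] Module.End F (IndMod 𝔫 F) where
  toFun y := LinearMap.liftBaseChange F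
    (LinearMap.applyₗ y ∘ₗ LinearMap.snd K _ _ ∘ₗ orbitMap hpr lam)
  map_add' y y' := by
    ext u
    simp
  map_smul' c y := by
    ext u
    simp

lemma complAct_tmul (y : L) (a : F) (u : UniversalEnvelopingAlgebra K 𝔫) :
    complAct hpr lam y (a ⊗ₜ u) = a • (orbitMap hpr lam u).2 y := by
  simp [complAct]

lemma complAct_tmul_one (y : L) (a : F) :
    complAct hpr lam y (a ⊗ₜ 1) = (a * lam y) ⊗ₜ 1 := by
  rw [complAct_tmul, orbitMap_one]
  simp [TensorProduct.smul_tmul']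

/-- The action of `L` on `F ⊗ U(𝔫)`. -/
def indAct : L →ₗ[K] Module.End F (IndMod 𝔫 F) :=
  (lmulBase 𝔫 F).toLinearMap ∘ₗ (ι K : 𝔫 →ₗ⁅K⁆ _).toLinearMap ∘ₗ pr +
    complAct hpr lam ∘ₗ coproj pr

lemma indAct_apply (z : L) : indAct hpr lam z =
    lmulBase 𝔫 F (ι K (pr z)) + complAct hpr lam (coproj pr z) := rfl

lemma indAct_coe (x : 𝔫) : indAct hpr lam x = lmulBase 𝔫 F (ι K x) := by
  rw [indAct_apply, hpr, coproj_coe hpr, map_zero, add_zero]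

lemma indAct_of_pr_eq_zero {y : L} (hy : pr y = 0) : indAct hpr lam y = complAct hpr lam y := by
  rw [indAct_apply, hy, coproj_eq_self hy, map_zero, map_zero, zero_add]

lemma complAct_lie_lmulBase (y : L) (x : 𝔫) :
    ⁅complAct hpr lam y, lmulBase 𝔫 F (ι K x)⁆ = indAct hpr lam ⁅coproj pr y, (x : L)⁆ := by
  rw [LieRing.of_associative_ring_bracket, sub_eq_iff_eq_add]
  ext u
  simp only [TensorProduct.AlgebraTensorModule.curry_apply, TensorProduct.curry_apply,
    LinearMap.coe_restrictScalars]
  rw [LinearMap.add_apply, indAct_apply, LinearMap.add_apply, Module.End.mul_apply,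
    Module.End.mul_apply, lmulBase_tmul, complAct_tmul, complAct_tmul, complAct_tmul,
    orbitMap_ι_mul, prolong_snd, orbitMap_fst, one_smul, one_smul, one_smul]
  abel

/-- The failure of `indAct` to be a Lie homomorphism on a pair of elements of the complement. -/
def complDefect (y y' : L) : Module.End F (IndMod 𝔫 F) :=
  ⁅complAct hpr lam (coproj pr y), complAct hpr lam (coproj pr y')⁆ -
    indAct hpr lam ⁅coproj pr y, coproj pr y'⁆

lemma complAct_lie_indAct (y z : L) :
    ⁅complAct hpr lam (coproj pr y), indAct hpr lam z⁆ =
      indAct hpr lam ⁅coproj pr y, z⁆ + complDefect hpr lam y z := by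
  conv_rhs => rw [← pr_add_coproj pr z, lie_add, map_add]
  rw [pr_add_coproj, indAct_apply hpr lam z, lie_add, complAct_lie_lmulBase, coproj_coproj hpr,
    complDefect]
  abel

variable {hpr lam}

lemma complDefect_one (hb : ∀ x y : L, pr ⁅coproj pr x, coproj pr y⁆ = 0)
    (hlam : ∀ x y : L, lam ⁅coproj pr x, coproj pr y⁆ = 0) (y y' : L) :
    complDefect hpr lam y y' (1 ⊗ₜ 1) = 0 := by
  simp only [complDefect, LieRing.of_associative_ring_bracket, LinearMap.sub_apply,
    Module.End.mul_apply, indAct_of_pr_eq_zero hpr lam (hb y y'), complAct_tmul_one, hlam,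
    mul_zero, TensorProduct.zero_tmul, sub_zero]
  rw [mul_right_comm, sub_self]

lemma complDefect_lie_lmulBase (hb : ∀ x y : L, pr ⁅coproj pr x, coproj pr y⁆ = 0) (y y' : L)
    (x : 𝔫) : ⁅complDefect hpr lam y y', lmulBase 𝔫 F (ι K x)⁆ =
      complDefect hpr lam y ⁅coproj pr y', (x : L)⁆ -
        complDefect hpr lam y' ⁅coproj pr y, (x : L)⁆ := by
  rw [complDefect, sub_lie, indAct_of_pr_eq_zero hpr lam (hb y y'), complAct_lie_lmulBase,
    coproj_eq_self (hb y y'), lie_lie, complAct_lie_lmulBase, complAct_lie_lmulBase,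
    coproj_coproj hpr, coproj_coproj hpr, complAct_lie_indAct, complAct_lie_indAct, lie_lie,
    map_sub]
  abel

lemma complDefect_eq_zero (hb : ∀ x y : L, pr ⁅coproj pr x, coproj pr y⁆ = 0)
    (hlam : ∀ x y : L, lam ⁅coproj pr x, coproj pr y⁆ = 0) (y y' : L) :
    complDefect hpr lam y y' = 0 := by
  ext u
  change complDefect hpr lam y y' (1 ⊗ₜ u) = 0
  induction u using ι_mul_induction generalizing y y' with
  | one => exact complDefect_one hb hlam y y'
  | add u v hu hv => rw [TensorProduct.tmul_add, map_add, hu, hv, add_zero]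
  | smul c u hu => rw [TensorProduct.tmul_smul, LinearMap.map_smul_of_tower, hu, smul_zero]
  | ι_mul x u hu =>
    have lie_apply := congrArg (· ((1 : F) ⊗ₜ[K] u))
      (complDefect_lie_lmulBase (hpr := hpr) (lam := lam) hb y y' x)
    simp only [LieRing.of_associative_ring_bracket, LinearMap.sub_apply, Module.End.mul_apply,
      hu, map_zero, sub_zero] at lie_apply
    exact lie_apply

lemma indAct_lie (hb : ∀ x y : L, pr ⁅coproj pr x, coproj pr y⁆ = 0)
    (hlam : ∀ x y : L, lam ⁅coproj pr x, coproj pr y⁆ = 0) (z z' : L) :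
    indAct hpr lam ⁅z, z'⁆ = ⁅indAct hpr lam z, indAct hpr lam z'⁆ := by
  have lie_lmulBase (y : 𝔫) (w : L) :
      ⁅lmulBase 𝔫 F (ι K y), indAct hpr lam w⁆ = indAct hpr lam ⁅(y : L), w⁆ := by
    conv_rhs => rw [← pr_add_coproj pr w, lie_add, map_add]
    rw [indAct_apply hpr lam w, lie_add, ← lie_skew _ (complAct _ _ _), complAct_lie_lmulBase,
      coproj_coproj hpr, ← map_neg, lie_skew, ← LieSubalgebra.coe_bracket, indAct_coe,
      LieHom.map_lie]
    simp only [LieRing.of_associative_ring_bracket, map_sub, map_mul]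
  conv_lhs => rw [← pr_add_coproj pr z, add_lie, map_add]
  rw [indAct_apply hpr lam z, add_lie, lie_lmulBase, complAct_lie_indAct,
    complDefect_eq_zero hb hlam, add_zero]

variable (hpr) in
/-- The action of `L` on `F ⊗ U(𝔫)`, as a homomorphism of Lie algebras. -/
def indHom (hb : ∀ x y : L, pr ⁅coproj pr x, coproj pr y⁆ = 0)
    (hlam : ∀ x y : L, lam ⁅coproj pr x, coproj pr y⁆ = 0) :
    L →ₗ⁅K⁆ Module.End F (IndMod 𝔫 F) :=
  { indAct hpr lam with map_lie' := indAct_lie hb hlam _ _ }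

lemma exists_eigenfunctional (ψ : 𝔫 →ₗ[K] K) (hψ : ∀ x y : 𝔫, ψ ⁅x, y⁆ = 0) :
    ∃ φ : IndMod 𝔫 F →ₗ[F] F, φ (1 ⊗ₜ 1) = 1 ∧
      ∀ (x : 𝔫) m, φ (lmulBase 𝔫 F (ι K x) m) = algebraMap K F (ψ x) * φ m := by
  let c : UniversalEnvelopingAlgebra K 𝔫 →ₐ[K] K := lift K
    { ψ with
      map_lie' := fun {x y} => by
        change ψ ⁅x, y⁆ = ⁅ψ x, ψ y⁆
        rw [hψ, LieRing.of_associative_ring_bracket, mul_comm, sub_self] }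
  have c_ι (x : 𝔫) : c (ι K x) = ψ x := lift_ι_apply' ..
  refine ⟨LinearMap.liftBaseChange F (Algebra.linearMap K F ∘ₗ c.toLinearMap), by simp,
    fun x m => ?_⟩
  induction m using TensorProduct.induction_on with
  | zero => simp
  | tmul a u =>
    rw [lmulBase_tmul]
    simp only [LinearMap.liftBaseChange_tmul, LinearMap.comp_apply, AlgHom.toLinearMap_apply,
      map_mul, c_ι, Algebra.linearMap_apply, smul_eq_mul]
    ring
  | add a b ha hb => rw [map_add, map_add, ha, hb, map_add, mul_add]

/-- For `L = 𝔫 ⊕ 𝔟` with characters `ψ` of `𝔫` and `lam` of `𝔟 = ker pr`, this is the functional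
`u ↦ φ(u (1 ⊗ 1))` on the module induced from `lam`, where `φ` is a `ψ`-eigenfunctional. -/
theorem exists_whittaker_functional (hpr : ∀ x : 𝔫, pr x = x)
    (hb : ∀ x y : L, pr ⁅coproj pr x, coproj pr y⁆ = 0)
    (hlam : ∀ x y : L, lam ⁅coproj pr x, coproj pr y⁆ = 0)
    (ψ : 𝔫 →ₗ[K] K) (hψ : ∀ x y : 𝔫, ψ ⁅x, y⁆ = 0) :
    ∃ θ : UniversalEnvelopingAlgebra K L →ₗ[K] F, θ 1 = 1 ∧
      (∀ (x : 𝔫) u, θ (ι K (x : L) * u) = algebraMap K F (ψ x) * θ u) ∧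
      ∀ u y, pr y = 0 → θ (u * ι K y) = θ u * lam y := by
  obtain ⟨φ, φ_one, φ_lmulBase⟩ := exists_eigenfunctional (F := F) ψ hψ
  let act : UniversalEnvelopingAlgebra K L →ₐ[K] Module.End F (IndMod 𝔫 F) :=
    lift K (indHom hpr hb hlam)
  have act_ι (z : L) : act (ι K z) = indAct hpr lam z := lift_ι_apply' ..
  refine ⟨(φ.restrictScalars K) ∘ₗ (LinearMap.applyₗ (1 ⊗ₜ 1)) ∘ₗ
    (LinearMap.restrictScalarsₗ K F _ _ K) ∘ₗ act.toLinearMap, ?_, fun x u => ?_,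
    fun u y hy => ?_⟩
  · simp [φ_one]
  · change φ (act _ _) = _ * φ (act _ _)
    rw [map_mul, act_ι, Module.End.mul_apply, indAct_coe, φ_lmulBase]
  · change φ (act _ _) = φ (act _ _) * _
    have smul_one : (1 * lam y) ⊗ₜ[K] (1 : UniversalEnvelopingAlgebra K 𝔫) =
        lam y • (1 : F) ⊗ₜ 1 := by
      rw [TensorProduct.smul_tmul', smul_eq_mul, mul_comm]
    rw [map_mul, act_ι, Module.End.mul_apply, indAct_of_pr_eq_zero hpr lam hy,
      complAct_tmul_one, smul_one, map_smul, map_smul, smul_eq_mul, mul_comm]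

end Whittaker

/-! ### Independence of additive subgroups and simultaneous eigenspaces -/

section Independence

lemma iSupIndep_iInf_eigenspace {K : Type u} [Field K] {V : Type v} [AddCommGroup V] [Module K V]
    {H : Type w} {f : H → Module.End K V} (hf : ∀ h h', Commute (f h) (f h')) :
    iSupIndep fun c : H → K => ⨅ h, (f h).eigenspace (c h) :=
  (Module.End.independent_iInf_maxGenEigenspace_of_forall_mapsTo f fun h h' c =>
    Module.End.mapsTo_maxGenEigenspace_of_comm (hf h' h) c).mono fun c =>
      iInf_mono fun h => ((f h).genEigenspace (c h)).monotone le_top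

variable {V : Type v} [AddCommGroup V] {J : Type w} {E : J → AddSubgroup V}

lemma iSupIndep_addSubgroup_iff :
    iSupIndep E ↔ ∀ (s : Finset J) (m : J → V), (∀ i ∈ s, m i ∈ E i) → ∑ i ∈ s, m i = 0 →
      ∀ i ∈ s, m i = 0 := by
  rw [← iSupIndep_map_orderIso_iff (AddSubgroup.toIntSubmodule (M := V)),
    iSupIndep_iff_finsetSum_eq_zero_imp_eq_zero]
  rfl

lemma iSupIndep_addSubgroup_of_eigen {K : Type u} [Field K] [Module K V] {H : Type x}
    {f : H → Module.End K V} (hf : ∀ h h', Commute (f h) (f h')) {c : J → H → K}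
    (hc : Function.Injective c) (hE : ∀ i, ∀ m ∈ E i, ∀ h, f h m = c i h • m) : iSupIndep E := by
  have indep := (iSupIndep_iff_finsetSum_eq_zero_imp_eq_zero _).mp
    ((iSupIndep_iInf_eigenspace hf).comp hc)
  refine iSupIndep_addSubgroup_iff.mpr fun s m hm => indep s m fun i hi => ?_
  exact (Submodule.mem_iInf _).mpr fun h => Module.End.mem_eigenspace_iff.mpr (hE i _ (hm i hi) h)

end Independence

/-! ### The grading of `U_χ` by `X / ℤI` -/

namespace Setting

open UniversalEnvelopingAlgebra (ι lift)

variable {K : Type u} [Field K] {p : ℕ} {O : Type v} [CommRing O] [HopfAlgebra K O]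
variable {X : Type w} [AddCommGroup X] (S : Setting K p O X)
variable (χ : Module.Dual K (lieAlg K O)) (I : Set X)

/-- The map `𝔤 → U_χ`. -/
def toUι : lieAlg K O →ₗ[K] S.U χ :=
  (S.toU χ).toLinearMap ∘ₗ (ι K : lieAlg K O →ₗ⁅K⁆ _).toLinearMap

lemma toUι_apply (x : lieAlg K O) : S.toUι χ x = S.toU χ (ι K x) := rfl

lemma toUι_e (α : S.R) : S.toUι χ (S.e α) = S.ue χ α := rfl

lemma toUι_lieMap (h : Cartan K X) : S.toUι χ (lieMap S.torus h) = S.uh χ h := by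
  simp [uh, u0, toUι_apply]

lemma toUι_lie (x y : lieAlg K O) :
    S.toUι χ ⁅x, y⁆ = S.toUι χ x * S.toUι χ y - S.toUι χ y * S.toUι χ x := by
  simp only [toUι_apply, LieHom.map_lie, LieRing.of_associative_ring_bracket, map_sub, map_mul]

lemma ue_pow (α : S.R) : S.ue χ α ^ p = algebraMap K _ (χ (S.e α) ^ p) := by
  rw [ue, ← map_pow]
  exact (RingQuot.mkAlgHom_rel K (s := S.uRel χ) ⟨α, rfl, rfl⟩).trans (AlgHom.commutes _ _)

lemma toU_surjective : Function.Surjective (S.toU χ) := RingQuot.mkAlgHom_surjective K _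

lemma adjoin_range_gen : Algebra.adjoin K (Set.range (S.gen χ)) = ⊤ := by
  have comap_eq_top : (Algebra.adjoin K (Set.range (S.gen χ))).comap (S.toU χ) = ⊤ := by
    refine subalgebra_eq_top_of_ι_mem _ fun x => ?_
    suffices span_le : Submodule.span K (Set.range S.basis) ≤
        (Subalgebra.toSubmodule (Algebra.adjoin K (Set.range (S.gen χ)))).comap (S.toUι χ) from
      span_le (S.basis.mem_span x)
    refine Submodule.span_le.mpr ?_
    rintro _ ⟨α | i, rfl⟩
    · exact Algebra.subset_adjoin ⟨Sum.inl α, rfl⟩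
    · obtain ⟨h, hh⟩ := S.basis_cartan i
      exact Algebra.subset_adjoin ⟨Sum.inr h, by rw [hh, toUι_lieMap]; rfl⟩
  refine Algebra.eq_top_iff.mpr fun y => ?_
  obtain ⟨z, rfl⟩ := S.toU_surjective χ y
  exact (comap_eq_top ▸ Algebra.mem_top : z ∈ (Algebra.adjoin K _).comap (S.toU χ))

lemma span_range_prod_gen : Submodule.span K (Set.range fun l : List (S.R ⊕ Cartan K X) =>
    (l.map (S.gen χ)).prod) = ⊤ := by
  rw [← Algebra.top_toSubmodule, ← S.adjoin_range_gen χ, Algebra.adjoin_eq_span,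
    ← FreeMonoid.mrange_lift, MonoidHom.coe_mrange]
  refine congrArg (Submodule.span K <| Set.range ·) (funext fun l => ?_)
  exact (FreeMonoid.lift_apply _ (FreeMonoid.ofList l)).symm

lemma cls_add (a b : X) : S.cls I (a + b) = S.cls I a + S.cls I b := rfl

lemma list_prod_mem_uGr (l : List (S.R ⊕ Cartan K X)) :
    (l.map (S.gen χ)).prod ∈ S.uGr χ I (l.map (S.genDeg I)).sum :=
  Submodule.subset_span ⟨l, rfl, rfl⟩

lemma iSup_uGr : ⨆ σ, S.uGr χ I σ = ⊤ := by
  rw [eq_top_iff, ← S.span_range_prod_gen χ, Submodule.span_le]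
  rintro _ ⟨l, rfl⟩
  exact Submodule.mem_iSup_of_mem _ (S.list_prod_mem_uGr χ I l)

lemma gen_mem_uGr (i) : S.gen χ i ∈ S.uGr χ I (S.genDeg I i) := by
  simpa using S.list_prod_mem_uGr χ I [i]

lemma ue_mem_uGr (α : S.R) : S.ue χ α ∈ S.uGr χ I (S.cls I α.1) := S.gen_mem_uGr χ I (Sum.inl α)

lemma one_mem_uGr : 1 ∈ S.uGr χ I 0 := by
  simpa using S.list_prod_mem_uGr χ I []

variable {χ I} in
lemma mul_mem_uGr {σ τ : S.XI I} {y z : S.U χ} (hy : y ∈ S.uGr χ I σ) (hz : z ∈ S.uGr χ I τ) :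
    y * z ∈ S.uGr χ I (σ + τ) := by
  suffices mul_le : S.uGr χ I σ * S.uGr χ I τ ≤ S.uGr χ I (σ + τ) from
    mul_le (Submodule.mul_mem_mul hy hz)
  rw [uGr, uGr, Submodule.span_mul_span, Submodule.span_le]
  rintro _ ⟨_, ⟨l, rfl, rfl⟩, _, ⟨m, rfl, rfl⟩, rfl⟩
  simpa using S.list_prod_mem_uGr χ I (l ++ m)

/-- The linear map `𝔤 → U_χ[X/ℤI]` with `x ↦ x t^{γ + ℤI}` for `x` of weight `γ`. -/
def degLin : lieAlg K O →ₗ[K] AddMonoidAlgebra (S.U χ) (S.XI I) :=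
  S.basis.constr K fun b => AddMonoidAlgebra.single (S.cls I (S.idxWt b)) (S.toUι χ (S.basis b))

section Coaction

variable [Infinite K] [Module.Free ℤ X]

lemma degLin_of_mem_weightSpace {γ : X} {x : lieAlg K O} (hx : x ∈ weightSpace S.torus γ) :
    S.degLin χ I x = AddMonoidAlgebra.single (S.cls I γ) (S.toUι χ x) := by
  change _ = (AddMonoidAlgebra.lsingle (R := K) (S.cls I γ) ∘ₗ S.toUι χ) x
  conv_rhs => rw [← S.basis.linearCombination_repr x, Finsupp.linearCombination_apply,
    map_finsuppSum]
  rw [degLin, Module.Basis.constr_apply]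
  refine Finsupp.sum_congr fun b _ => ?_
  by_cases hb : S.idxWt b = γ
  · rw [hb, map_smul]
    rfl
  · rw [S.repr_eq_zero_of_idxWt_ne hx hb, zero_smul, zero_smul, map_zero]

lemma degLin_lie (x y : lieAlg K O) :
    S.degLin χ I ⁅x, y⁆ = ⁅S.degLin χ I x, S.degLin χ I y⁆ := by
  suffices bilin_eq : (LieModule.toEnd K (lieAlg K O) (lieAlg K O)).toLinearMap.compr₂
        (S.degLin χ I) =
      (LieModule.toEnd K (AddMonoidAlgebra (S.U χ) (S.XI I))
        (AddMonoidAlgebra (S.U χ) (S.XI I))).toLinearMap.compl₁₂ (S.degLin χ I) (S.degLin χ I) from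
    LinearMap.congr_fun₂ bilin_eq x y
  refine S.basis.ext fun b => S.basis.ext fun b' => ?_
  change S.degLin χ I ⁅S.basis b, S.basis b'⁆ =
    ⁅S.degLin χ I (S.basis b), S.degLin χ I (S.basis b')⁆
  have hb := S.basis_mem_weightSpace b
  have hb' := S.basis_mem_weightSpace b'
  rw [S.degLin_of_mem_weightSpace χ I hb, S.degLin_of_mem_weightSpace χ I hb',
    S.degLin_of_mem_weightSpace χ I (lie_mem_weightSpace _ hb hb'),
    LieRing.of_associative_ring_bracket, AddMonoidAlgebra.single_mul_single,
    AddMonoidAlgebra.single_mul_single, toUι_lie, add_comm (S.cls I (S.idxWt b')),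
    ← QuotientAddGroup.mk_add]
  exact map_sub (AddMonoidAlgebra.singleAddHom _) _ _

/-- `degLin` as a homomorphism of Lie algebras. -/
def degLie : lieAlg K O →ₗ⁅K⁆ AddMonoidAlgebra (S.U χ) (S.XI I) :=
  { S.degLin χ I with map_lie' := S.degLin_lie χ I _ _ }

variable {S χ I}

lemma IsStandardLevi.apply_e_eq_zero (hχ : S.IsStandardLevi χ I) {α : S.R} (hα : -α.1 ∉ I) :
    χ (S.e α) = 0 := by
  by_cases hpos : α.1 ∈ S.pos
  · exact hχ.borel _ (S.e_mem_borel hpos)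
  · exact hχ.not_mem α ((S.pos_or_neg _ α.2).resolve_left hpos) hα

lemma IsStandardLevi.apply_e_eq_zero_or_cls_eq_zero (hχ : S.IsStandardLevi χ I) (α : S.R) :
    χ (S.e α) = 0 ∨ S.cls I α.1 = 0 := by
  by_cases hα : -α.1 ∈ I
  · refine Or.inr ((QuotientAddGroup.eq_zero_iff _).mpr ?_)
    exact neg_mem_iff.mp (AddSubgroup.subset_closure hα)
  · exact Or.inl (hχ.apply_e_eq_zero hα)

lemma IsStandardLevi.degLin_e_pow (hχ : S.IsStandardLevi χ I) (α : S.R) :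
    S.degLin χ I (S.e α) ^ p = algebraMap K _ (χ (S.e α) ^ p) := by
  rw [S.degLin_of_mem_weightSpace χ I (S.e_mem_weightSpace α), AddMonoidAlgebra.single_pow, toUι_e,
    ue_pow]
  rcases hχ.apply_e_eq_zero_or_cls_eq_zero α with hα | hα
  · rcases eq_or_ne p 0 with rfl | hp
    · rw [zero_smul]
      rfl
    · rw [hα, zero_pow hp, map_zero, map_zero, AddMonoidAlgebra.single_zero]
  · rw [hα, smul_zero]
    rfl

/-- The grading of `U_χ` as a coaction of `X/ℤI`. -/
def coact (hχ : S.IsStandardLevi χ I) : S.U χ →ₐ[K] AddMonoidAlgebra (S.U χ) (S.XI I) :=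
  RingQuot.liftAlgHom K ⟨lift K (S.degLie χ I), by
    rintro _ _ ⟨α, rfl, rfl⟩
    rw [map_pow, UniversalEnvelopingAlgebra.lift_ι_apply, AlgHom.commutes]
    exact hχ.degLin_e_pow α⟩

variable (hχ : S.IsStandardLevi χ I)

lemma coact_toUι {γ : X} {x : lieAlg K O} (hx : x ∈ weightSpace S.torus γ) :
    coact hχ (S.toUι χ x) = AddMonoidAlgebra.single (S.cls I γ) (S.toUι χ x) := by
  rw [← S.degLin_of_mem_weightSpace χ I hx]
  exact (RingQuot.liftAlgHom_mkAlgHom_apply ..).trans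
    (UniversalEnvelopingAlgebra.lift_ι_apply K (S.degLie χ I) x)

lemma coact_gen (i) :
    coact hχ (S.gen χ i) = AddMonoidAlgebra.single (S.genDeg I i) (S.gen χ i) := by
  rcases i with α | h
  · exact coact_toUι hχ (S.e_mem_weightSpace α)
  · have coact_lieMap := coact_toUι hχ (lieMap_mem_weightSpace S.torus h)
    rwa [toUι_lieMap] at coact_lieMap

lemma coact_of_mem_uGr {σ : S.XI I} {y : S.U χ} (hy : y ∈ S.uGr χ I σ) :
    coact hχ y = AddMonoidAlgebra.single σ y := by
  suffices uGr_le : S.uGr χ I σ ≤ LinearMap.eqLocus (coact hχ).toLinearMap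
      (AddMonoidAlgebra.lsingle (R := K) (S := S.U χ) σ) from uGr_le hy
  rw [uGr, Submodule.span_le]
  clear hy
  rintro _ ⟨l, rfl, rfl⟩
  change coact hχ _ = AddMonoidAlgebra.single _ _
  induction l with
  | nil => exact map_one _
  | cons i l ih =>
    simp only [List.map_cons, List.prod_cons, List.sum_cons, map_mul, ih, coact_gen,
      AddMonoidAlgebra.single_mul_single]

lemma coact_u0 (s : U0 K X) : coact hχ (S.u0 χ s) = AddMonoidAlgebra.single 0 (S.u0 χ s) := by
  have comp_u0_eq : (coact hχ).comp (S.u0 χ) =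
      (AddMonoidAlgebra.singleZeroAlgHom (R := K) (A := S.U χ) (M := S.XI I)).comp (S.u0 χ) :=
    UniversalEnvelopingAlgebra.hom_ext K (LieHom.ext fun h => coact_gen hχ (Sum.inr h))
  exact AlgHom.congr_fun comp_u0_eq s

/-- The projection of `U_χ` onto its component of degree `σ`. -/
def uProj (σ : S.XI I) : S.U χ →ₗ[K] S.U χ where
  toFun y := (coact hχ y).coeff σ
  map_add' y z := by simp
  map_smul' c y := by simp

lemma uProj_apply (σ : S.XI I) (y : S.U χ) : uProj hχ σ y = (coact hχ y).coeff σ := rfl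

lemma uProj_of_mem {σ : S.XI I} {y : S.U χ} (hy : y ∈ S.uGr χ I σ) : uProj hχ σ y = y := by
  simp [uProj_apply, coact_of_mem_uGr hχ hy]

lemma uProj_of_mem_of_ne {σ τ : S.XI I} (hne : τ ≠ σ) {y : S.U χ} (hy : y ∈ S.uGr χ I τ) :
    uProj hχ σ y = 0 := by
  simp [uProj_apply, coact_of_mem_uGr hχ hy, hne]

lemma uProj_mul_ue (σ : S.XI I) (y : S.U χ) (α : S.R) :
    uProj hχ σ (y * S.ue χ α) = uProj hχ (σ - S.cls I α.1) y * S.ue χ α := by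
  rw [uProj_apply, uProj_apply, map_mul, coact_of_mem_uGr hχ (S.ue_mem_uGr χ I α),
    AddMonoidAlgebra.coeff_mul_single_apply, sub_eq_add_neg]

lemma uProj_mul_u0 (σ : S.XI I) (y : S.U χ) (s : U0 K X) :
    uProj hχ σ (y * S.u0 χ s) = uProj hχ σ y * S.u0 χ s := by
  rw [uProj_apply, uProj_apply, map_mul, coact_u0 hχ, AddMonoidAlgebra.coeff_mul_single_apply,
    neg_zero, add_zero]

end Coaction

/-! ### The weights of `𝔥` on `U_χ` -/

variable {χ I} in
lemma uh_mul_of_mem_uWt {σ : S.XI I} {ξ : Module.Dual K (Cartan K X)} {y : S.U χ}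
    (hy : y ∈ S.uWt χ I σ ξ) (h : Cartan K X) : S.uh χ h * y = ξ h • y + y * S.uh χ h :=
  sub_eq_iff_eq_add.mp (hy.2 h)

variable {χ I} in
lemma mul_mem_uWt {σ τ : S.XI I} {ξ η : Module.Dual K (Cartan K X)} {y z : S.U χ}
    (hy : y ∈ S.uWt χ I σ ξ) (hz : z ∈ S.uWt χ I τ η) : y * z ∈ S.uWt χ I (σ + τ) (ξ + η) := by
  refine ⟨S.mul_mem_uGr hy.1 hz.1, fun h => ?_⟩
  rw [← mul_assoc, S.uh_mul_of_mem_uWt hy, add_mul, mul_assoc, S.uh_mul_of_mem_uWt hz, mul_add,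
    LinearMap.add_apply, add_smul, smul_mul_assoc, mul_smul_comm, mul_assoc]
  abel

lemma one_mem_uWt : (1 : S.U χ) ∈ S.uWt χ I 0 0 :=
  ⟨S.one_mem_uGr χ I, fun h => by simp⟩

lemma commute_uh (h h' : Cartan K X) : Commute (S.uh χ h) (S.uh χ h') := by
  rw [commute_iff_eq, ← sub_eq_zero, ← toUι_lieMap, ← toUι_lieMap, ← toUι_lie, ← LieHom.map_lie,
    cartan_lie, map_zero (lieMap S.torus), map_zero]

lemma uh_mem_uWt (h : Cartan K X) : S.uh χ h ∈ S.uWt χ I 0 0 := by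
  refine ⟨S.gen_mem_uGr χ I (Sum.inr h), fun h' => ?_⟩
  rw [(S.commute_uh χ h' h).eq, sub_self, LinearMap.zero_apply, zero_smul]

variable {χ I} in
lemma u0_mul_of_mem_uWt {σ : S.XI I} {ν : X} {y : S.U χ} (hy : y ∈ S.uWt χ I σ (dchar ν))
    (s : U0 K X) : S.u0 χ s * y = y * S.u0 χ (tilde ν s) := by
  induction s using ι_mul_induction with
  | one => simp only [map_one, one_mul, mul_one]
  | add s t hs ht => simp only [map_add, add_mul, mul_add, hs, ht]
  | smul c s hs => simp only [map_smul, smul_mul_assoc, mul_smul_comm, hs]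
  | ι_mul h s hs =>
    rw [map_mul, mul_assoc, hs, ← mul_assoc, ← uh, S.uh_mul_of_mem_uWt hy, map_mul, map_mul,
      tilde_ι, map_add, AlgHom.commutes, ← uh, add_comm (S.uh χ h), add_mul, add_mul, mul_add,
      mul_assoc, ← Algebra.smul_def, smul_mul_assoc, mul_smul_comm]

lemma iSupIndep_iInf_eigenspace_ad_uh :
    iSupIndep fun ξ : Module.Dual K (Cartan K X) =>
      ⨅ h, (LieAlgebra.ad K (S.U χ) (S.uh χ h)).eigenspace (ξ h) := by
  refine (iSupIndep_iInf_eigenspace fun h h' => ?_).comp DFunLike.coe_injective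
  rw [commute_iff_lie_eq, ← LieHom.map_lie, (commute_iff_lie_eq.mp (S.commute_uh χ h h')),
    map_zero]

variable {χ I} in
lemma mem_iInf_eigenspace_of_mem_uWt {σ : S.XI I} {ξ : Module.Dual K (Cartan K X)} {y : S.U χ}
    (hy : y ∈ S.uWt χ I σ ξ) :
    y ∈ ⨅ h, (LieAlgebra.ad K (S.U χ) (S.uh χ h)).eigenspace (ξ h) :=
  (Submodule.mem_iInf _).mpr fun h => Module.End.mem_eigenspace_iff.mpr (hy.2 h)

variable [Infinite K] [Module.Free ℤ X]

lemma ue_mem_uWt (α : S.R) : S.ue χ α ∈ S.uWt χ I (S.cls I α.1) (dchar α.1) := by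
  refine ⟨S.ue_mem_uGr χ I α, fun h => ?_⟩
  rw [← toUι_e, ← toUι_lieMap, ← toUι_lie, lie_weightSpace _ (S.e_mem_weightSpace α), map_smul]

lemma exists_list_prod_mem_uWt (l : List (S.R ⊕ Cartan K X)) :
    ∃ ν : X, S.cls I ν = (l.map (S.genDeg I)).sum ∧
      (l.map (S.gen χ)).prod ∈ S.uWt χ I (S.cls I ν) (dchar ν) := by
  induction l with
  | nil => exact ⟨0, rfl, dchar_zero (K := K) (X := X) ▸ S.one_mem_uWt χ I⟩
  | cons i l ih =>
    obtain ⟨ν, cls_ν, prod_mem⟩ := ih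
    rw [List.map_cons, List.sum_cons, ← cls_ν, List.map_cons, List.prod_cons]
    rcases i with α | h
    · refine ⟨α.1 + ν, rfl, ?_⟩
      rw [dchar_add, cls_add]
      exact S.mul_mem_uWt (S.ue_mem_uWt χ I α) prod_mem
    · refine ⟨ν, (zero_add _).symm, ?_⟩
      have mul_mem := S.mul_mem_uWt (S.uh_mem_uWt χ I h) prod_mem
      rwa [zero_add, zero_add] at mul_mem

variable {χ I} in
lemma eq_zero_of_mem_uWt {σ : S.XI I} {ξ : Module.Dual K (Cartan K X)}
    (hξ : ∀ ν, S.cls I ν = σ → dchar ν ≠ ξ) {y : S.U χ} (hy : y ∈ S.uWt χ I σ ξ) : y = 0 := by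
  refine Submodule.disjoint_def.mp (S.iSupIndep_iInf_eigenspace_ad_uh χ ξ) y
    (S.mem_iInf_eigenspace_of_mem_uWt hy) ?_
  suffices uGr_le : S.uGr χ I σ ≤ ⨆ (η : Module.Dual K (Cartan K X)) (_ : η ≠ ξ),
      ⨅ h, (LieAlgebra.ad K (S.U χ) (S.uh χ h)).eigenspace (η h) from uGr_le hy.1
  rw [uGr, Submodule.span_le]
  rintro _ ⟨l, hl, rfl⟩
  obtain ⟨ν, cls_ν, prod_mem⟩ := S.exists_list_prod_mem_uWt χ I l
  exact Submodule.mem_iSup_of_mem (dchar ν) (Submodule.mem_iSup_of_mem (hξ ν (cls_ν.trans hl))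
    (S.mem_iInf_eigenspace_of_mem_uWt prod_mem))

end Setting

/-! ### Nilpotence of the algebra generated by the elements `e_α - χ(e_α)` -/

section Nilpotence

variable {A : Type u} [Ring A] {J : Type v}

lemma prod_map_append_eq_of_perm (f : J → A) {l l' : List J} (hl : l.Perm l') (u : List J)
    (hf : ∀ (a b : List J) (x y : J), (a ++ x :: y :: b).Perm (u ++ l) →
      (a.map f).prod * (f x * f y - f y * f x) * (b.map f).prod = 0) :
    ((u ++ l).map f).prod = ((u ++ l').map f).prod := by
  induction hl generalizing u with
  | nil => rfl
  | cons x _ ih => simpa using ih (u ++ [x]) (by simpa using hf)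
  | swap x y l =>
    rw [← sub_eq_zero, ← hf u l y x (List.Perm.refl _)]
    simp only [List.map_append, List.map_cons, List.prod_append, List.prod_cons]
    noncomm_ring
  | trans hl _ ih ih' =>
    exact (ih u hf).trans (ih' u fun a b x y hp => hf a b x y (hp.trans (hl.symm.append_left u)))

lemma prod_map_eq_zero_of_le_count [DecidableEq J] {f : J → A} {j : J} {n : ℕ} {l : List J}
    (hj : f j ^ n = 0) (hn : n ≤ l.count j)
    (hf : ∀ (a b : List J) (x y : J), (a ++ x :: y :: b).Perm l →
      (a.map f).prod * (f x * f y - f y * f x) * (b.map f).prod = 0) :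
    (l.map f).prod = 0 := by
  obtain ⟨m, hm⟩ := (List.replicate_sublist_iff.mpr hn).exists_perm_append
  calc (l.map f).prod = ((List.replicate n j ++ m).map f).prod :=
        prod_map_append_eq_of_perm f hm [] hf
    _ = 0 := by
      rw [List.map_append, List.prod_append, List.map_replicate, List.prod_replicate, hj, zero_mul]

lemma exists_lt_count_of_card_mul_lt_length [Fintype J] [DecidableEq J] {n : ℕ} {l : List J}
    (hl : Fintype.card J * n < l.length) : ∃ j, n < l.count j := by
  by_contra! hcount
  have hsum : ∑ j, l.count j = l.length := by
    simpa using Multiset.sum_count_eq_card (s := Finset.univ) (m := (l : Multiset J)) (by simp)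
  have hle : ∑ j, l.count j ≤ Fintype.card J * n := by
    simpa using Finset.sum_le_card_nsmul Finset.univ _ n fun j _ => hcount j
  lia

-- Sorting a word changes it only by shorter words of the same total height. A sufficiently high
-- word is long, so it contains a letter with multiplicity at least `n` and sorting makes it vanish.
lemma exists_forall_le_length_prod_map_eq_zero {R : Type w} [CommRing R] [Algebra R A] [Finite J]
    (f : J → A) (ht : J → ℚ) (one_le_ht : ∀ j, 1 ≤ ht j) {n : ℕ} (hpow : ∀ j, f j ^ n = 0)
    (hcomm : ∀ i j, f i * f j - f j * f i = 0 ∨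
      ∃ (k : J) (c : R), ht k = ht i + ht j ∧ f i * f j - f j * f i = c • f k) :
    ∃ k : ℕ, ∀ l : List J, k ≤ l.length → (l.map f).prod = 0 := by
  classical
  have := Fintype.ofFinite J
  obtain ⟨M, hM⟩ : ∃ M : ℕ, ∀ j, ht j ≤ M := by
    obtain ⟨B, hB⟩ := (Set.finite_range ht).bddAbove
    obtain ⟨M, hM⟩ := exists_nat_ge B
    exact ⟨M, fun j => (hB ⟨j, rfl⟩).trans hM⟩
  have sum_ht_le (l : List J) : (l.map ht).sum ≤ l.length * M := by
    simpa using (l.map ht).sum_le_card_nsmul (M : ℚ) (by simpa using fun j _ => hM j)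
  have le_sum_ht (l : List J) : (l.length : ℚ) ≤ (l.map ht).sum := by
    simpa using (l.map ht).card_nsmul_le_sum 1 (by simpa using fun j _ => one_le_ht j)
  have high_eq_zero (l : List J) (hl : (Fintype.card J * n * M : ℚ) < (l.map ht).sum) :
      (l.map f).prod = 0 := by
    induction hlen : l.length using Nat.strong_induction_on generalizing l with | _ m ih
    obtain ⟨j, hj⟩ : ∃ j, n < l.count j := by
      refine exists_lt_count_of_card_mul_lt_length ?_
      by_contra! hle
      have : (l.length * M : ℚ) ≤ Fintype.card J * n * M := by
        exact_mod_cast Nat.mul_le_mul_right M hle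
      linarith [sum_ht_le l]
    refine prod_map_eq_zero_of_le_count (hpow j) hj.le fun a b x y hl' => ?_
    rcases hcomm x y with hxy | ⟨k, c, hk, hxy⟩
    · rw [hxy, mul_zero, zero_mul]
    · have sum_ht_eq : ((a ++ k :: b).map ht).sum = (l.map ht).sum := by
        rw [← (hl'.map ht).sum_eq]
        simp only [List.map_append, List.map_cons, List.sum_append, List.sum_cons, hk]
        ring
      have length_lt : (a ++ k :: b).length < m := by
        simp [← hlen, ← hl'.length_eq]
      have := ih _ length_lt _ (sum_ht_eq ▸ hl) rfl
      rw [List.map_append, List.map_cons, List.prod_append, List.prod_cons, ← mul_assoc] at this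
      rw [hxy, mul_smul_comm, smul_mul_assoc, this, smul_zero]
  refine ⟨Fintype.card J * n * M + 1, fun l hl => high_eq_zero l (lt_of_lt_of_le ?_ (le_sum_ht l))⟩
  exact_mod_cast hl

end Nilpotence

namespace Setting

variable {K : Type u} [Field K] {p : ℕ} {O : Type v} [CommRing O] [HopfAlgebra K O]
variable {X : Type w} [AddCommGroup X] (S : Setting K p O X)
variable (χ : Module.Dual K (lieAlg K O)) {I : Set X}

/-- The type of negative roots. -/
abbrev Neg : Type w := {α : S.R // α.1 ∉ S.pos}

/-- The element `e_α - χ(e_α)` of `U_χ`, for a negative root `α`. Unlike `e_α` it is nilpotent. -/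
def uy (α : S.Neg) : S.U χ := S.ue χ α.1 - algebraMap K _ (χ (S.e α.1))

/-- The product of the elements `e_α - χ(e_α)` for `α` running through a list of negative roots.
These products applied to the highest weight vector span a baby Verma module. -/
def word (l : List S.Neg) : S.U χ := (l.map (S.uy χ)).prod

lemma word_nil : S.word χ [] = 1 := rfl

lemma word_cons (α : S.Neg) (l : List S.Neg) : S.word χ (α :: l) = S.uy χ α * S.word χ l :=
  List.prod_cons

lemma word_concat (l : List S.Neg) (α : S.Neg) :
    S.word χ (l ++ [α]) = S.word χ l * S.uy χ α := by
  simp [word]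

lemma toUι_mul_uy (x : lieAlg K O) (α : S.Neg) :
    S.toUι χ x * S.uy χ α = S.uy χ α * S.toUι χ x + S.toUι χ ⁅x, S.e α.1⁆ := by
  rw [toUι_lie, toUι_e, uy, mul_sub, sub_mul, Algebra.commutes]
  abel

lemma uy_commutator (α β : S.Neg) :
    S.uy χ α * S.uy χ β - S.uy χ β * S.uy χ α = S.toUι χ ⁅S.e α.1, S.e β.1⁆ := by
  have hαβ := S.toUι_mul_uy χ (S.e α.1) β
  rw [toUι_e] at hαβ
  rw [uy.eq_def S χ α, sub_mul, mul_sub, hαβ, Algebra.commutes]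
  abel

lemma uy_pow [Fact p.Prime] [CharP K p] (α : S.Neg) : S.uy χ α ^ p = 0 := by
  rw [uy, sub_pow_char_of_algebra K p (Algebra.commute_algebraMap_right _ _), ue_pow, map_pow,
    sub_self]

lemma one_le_neg_ht (α : S.Neg) : 1 ≤ -S.ht α.1.1 := by
  linarith [S.ht_le_neg_one α.1.2 α.2]

variable {S χ} [Infinite K] [Module.Free ℤ X]

lemma lie_e_eq_zero_or_eq_smul_e {α β : S.R} (hne : S.ht α.1 + S.ht β.1 ≠ 0) :
    ⁅S.e α, S.e β⁆ = 0 ∨ ∃ (γ : S.R) (c : K), S.ht γ.1 = S.ht α.1 + S.ht β.1 ∧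
      ⁅S.e α, S.e β⁆ = c • S.e γ := by
  have hlie := lie_mem_weightSpace _ (S.e_mem_weightSpace α) (S.e_mem_weightSpace β)
  have ht_add : S.ht (α.1 + β.1) = S.ht α.1 + S.ht β.1 := map_add _ _ _
  by_cases hroot : α.1 + β.1 ∈ S.R
  · exact .inr ⟨⟨_, hroot⟩, _, ht_add, S.eq_smul_e_of_mem_weightSpace (α := ⟨_, hroot⟩) hlie⟩
  · refine .inl (S.eq_zero_of_not_root (fun hzero => hne ?_) hroot hlie)
    rw [← ht_add, hzero, map_zero]

lemma lie_e_neg_eq_zero_or_eq_smul_e (α β : S.Neg) : ⁅S.e α.1, S.e β.1⁆ = 0 ∨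
    ∃ (γ : S.Neg) (c : K), S.ht γ.1.1 = S.ht α.1.1 + S.ht β.1.1 ∧
      ⁅S.e α.1, S.e β.1⁆ = c • S.e γ.1 := by
  have hα := S.one_le_neg_ht α
  have hβ := S.one_le_neg_ht β
  refine (lie_e_eq_zero_or_eq_smul_e (by linarith)).imp_right ?_
  rintro ⟨γ, c, hγ, hlie⟩
  exact ⟨⟨γ, fun hpos => by linarith [S.one_le_ht hpos]⟩, c, hγ, hlie⟩

lemma lie_e_pos_eq_zero_or_eq_smul_e {α β : S.R} (hα : α.1 ∈ S.pos) (hβ : β.1 ∈ S.pos) :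
    ⁅S.e α, S.e β⁆ = 0 ∨
      ∃ (γ : S.R) (c : K), γ.1 ∈ S.pos ∧ ⁅S.e α, S.e β⁆ = c • S.e γ := by
  have hα := S.one_le_ht hα
  have hβ := S.one_le_ht hβ
  refine (lie_e_eq_zero_or_eq_smul_e (by linarith)).imp_right ?_
  rintro ⟨γ, c, hγ, hlie⟩
  exact ⟨γ, c, (S.mem_pos_iff γ.2).mpr (by linarith), hlie⟩

lemma IsStandardLevi.apply_e_eq_zero_of_ht_lt (hχ : S.IsStandardLevi χ I) {γ : S.R}
    (hγ : S.ht γ.1 < -1) : χ (S.e γ) = 0 := by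
  refine hχ.apply_e_eq_zero fun hI => ?_
  have := S.ht_simple (hχ.subset hI)
  rw [map_neg] at this
  linarith

lemma IsStandardLevi.uy_commutator_eq_zero_or_eq_smul (hχ : S.IsStandardLevi χ I) (α β : S.Neg) :
    S.uy χ α * S.uy χ β - S.uy χ β * S.uy χ α = 0 ∨
      ∃ (γ : S.Neg) (c : K), -S.ht γ.1.1 = -S.ht α.1.1 + -S.ht β.1.1 ∧
        S.uy χ α * S.uy χ β - S.uy χ β * S.uy χ α = c • S.uy χ γ := by
  rw [uy_commutator]
  rcases lie_e_neg_eq_zero_or_eq_smul_e α β with hzero | ⟨γ, c, hγ, hlie⟩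
  · exact .inl (by rw [hzero, map_zero])
  · refine .inr ⟨γ, c, by linarith, ?_⟩
    have hχγ : χ (S.e γ.1) = 0 :=
      hχ.apply_e_eq_zero_of_ht_lt (by linarith [S.one_le_neg_ht α, S.one_le_neg_ht β])
    rw [hlie, map_smul, toUι_e, uy, hχγ, map_zero, sub_zero]

lemma IsStandardLevi.exists_word_eq_zero [Fact p.Prime] [CharP K p] [Finite S.R]
    (hχ : S.IsStandardLevi χ I) : ∃ k, ∀ l : List S.Neg, k ≤ l.length → S.word χ l = 0 :=
  exists_forall_le_length_prod_map_eq_zero (S.uy χ) _ S.one_le_neg_ht (S.uy_pow χ)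
    hχ.uy_commutator_eq_zero_or_eq_smul

lemma IsStandardLevi.uy_mem_uGr (hχ : S.IsStandardLevi χ I) (α : S.Neg) :
    S.uy χ α ∈ S.uGr χ I (S.cls I α.1.1) := by
  refine Submodule.sub_mem _ (S.ue_mem_uGr χ I α.1) ?_
  rcases hχ.apply_e_eq_zero_or_cls_eq_zero α.1 with hzero | hcls
  · rw [hzero, map_zero]
    exact Submodule.zero_mem _
  · rw [hcls, Algebra.algebraMap_eq_smul_one]
    exact Submodule.smul_mem _ _ (S.one_mem_uGr χ I)

lemma IsStandardLevi.word_mem_uGr (hχ : S.IsStandardLevi χ I) (l : List S.Neg) :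
    S.word χ l ∈ S.uGr χ I (l.map fun α => S.cls I α.1.1).sum := by
  induction l with
  | nil => exact S.one_mem_uGr χ I
  | cons α l ih =>
    rw [word_cons, List.map_cons, List.sum_cons]
    exact S.mul_mem_uGr (hχ.uy_mem_uGr α) ih

end Setting

/-! ### The module underlying a baby Verma module -/

namespace Setting

variable {K : Type u} [Field K] {p : ℕ} {O : Type v} [CommRing O] [HopfAlgebra K O]
variable {X : Type w} [AddCommGroup X] (S : Setting K p O X)
variable (χ : Module.Dual K (lieAlg K O)) {I : Set X}
variable (A : Type x) [CommRing A] [Algebra K A] (π : U0 K X →ₐ[K] A) (lam : X)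

/-- The `U_χ ⊗ A`-module underlying the baby Verma module `Z_{A,χ}(lam)`. -/
abbrev Ver : Type (max u v x) := (S.U χ ⊗[K] A) ⧸ S.verRel χ A π lam

variable {A}

/-- The class of `y ⊗ a` in a baby Verma module. -/
def verMk : S.U χ →ₗ[K] A →ₗ[K] S.Ver χ A π lam :=
  (TensorProduct.mk K (S.U χ) A).compr₂ ((S.verRel χ A π lam).mkQ.restrictScalars K)

lemma verMk_apply (y : S.U χ) (a : A) :
    S.verMk χ π lam y a = Submodule.Quotient.mk (y ⊗ₜ[K] a) := rfl

lemma verMk_smul_left (c : K) (y : S.U χ) (a : A) :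
    S.verMk χ π lam (c • y) a = S.verMk χ π lam y (c • a) := by
  rw [LinearMap.map_smul₂, map_smul]

lemma smul_verMk (y z : S.U χ) (a b : A) :
    (y ⊗ₜ[K] a) • S.verMk χ π lam z b = S.verMk χ π lam (y * z) (a * b) := by
  rw [verMk_apply, ← Submodule.Quotient.mk_smul, smul_eq_mul, Algebra.TensorProduct.tmul_mul_tmul,
    verMk_apply]

lemma one_tmul_smul_verMk (z : S.U χ) (a b : A) :
    ((1 : S.U χ) ⊗ₜ[K] a) • S.verMk χ π lam z b = S.verMk χ π lam z (a * b) := by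
  rw [smul_verMk, one_mul]

lemma tmul_one_smul_verMk (y z : S.U χ) (b : A) :
    (y ⊗ₜ[K] (1 : A)) • S.verMk χ π lam z b = S.verMk χ π lam (y * z) b := by
  rw [smul_verMk, one_mul]

lemma verMk_mul_ue {α : S.R} (hα : α.1 ∈ S.pos) (y : S.U χ) (a : A) :
    S.verMk χ π lam (y * S.ue χ α) a = 0 := by
  rw [verMk_apply, Submodule.Quotient.mk_eq_zero]
  exact Submodule.subset_span (.inl ⟨y, α, a, hα, rfl⟩)

lemma verMk_mul_u0 (y : S.U χ) (s : U0 K X) (a : A) :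
    S.verMk χ π lam (y * S.u0 χ s) a = S.verMk χ π lam y (a * π (tilde lam s)) := by
  rw [verMk_apply, verMk_apply, Submodule.Quotient.eq]
  exact Submodule.subset_span (.inr ⟨y, s, a, rfl⟩)

section Lift

variable {S χ π lam}

lemma verRel_toAddSubgroup_le {N : AddSubgroup (S.U χ ⊗[K] A)}
    (hpos : ∀ y (α : S.R) a, α.1 ∈ S.pos → (y * S.ue χ α) ⊗ₜ[K] a ∈ N)
    (hcartan : ∀ y s a, (y * S.u0 χ s) ⊗ₜ[K] a - y ⊗ₜ[K] (a * π (tilde lam s)) ∈ N) :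
    (S.verRel χ A π lam).toAddSubgroup ≤ N := by
  intro z hz
  change z ∈ Submodule.span _ _ at hz
  induction hz using Submodule.closure_induction with
  | zero => exact N.zero_mem
  | add _ _ _ _ hx hy => exact N.add_mem hx hy
  | smul_mem r x hx =>
    induction r using TensorProduct.induction_on with
    | zero =>
      rw [zero_smul]
      exact N.zero_mem
    | add r s hr hs =>
      rw [add_smul]
      exact N.add_mem hr hs
    | tmul u b =>
      rw [smul_eq_mul]
      rcases hx with ⟨y, α, a, hα, rfl⟩ | ⟨y, s, a, rfl⟩
      · rw [Algebra.TensorProduct.tmul_mul_tmul, ← mul_assoc]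
        exact hpos _ _ _ hα
      · rw [mul_sub, Algebra.TensorProduct.tmul_mul_tmul, Algebra.TensorProduct.tmul_mul_tmul,
          ← mul_assoc, ← mul_assoc]
        exact hcartan _ _ _

variable {V : Type*} [AddCommGroup V] [Module K V] (f : S.U χ ⊗[K] A →ₗ[K] V)
  (hpos : ∀ y (α : S.R) a, α.1 ∈ S.pos → f ((y * S.ue χ α) ⊗ₜ[K] a) = 0)
  (hcartan : ∀ y s a, f ((y * S.u0 χ s) ⊗ₜ[K] a) = f (y ⊗ₜ[K] (a * π (tilde lam s))))

/-- The universal property of the tensor product `U_χ ⊗_{U⁰U⁺} A^lam`, for `K`-linear maps. -/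
def verLift : S.Ver χ A π lam →ₗ[K] V :=
  ((S.verRel χ A π lam).restrictScalars K).liftQ f
      (verRel_toAddSubgroup_le (N := (LinearMap.ker f).toAddSubgroup) hpos
        fun y s a => LinearMap.sub_mem_ker_iff.mpr (hcartan y s a)) ∘ₗ
    (Submodule.Quotient.restrictScalarsEquiv K (S.verRel χ A π lam)).symm.toLinearMap

lemma verLift_verMk (y : S.U χ) (a : A) :
    verLift f hpos hcartan (S.verMk χ π lam y a) = f (y ⊗ₜ[K] a) := rfl

end Lift

section Slice

variable {S χ π lam}

/-- The elements `y ∈ U_χ` such that the classes of all `y ⊗ a` lie in `N`. -/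
def verSlice (N : AddSubgroup (S.Ver χ A π lam)) : Submodule K (S.U χ) where
  carrier := {y | ∀ a, S.verMk χ π lam y a ∈ N}
  add_mem' hy hz a := by
    rw [LinearMap.map_add₂]
    exact N.add_mem (hy a) (hz a)
  zero_mem' a := by
    rw [LinearMap.map_zero₂]
    exact N.zero_mem
  smul_mem' c y hy a := by
    rw [verMk_smul_left]
    exact hy _

lemma mem_verSlice {N : AddSubgroup (S.Ver χ A π lam)} {y : S.U χ} :
    y ∈ verSlice N ↔ ∀ a, S.verMk χ π lam y a ∈ N := Iff.rfl

lemma eq_top_of_verSlice_eq_top {N : AddSubgroup (S.Ver χ A π lam)} (hN : verSlice N = ⊤) :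
    N = ⊤ := by
  refine (AddSubgroup.eq_top_iff' N).mpr fun z => ?_
  obtain ⟨t, rfl⟩ := Submodule.Quotient.mk_surjective _ z
  induction t using TensorProduct.induction_on with
  | zero => exact N.zero_mem
  | tmul y a => exact mem_verSlice.mp (hN ▸ Submodule.mem_top) a
  | add _ _ ht ht' => exact N.add_mem ht ht'

end Slice

/-- The span of the words in the elements `e_α - χ(e_α)` applied to the highest weight vectors. -/
def verWords : AddSubgroup (S.Ver χ A π lam) :=
  AddSubgroup.closure {z | ∃ l a, z = S.verMk χ π lam (S.word χ l) a}

variable {S χ π lam}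

lemma word_mem_verSlice_verWords (l : List S.Neg) :
    S.word χ l ∈ verSlice (S.verWords χ π lam) :=
  fun a => AddSubgroup.subset_closure ⟨l, a, rfl⟩

lemma mul_mem_verSlice_verWords {y z : S.U χ}
    (hy : ∀ l, y * S.word χ l ∈ verSlice (S.verWords χ π lam))
    (hz : z ∈ verSlice (S.verWords χ π lam)) : y * z ∈ verSlice (S.verWords χ π lam) := by
  have hstable : S.verWords χ π lam ≤
      (S.verWords χ π lam).comap (DistribSMul.toAddMonoidHom _ (y ⊗ₜ[K] (1 : A))) := by
    refine (AddSubgroup.closure_le _).mpr ?_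
    rintro _ ⟨l, a, rfl⟩
    change (y ⊗ₜ[K] (1 : A)) • S.verMk χ π lam (S.word χ l) a ∈ S.verWords χ π lam
    rw [tmul_one_smul_verMk]
    exact hy l a
  intro a
  rw [← tmul_one_smul_verMk]
  exact hstable (hz a)

lemma toUι_mem_verSlice_verWords (x : lieAlg K O) :
    S.toUι χ x ∈ verSlice (S.verWords χ π lam) := by
  suffices htop : (verSlice (S.verWords χ π lam)).comap (S.toUι χ) = ⊤ from
    Submodule.mem_comap.mp (htop ▸ Submodule.mem_top)
  rw [eq_top_iff, ← S.basis.span_eq, Submodule.span_le]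
  rintro _ ⟨α | i, rfl⟩ a
  · change S.verMk χ π lam (S.ue χ α) a ∈ _
    by_cases hα : α.1 ∈ S.pos
    · rw [← one_mul (S.ue χ α), S.verMk_mul_ue χ π lam hα]
      exact AddSubgroup.zero_mem _
    · have hue : S.ue χ α = S.word χ [⟨α, hα⟩] + χ (S.e α) • S.word χ [] := by
        rw [word_cons, word_nil, mul_one, uy, ← Algebra.algebraMap_eq_smul_one, sub_add_cancel]
      rw [hue]
      exact Submodule.add_mem _ (word_mem_verSlice_verWords _)
        (Submodule.smul_mem _ _ (word_mem_verSlice_verWords _)) a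
  · obtain ⟨h, hh⟩ := S.basis_cartan i
    change S.verMk χ π lam (S.toUι χ _) a ∈ _
    rw [hh, toUι_lieMap, uh, ← one_mul (S.u0 χ _), verMk_mul_u0]
    exact word_mem_verSlice_verWords [] _

lemma toUι_mul_word_mem_verSlice_verWords (x : lieAlg K O) (l : List S.Neg) :
    S.toUι χ x * S.word χ l ∈ verSlice (S.verWords χ π lam) := by
  induction l generalizing x with
  | nil =>
    rw [word_nil, mul_one]
    exact toUι_mem_verSlice_verWords x
  | cons β l ih =>
    rw [word_cons, ← mul_assoc, toUι_mul_uy, add_mul, mul_assoc]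
    refine Submodule.add_mem _ (mul_mem_verSlice_verWords (fun m => ?_) (ih x)) (ih _)
    rw [← word_cons]
    exact word_mem_verSlice_verWords _

theorem verWords_eq_top : S.verWords χ π lam = ⊤ := by
  refine eq_top_of_verSlice_eq_top (Submodule.eq_top_iff'.mpr fun y => ?_)
  obtain ⟨u, rfl⟩ := S.toU_surjective χ y
  induction u using ι_mul_induction with
  | one => exact (map_one (S.toU χ)).symm ▸ word_mem_verSlice_verWords []
  | add u u' hu hu' => exact (map_add (S.toU χ) u u').symm ▸ Submodule.add_mem _ hu hu'
  | smul c u hu => exact (map_smul (S.toU χ) c u).symm ▸ Submodule.smul_mem _ c hu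
  | ι_mul x u hu =>
    rw [map_mul]
    exact mul_mem_verSlice_verWords (toUι_mul_word_mem_verSlice_verWords x) hu

section Projection

variable [Infinite K] [Module.Free ℤ X] (hχ : S.IsStandardLevi χ I)

variable (π lam) in
/-- The map of baby Verma modules induced by the projection of `U_χ` onto its component of degree
`σ`; it is the projection onto the component of degree `σ + lam`. -/
def verProj (σ : S.XI I) : S.Ver χ A π lam →ₗ[K] S.Ver χ A π lam :=
  verLift (TensorProduct.lift (S.verMk χ π lam ∘ₗ uProj hχ σ))
    (fun y α a hα => by
      rw [TensorProduct.lift.tmul, LinearMap.comp_apply, uProj_mul_ue, verMk_mul_ue _ _ _ _ hα])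
    fun y s a => by
      rw [TensorProduct.lift.tmul, TensorProduct.lift.tmul, LinearMap.comp_apply, uProj_mul_u0,
        verMk_mul_u0, LinearMap.comp_apply]

lemma verProj_verMk (σ : S.XI I) (y : S.U χ) (a : A) :
    verProj π lam hχ σ (S.verMk χ π lam y a) = S.verMk χ π lam (uProj hχ σ y) a := rfl

end Projection

end Setting

/-! ### Baby Verma modules are objects of `𝒞_A` -/

namespace Setting

variable {K : Type u} [Field K] {p : ℕ} {O : Type v} [CommRing O] [HopfAlgebra K O]
variable {X : Type w} [AddCommGroup X] {S : Setting K p O X}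
variable {χ : Module.Dual K (lieAlg K O)} {I : Set X}
variable {A : Type x} [CommRing A] [Algebra K A] {π : U0 K X →ₐ[K] A} {lam : X}

-- On the weight space of weight `ξ` the operators `h ⊗ 1 - 1 ⊗ π(h)` have the eigenvalues `ξ(h)`.
lemma GrMod.iSupIndep_wt_of_act (M : S.GrMod χ I A) (σ : S.XI I)
    (hbot : ∀ ξ ∉ S.weights I σ, M.wt σ ξ = ⊥)
    (hact : ∀ μ : X, dchar μ ∈ S.weights I σ → ∀ (s : U0 K X), ∀ m ∈ M.wt σ (dchar μ),
      (S.u0 χ s ⊗ₜ[K] (1 : A)) • m = ((1 : S.U χ) ⊗ₜ[K] π (tilde μ s)) • m) :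
    iSupIndep (M.wt σ) := by
  let _ : Module K M.carrier := Module.compHom _ (algebraMap K (S.U χ ⊗[K] A))
  have : IsScalarTower K (S.U χ ⊗[K] A) M.carrier :=
    IsScalarTower.of_algebraMap_smul fun _ _ => rfl
  let t (h : Cartan K X) : S.U χ ⊗[K] A :=
    S.uh χ h ⊗ₜ[K] 1 - 1 ⊗ₜ[K] π (UniversalEnvelopingAlgebra.ι K h)
  have t_commute (h h' : Cartan K X) : Commute (t h) (t h') := by
    have commute_tmul {y y' : S.U χ} (hy : Commute y y') (a a' : A) :
        Commute (y ⊗ₜ[K] a) (y' ⊗ₜ[K] a') := hy.tmul (Commute.all a a')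
    exact ((commute_tmul (S.commute_uh χ h h') _ _).sub_right
        (commute_tmul (Commute.one_right _) _ _)).sub_left
      ((commute_tmul (Commute.one_left _) _ _).sub_right
        (commute_tmul (Commute.one_left _) _ _))
  refine iSupIndep_addSubgroup_of_eigen (f := fun h => Algebra.lsmul K K M.carrier (t h))
    (fun h h' => (t_commute h h').map _) (c := fun ξ h => ξ h) DFunLike.coe_injective
    fun ξ m hm h => ?_
  by_cases hξ : ξ ∈ S.weights I σ
  · obtain ⟨μ, -, -, rfl⟩ := id hξ
    have scalar : (1 : S.U χ) ⊗ₜ[K] algebraMap K A (dchar μ h) =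
        algebraMap K (S.U χ ⊗[K] A) (dchar μ h) := by
      rw [Algebra.algebraMap_eq_smul_one, Algebra.algebraMap_eq_smul_one, TensorProduct.tmul_smul,
        Algebra.TensorProduct.one_def]
    change (S.uh χ h ⊗ₜ[K] 1 - 1 ⊗ₜ[K] π (UniversalEnvelopingAlgebra.ι K h)) • m = _
    rw [sub_smul, uh, hact μ hξ _ m hm, tilde_ι, map_add, AlgHom.commutes,
      TensorProduct.tmul_add, add_smul, add_sub_cancel_left, scalar, algebraMap_smul]
  · rw [hbot ξ hξ, AddSubgroup.mem_bot] at hm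
    rw [hm, map_zero, smul_zero]

lemma verMk_mem_gr {σ : S.XI I} {y : S.U χ} (hy : y ∈ S.uGr χ I (σ - S.cls I lam)) (a : A) :
    S.verMk χ π lam y a ∈ (S.babyVerma χ I A π lam).gr σ :=
  AddSubgroup.subset_closure ⟨y, hy, a, rfl⟩

lemma verMk_mem_wt {σ : S.XI I} {ξ : Module.Dual K (Cartan K X)} {y : S.U χ}
    (hy : y ∈ S.uWt χ I (σ - S.cls I lam) (ξ - dchar lam)) (a : A) :
    S.verMk χ π lam y a ∈ (S.babyVerma χ I A π lam).wt σ ξ :=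
  AddSubgroup.subset_closure ⟨y, hy, a, rfl⟩

lemma babyVerma_gr_le_iff {σ : S.XI I} {N : AddSubgroup (S.Ver χ A π lam)} :
    (S.babyVerma χ I A π lam).gr σ ≤ N ↔ S.uGr χ I (σ - S.cls I lam) ≤ verSlice N := by
  refine ⟨fun hN y hy a => hN (verMk_mem_gr hy a), fun hN => (AddSubgroup.closure_le _).mpr ?_⟩
  rintro _ ⟨y, hy, a, rfl⟩
  exact hN hy a

lemma babyVerma_wt_le_iff {σ : S.XI I} {ξ : Module.Dual K (Cartan K X)}
    {N : AddSubgroup (S.Ver χ A π lam)} : (S.babyVerma χ I A π lam).wt σ ξ ≤ N ↔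
      S.uWt χ I (σ - S.cls I lam) (ξ - dchar lam) ⊆ verSlice N := by
  refine ⟨fun hN y hy a => hN (verMk_mem_wt hy a), fun hN => (AddSubgroup.closure_le _).mpr ?_⟩
  rintro _ ⟨y, hy, a, rfl⟩
  exact hN hy a

lemma iSup_babyVerma_gr : ⨆ σ, (S.babyVerma χ I A π lam).gr σ = ⊤ := by
  refine eq_top_of_verSlice_eq_top (π := π) (lam := lam) (eq_top_iff.mpr ?_)
  rw [← S.iSup_uGr χ I]
  refine iSup_le fun σ => ?_
  have hle : S.uGr χ I (σ + S.cls I lam - S.cls I lam) ≤ _ := babyVerma_gr_le_iff.mp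
    (le_iSup (S.babyVerma χ I A π lam).gr (σ + S.cls I lam))
  rwa [add_sub_cancel_right] at hle

lemma smul_mem_babyVerma_gr {σ : S.XI I} (b : A) {m : S.Ver χ A π lam}
    (hm : m ∈ (S.babyVerma χ I A π lam).gr σ) :
    ((1 : S.U χ) ⊗ₜ[K] b) • m ∈ (S.babyVerma χ I A π lam).gr σ := by
  refine babyVerma_gr_le_iff (N := AddSubgroup.comap
    (DistribSMul.toAddMonoidHom (S.Ver χ A π lam) ((1 : S.U χ) ⊗ₜ[K] b))
    ((S.babyVerma χ I A π lam).gr σ)).mpr (fun y hy a => ?_) hm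
  change ((1 : S.U χ) ⊗ₜ[K] b) • S.verMk χ π lam y a ∈ (S.babyVerma χ I A π lam).gr σ
  rw [one_tmul_smul_verMk]
  exact verMk_mem_gr hy _

lemma mul_mem_babyVerma_gr {σ τ : S.XI I} {u : S.U χ} (hu : u ∈ S.uGr χ I σ)
    {m : S.Ver χ A π lam} (hm : m ∈ (S.babyVerma χ I A π lam).gr τ) :
    (u ⊗ₜ[K] (1 : A)) • m ∈ (S.babyVerma χ I A π lam).gr (σ + τ) := by
  refine babyVerma_gr_le_iff (N := AddSubgroup.comap
    (DistribSMul.toAddMonoidHom (S.Ver χ A π lam) (u ⊗ₜ[K] (1 : A)))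
    ((S.babyVerma χ I A π lam).gr (σ + τ))).mpr (fun y hy a => ?_) hm
  change (u ⊗ₜ[K] (1 : A)) • S.verMk χ π lam y a ∈ (S.babyVerma χ I A π lam).gr (σ + τ)
  rw [tmul_one_smul_verMk]
  refine verMk_mem_gr ?_ _
  rw [add_sub_assoc]
  exact S.mul_mem_uGr hu hy

lemma smul_mem_babyVerma_wt {σ : S.XI I} {ξ : Module.Dual K (Cartan K X)} (b : A)
    {m : S.Ver χ A π lam} (hm : m ∈ (S.babyVerma χ I A π lam).wt σ ξ) :
    ((1 : S.U χ) ⊗ₜ[K] b) • m ∈ (S.babyVerma χ I A π lam).wt σ ξ := by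
  refine babyVerma_wt_le_iff (N := AddSubgroup.comap
    (DistribSMul.toAddMonoidHom (S.Ver χ A π lam) ((1 : S.U χ) ⊗ₜ[K] b))
    ((S.babyVerma χ I A π lam).wt σ ξ)).mpr (fun y hy a => ?_) hm
  change ((1 : S.U χ) ⊗ₜ[K] b) • S.verMk χ π lam y a ∈ (S.babyVerma χ I A π lam).wt σ ξ
  rw [one_tmul_smul_verMk]
  exact verMk_mem_wt hy _

lemma u0_smul_of_mem_babyVerma_wt {σ : S.XI I} {μ : X} (s : U0 K X) {m : S.Ver χ A π lam}
    (hm : m ∈ (S.babyVerma χ I A π lam).wt σ (dchar μ)) :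
    (S.u0 χ s ⊗ₜ[K] (1 : A)) • m = ((1 : S.U χ) ⊗ₜ[K] π (tilde μ s)) • m := by
  refine babyVerma_wt_le_iff (N := AddMonoidHom.eqLocus
    (DistribSMul.toAddMonoidHom _ (S.u0 χ s ⊗ₜ[K] (1 : A)))
    (DistribSMul.toAddMonoidHom _ ((1 : S.U χ) ⊗ₜ[K] π (tilde μ s)))).mpr (fun y hy a => ?_) hm
  change (S.u0 χ s ⊗ₜ[K] (1 : A)) • S.verMk χ π lam y a =
    ((1 : S.U χ) ⊗ₜ[K] π (tilde μ s)) • S.verMk χ π lam y a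
  rw [← dchar_sub] at hy
  rw [tmul_one_smul_verMk, one_tmul_smul_verMk, S.u0_mul_of_mem_uWt hy, verMk_mul_u0, tilde_tilde,
    add_sub_cancel, mul_comm]

variable [Infinite K] [Module.Free ℤ X]

lemma iSup_babyVerma_wt (σ : S.XI I) :
    ⨆ ξ, (S.babyVerma χ I A π lam).wt σ ξ = (S.babyVerma χ I A π lam).gr σ := by
  refine le_antisymm (iSup_le fun ξ => AddSubgroup.closure_mono ?_)
    (babyVerma_gr_le_iff.mpr (Submodule.span_le.mpr ?_))
  · rintro _ ⟨y, hy, a, rfl⟩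
    exact ⟨y, hy.1, a, rfl⟩
  · rintro _ ⟨l, hl, rfl⟩ a
    obtain ⟨ν, hν, hmem⟩ := S.exists_list_prod_mem_uWt χ I l
    refine AddSubgroup.mem_iSup_of_mem (dchar ν + dchar lam) (verMk_mem_wt ?_ a)
    rwa [add_sub_cancel_right, ← hl, ← hν]

lemma babyVerma_wt_eq_bot {σ : S.XI I} {ξ : Module.Dual K (Cartan K X)}
    (hξ : ξ ∉ S.weights I σ) : (S.babyVerma χ I A π lam).wt σ ξ = ⊥ := by
  refine eq_bot_iff.mpr (babyVerma_wt_le_iff.mpr fun y hy => ?_)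
  have hzero : y = 0 := eq_zero_of_mem_uWt S (fun ν hν hdν => hξ ⟨ν + lam, 0, ?_, ?_⟩) hy
  · exact hzero ▸ Submodule.zero_mem _
  · rw [smul_zero, sub_zero, cls_add, hν, sub_add_cancel]
  · rw [dchar_add, hdν, sub_add_cancel]

lemma ue_smul_mem_babyVerma_wt {σ : S.XI I} {μ : X} (α : S.R) {m : S.Ver χ A π lam}
    (hm : m ∈ (S.babyVerma χ I A π lam).wt σ (dchar μ)) : (S.ue χ α ⊗ₜ[K] (1 : A)) • m ∈
      (S.babyVerma χ I A π lam).wt (S.cls I α.1 + σ) (dchar (μ + α.1)) := by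
  refine babyVerma_wt_le_iff (N := AddSubgroup.comap
    (DistribSMul.toAddMonoidHom (S.Ver χ A π lam) (S.ue χ α ⊗ₜ[K] (1 : A)))
    ((S.babyVerma χ I A π lam).wt (S.cls I α.1 + σ) (dchar (μ + α.1)))).mpr
    (fun y hy a => ?_) hm
  change (S.ue χ α ⊗ₜ[K] (1 : A)) • S.verMk χ π lam y a ∈
    (S.babyVerma χ I A π lam).wt (S.cls I α.1 + σ) (dchar (μ + α.1))
  rw [tmul_one_smul_verMk]
  refine verMk_mem_wt ?_ _
  rw [add_sub_assoc, add_comm μ, dchar_add, add_sub_assoc]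
  exact S.mul_mem_uWt (S.ue_mem_uWt χ I α) hy

lemma verProj_of_mem_gr (hχ : S.IsStandardLevi χ I) {σ : S.XI I} {z : S.Ver χ A π lam}
    (hz : z ∈ (S.babyVerma χ I A π lam).gr σ) : verProj π lam hχ (σ - S.cls I lam) z = z := by
  refine babyVerma_gr_le_iff (N := AddMonoidHom.eqLocus
    (verProj π lam hχ (σ - S.cls I lam)).toAddMonoidHom (.id _)).mpr (fun y hy a => ?_) hz
  change verProj π lam hχ (σ - S.cls I lam) (S.verMk χ π lam y a) = S.verMk χ π lam y a
  rw [verProj_verMk, uProj_of_mem hχ hy]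

lemma verProj_of_mem_gr_of_ne (hχ : S.IsStandardLevi χ I) {σ τ : S.XI I} (hne : τ ≠ σ)
    {z : S.Ver χ A π lam} (hz : z ∈ (S.babyVerma χ I A π lam).gr τ) :
    verProj π lam hχ (σ - S.cls I lam) z = 0 := by
  refine babyVerma_gr_le_iff (N := (verProj π lam hχ (σ - S.cls I lam)).toAddMonoidHom.ker).mpr
    (fun y hy a => ?_) hz
  change verProj π lam hχ (σ - S.cls I lam) (S.verMk χ π lam y a) = 0
  rw [verProj_verMk, uProj_of_mem_of_ne hχ (fun h => hne (sub_left_injective h)) hy,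
    LinearMap.map_zero₂]

variable (π lam) in
lemma IsStandardLevi.iSupIndep_babyVerma_gr (hχ : S.IsStandardLevi χ I) :
    iSupIndep (S.babyVerma χ I A π lam).gr := by
  classical
  refine (iSupIndep_addSubgroup_iff (V := S.Ver χ A π lam)).mpr fun s m hm hsum σ hσ => ?_
  have hproj : ∀ τ ∈ s, verProj π lam hχ (σ - S.cls I lam) (m τ) = if τ = σ then m σ else 0 := by
    intro τ hτ
    split_ifs with h
    · exact h ▸ verProj_of_mem_gr hχ (hm _ hτ)
    · exact verProj_of_mem_gr_of_ne hχ h (hm τ hτ)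
  simpa [map_sum, Finset.sum_congr rfl hproj, hσ] using
    congrArg (verProj π lam hχ (σ - S.cls I lam)) hsum

variable (S χ π lam) in
/-- The vectors `y ⊗ a` of degree `σ` in `Z(λ)` given by the non-zero words `y` in the elements
`e_α - χ(e_α)`. -/
def wordVecs (σ : S.XI I) : Set (S.Ver χ A π lam) :=
  {m | ∃ (l : List S.Neg) (a : A), S.word χ l ≠ 0 ∧
    (l.map fun α => S.cls I α.1.1).sum = σ - S.cls I lam ∧ m = S.verMk χ π lam (S.word χ l) a}

lemma IsStandardLevi.verProj_word_mem_closure (hχ : S.IsStandardLevi χ I) (σ : S.XI I)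
    (l : List S.Neg) (a : A) :
    verProj π lam hχ (σ - S.cls I lam) (S.verMk χ π lam (S.word χ l) a) ∈
      AddSubgroup.closure (S.wordVecs χ π lam σ) := by
  rw [verProj_verMk]
  by_cases hl : S.word χ l = 0
  · rw [hl, map_zero, LinearMap.map_zero₂]
    exact AddSubgroup.zero_mem _
  by_cases hdeg : (l.map fun α => S.cls I α.1.1).sum = σ - S.cls I lam
  · rw [uProj_of_mem hχ (hdeg ▸ hχ.word_mem_uGr l)]
    exact AddSubgroup.subset_closure ⟨l, a, hl, hdeg, rfl⟩
  · rw [uProj_of_mem_of_ne hχ hdeg (hχ.word_mem_uGr l), LinearMap.map_zero₂]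
    exact AddSubgroup.zero_mem _

lemma IsStandardLevi.babyVerma_gr_eq_closure_wordVecs (hχ : S.IsStandardLevi χ I)
    (σ : S.XI I) :
    (S.babyVerma χ I A π lam).gr σ = AddSubgroup.closure (S.wordVecs χ π lam σ) := by
  refine le_antisymm (fun (z : S.Ver χ A π lam) hz => ?_) ((AddSubgroup.closure_le _).mpr ?_)
  · have hwords : S.verWords χ π lam ≤ (AddSubgroup.closure (S.wordVecs χ π lam σ)).comap
        (verProj π lam hχ (σ - S.cls I lam)).toAddMonoidHom := by
      refine (AddSubgroup.closure_le _).mpr ?_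
      rintro _ ⟨l, a, rfl⟩
      exact hχ.verProj_word_mem_closure σ l a
    rw [← verProj_of_mem_gr hχ hz]
    exact hwords ((verWords_eq_top (π := π)).ge (AddSubgroup.mem_top z))
  · rintro _ ⟨l, a, -, hdeg, rfl⟩
    exact verMk_mem_gr (hdeg ▸ hχ.word_mem_uGr l) a

variable [Fact p.Prime] [CharP K p] [Finite S.R]

lemma IsStandardLevi.finite_word_ne_zero (hχ : S.IsStandardLevi χ I) :
    {l : List S.Neg | S.word χ l ≠ 0}.Finite := by
  obtain ⟨k, hk⟩ := hχ.exists_word_eq_zero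
  exact (List.finite_length_lt _ k).subset fun l hl => not_le.mp fun hkl => hl (hk l hkl)

variable (π lam) in
lemma IsStandardLevi.finite_babyVerma_gr_ne_bot (hχ : S.IsStandardLevi χ I) :
    {σ | (S.babyVerma χ I A π lam).gr σ ≠ ⊥}.Finite := by
  refine (hχ.finite_word_ne_zero.image fun l =>
    (l.map fun α => S.cls I α.1.1).sum + S.cls I lam).subset fun σ hσ => ?_
  by_contra hnot
  refine hσ (eq_bot_iff.mpr ((hχ.babyVerma_gr_eq_closure_wordVecs σ).le.trans
    ((AddSubgroup.closure_le (G := S.Ver χ A π lam) _).mpr ?_)))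
  rintro _ ⟨l, a, hl, hdeg, rfl⟩
  exact (hnot ⟨l, hl, by simp only [hdeg, sub_add_cancel]⟩).elim

lemma IsStandardLevi.babyVerma_gr_fg (hχ : S.IsStandardLevi χ I) (σ : S.XI I) :
    ∃ s : Finset (S.Ver χ A π lam), (S.babyVerma χ I A π lam).gr σ =
      AddSubgroup.closure {m | ∃ a : A, ∃ y ∈ s, m = ((1 : S.U χ) ⊗ₜ[K] a) • y} := by
  have hfin := (hχ.finite_word_ne_zero.subset (Set.sep_subset _ fun l =>
    (l.map fun α => S.cls I α.1.1).sum = σ - S.cls I lam)).image fun l =>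
      S.verMk χ π lam (S.word χ l) 1
  refine ⟨hfin.toFinset, ?_⟩
  rw [hχ.babyVerma_gr_eq_closure_wordVecs]
  refine congrArg _ (Set.ext fun m => ?_)
  simp only [wordVecs, Set.mem_ofPred_eq, Set.Finite.mem_toFinset]
  constructor
  · rintro ⟨l, a, hl, hdeg, rfl⟩
    exact ⟨a, _, ⟨l, ⟨hl, hdeg⟩, rfl⟩, by rw [one_tmul_smul_verMk, mul_one]⟩
  · rintro ⟨a, _, ⟨l, ⟨hl, hdeg⟩, rfl⟩, rfl⟩
    exact ⟨l, a, hl, hdeg, by rw [one_tmul_smul_verMk, mul_one]⟩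

variable (π lam) in
theorem IsStandardLevi.babyVerma_isObject (hχ : S.IsStandardLevi χ I) :
    (S.babyVerma χ I A π lam).IsObject π where
  gr_indep := hχ.iSupIndep_babyVerma_gr π lam
  gr_top := iSup_babyVerma_gr
  gr_smul _ a _ hm := smul_mem_babyVerma_gr a hm
  gr_finite := hχ.finite_babyVerma_gr_ne_bot π lam
  gr_fg := hχ.babyVerma_gr_fg
  gr_mul _ _ _ hu _ hm := mul_mem_babyVerma_gr hu hm
  wt_indep σ := GrMod.iSupIndep_wt_of_act _ σ (fun _ => babyVerma_wt_eq_bot)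
    fun _ _ s _ hm => u0_smul_of_mem_babyVerma_wt s hm
  wt_sum := iSup_babyVerma_wt
  wt_bot _ _ := babyVerma_wt_eq_bot
  wt_act _ _ _ s _ hm := u0_smul_of_mem_babyVerma_wt s hm
  wt_root _ _ α _ _ hm := ue_smul_mem_babyVerma_wt α hm
  wt_smul _ _ a _ hm := smul_mem_babyVerma_wt a hm

end Setting

/-! ### Baby Verma modules are non-zero -/

lemma exists_linearMap_comp_mkAlgHom_eq {K : Type*} [CommRing K] {B : Type*} [Ring B] [Algebra K B]
    {V : Type*} [AddCommGroup V] [Module K V] {r : B → B → Prop} (θ : B →ₗ[K] V)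
    (hθ : ∀ a b, r a b → ∀ u v, θ (u * a * v) = θ (u * b * v)) :
    ∃ θ' : RingQuot r →ₗ[K] V, ∀ z, θ' (RingQuot.mkAlgHom K r z) = θ z := by
  let con : RingCon B :=
    { r := fun a b => ∀ u v, θ (u * a * v) = θ (u * b * v)
      iseqv := ⟨fun _ _ _ => rfl, fun h u v => (h u v).symm,
        fun h h' u v => (h u v).trans (h' u v)⟩
      mul' := fun {a b a' b'} h h' u v => by
        rw [← mul_assoc, mul_assoc _ a', h, ← mul_assoc, h', mul_assoc u]
      add' := fun h h' u v => by
        rw [mul_add, mul_add, add_mul, add_mul, map_add, map_add, h, h'] }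
  have ker_le : LinearMap.ker (RingQuot.mkAlgHom K r).toLinearMap ≤ LinearMap.ker θ := by
    intro z hz
    have mk_zero : RingQuot.mkRingHom r z = 0 := by
      rw [← RingQuot.mkAlgHom_coe K]
      exact hz
    have con_zero : con.mk' z = con.mk' 0 := by
      rw [← RingQuot.lift_mkRingHom_apply con.mk' fun a b hab => (RingCon.eq con).mpr (hθ a b hab),
        mk_zero, map_zero, map_zero]
    simpa using (RingCon.eq con).mp con_zero 1 1
  let e := (RingQuot.mkAlgHom K r).toLinearMap.quotKerEquivOfSurjective
    (RingQuot.mkAlgHom_surjective K r)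
  refine ⟨Submodule.liftQ _ θ ker_le ∘ₗ e.symm.toLinearMap, fun z => ?_⟩
  have e_symm : e.symm (RingQuot.mkAlgHom K r z) = Submodule.Quotient.mk z := by
    rw [LinearEquiv.symm_apply_eq]
    rfl
  rw [LinearMap.comp_apply, LinearEquiv.coe_coe, e_symm, Submodule.liftQ_apply]

namespace Setting

variable {K : Type u} [Field K] {p : ℕ} {O : Type v} [CommRing O] [HopfAlgebra K O]
variable {X : Type w} [AddCommGroup X] (S : Setting K p O X)

/-- The subspace `𝔫⁺` spanned by the positive root vectors. -/
def posSpan : Submodule K (lieAlg K O) :=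
  Submodule.span K {x | ∃ α : S.R, α.1 ∈ S.pos ∧ x = S.e α}

/-- The spanning set of `𝔥 + 𝔫⁺` consisting of `𝔥` and the positive root vectors. -/
def borelVecs : Set (lieAlg K O) :=
  {x | (∃ α : S.R, α.1 ∈ S.pos ∧ x = S.e α) ∨ ∃ h, x = lieMap S.torus h}

/-- The basis vector `h_i`, as an element of `𝔥`. -/
def cartanVec (i : Fin (Module.finrank ℤ X)) : Cartan K X := (S.basis_cartan i).choose

lemma lieMap_cartanVec (i) : lieMap S.torus (S.cartanVec i) = S.basis (Sum.inr i) :=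
  (S.basis_cartan i).choose_spec.symm

variable {S}

lemma e_mem_posSpan {α : S.R} (hα : α.1 ∈ S.pos) : S.e α ∈ S.posSpan :=
  Submodule.subset_span ⟨α, hα, rfl⟩

section BorelChar

variable {A : Type x} [CommRing A] [Algebra K A] (π : U0 K X →ₐ[K] A) (lam : X)

variable (S) in
/-- The character through which `𝔟` acts on the highest weight vector, extended by zero to the
negative root vectors. -/
def borelChar : lieAlg K O →ₗ[K] A :=
  S.basis.constr K (Sum.elim (fun _ => 0)
    fun i => π (tilde lam (UniversalEnvelopingAlgebra.ι K (S.cartanVec i))))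

lemma borelChar_e (α : S.R) : S.borelChar π lam (S.e α) = 0 := by
  rw [borelChar, e, Module.Basis.constr_basis, Sum.elim_inl]

lemma posSpan_le_ker_borelChar : S.posSpan ≤ LinearMap.ker (S.borelChar π lam) := by
  refine Submodule.span_le.mpr ?_
  rintro _ ⟨α, -, rfl⟩
  exact borelChar_e π lam α

end BorelChar

variable [Infinite K] [Module.Free ℤ X]

lemma lieMap_mem_span_basis_inr (h : Cartan K X) :
    lieMap S.torus h ∈ Submodule.span K (Set.range fun i => S.basis (Sum.inr i)) := by
  rw [← S.basis.linearCombination_repr (lieMap S.torus h)]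
  refine Submodule.sum_mem _ fun b _ => ?_
  change S.basis.repr (lieMap S.torus h) b • S.basis b ∈ _
  rcases b with α | i
  · rw [S.repr_eq_zero_of_idxWt_ne (lieMap_mem_weightSpace S.torus h) (b := Sum.inl α) α.2.1,
      zero_smul]
    exact Submodule.zero_mem _
  · exact Submodule.smul_mem _ _ (Submodule.subset_span ⟨i, rfl⟩)

lemma span_range_cartanVec : Submodule.span K (Set.range S.cartanVec) = ⊤ := by
  refine Submodule.eq_top_iff'.mpr fun h => ?_
  have hmem := lieMap_mem_span_basis_inr (S := S) h
  simp only [← lieMap_cartanVec] at hmem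
  rw [Set.range_comp' (lieMap S.torus) S.cartanVec] at hmem
  obtain ⟨h', hh', heq⟩ :=
    Submodule.map_span (lieMap S.torus : Cartan K X →ₗ[K] lieAlg K O) _ ▸ hmem
  exact lieMap_injective S.torus_max.1 heq ▸ hh'

lemma lie_mem_posSpan {x y : lieAlg K O} (hx : x ∈ Submodule.span K S.borelVecs)
    (hy : y ∈ Submodule.span K S.borelVecs) : ⁅x, y⁆ ∈ S.posSpan := by
  refine LinearMap.BilinMap.apply_apply_mem_of_mem_span S.posSpan _ _
    (LieAlgebra.ad K (lieAlg K O)).toLinearMap ?_ x y hx hy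
  rintro _ (⟨α, hα, rfl⟩ | ⟨h, rfl⟩) _ (⟨β, hβ, rfl⟩ | ⟨h', rfl⟩)
  · change ⁅S.e α, S.e β⁆ ∈ _
    rcases lie_e_pos_eq_zero_or_eq_smul_e hα hβ with hzero | ⟨γ, c, hγ, hlie⟩
    · exact hzero ▸ Submodule.zero_mem _
    · exact hlie ▸ Submodule.smul_mem _ _ (e_mem_posSpan hγ)
  · change ⁅S.e α, lieMap S.torus h'⁆ ∈ _
    rw [← lie_skew, lie_weightSpace _ (S.e_mem_weightSpace α)]
    exact Submodule.neg_mem _ (Submodule.smul_mem _ _ (e_mem_posSpan hα))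
  · change ⁅lieMap S.torus h, S.e β⁆ ∈ _
    rw [lie_weightSpace _ (S.e_mem_weightSpace β)]
    exact Submodule.smul_mem _ _ (e_mem_posSpan hβ)
  · change ⁅lieMap S.torus h, lieMap S.torus h'⁆ ∈ _
    rw [← LieHom.map_lie, cartan_lie, map_zero (lieMap S.torus)]
    exact Submodule.zero_mem _

variable (S) in
/-- The Lie algebra `𝔫⁻` spanned by the negative root vectors. -/
def negLie : LieSubalgebra K (lieAlg K O) where
  toSubmodule := Submodule.span K (Set.range fun α : S.Neg => S.e α.1)
  lie_mem' {x y} hx hy := by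
    refine LinearMap.BilinMap.apply_apply_mem_of_mem_span _ _ _
      (LieAlgebra.ad K (lieAlg K O)).toLinearMap ?_ x y hx hy
    rintro _ ⟨α, rfl⟩ _ ⟨β, rfl⟩
    change ⁅S.e α.1, S.e β.1⁆ ∈ _
    rcases lie_e_neg_eq_zero_or_eq_smul_e α β with hzero | ⟨γ, c, -, hlie⟩
    · exact hzero ▸ Submodule.zero_mem _
    · exact hlie ▸ Submodule.smul_mem _ _ (Submodule.subset_span ⟨γ, rfl⟩)

lemma e_mem_negLie (α : S.Neg) : S.e α.1 ∈ S.negLie := Submodule.subset_span ⟨α, rfl⟩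

lemma IsStandardLevi.apply_lie_negLie {χ : Module.Dual K (lieAlg K O)} {I : Set X}
    (hχ : S.IsStandardLevi χ I) (x y : S.negLie) :
    χ ⁅(x : lieAlg K O), (y : lieAlg K O)⁆ = 0 := by
  refine LinearMap.BilinMap.apply_apply_mem_of_mem_span (LinearMap.ker χ) _ _
    (LieAlgebra.ad K (lieAlg K O)).toLinearMap ?_ x y x.2 y.2
  rintro _ ⟨α, rfl⟩ _ ⟨β, rfl⟩
  change χ ⁅S.e α.1, S.e β.1⁆ = 0
  rcases lie_e_neg_eq_zero_or_eq_smul_e α β with hzero | ⟨γ, c, hγ, hlie⟩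
  · rw [hzero, map_zero]
  · rw [hlie, map_smul, hχ.apply_e_eq_zero_of_ht_lt, smul_zero]
    linarith [S.one_le_neg_ht α, S.one_le_neg_ht β]

open Classical in
variable (S) in
/-- The projection `𝔤 → 𝔫⁻` along `𝔥 + 𝔫⁺`. -/
def negProj : lieAlg K O →ₗ[K] S.negLie :=
  S.basis.constr K (Sum.elim
    (fun α => if hα : α.1 ∈ S.pos then 0 else ⟨S.e α, e_mem_negLie ⟨α, hα⟩⟩) fun _ => 0)

lemma negProj_e_neg (α : S.Neg) : (S.negProj (S.e α.1) : lieAlg K O) = S.e α.1 := by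
  rw [negProj, e, Module.Basis.constr_basis, Sum.elim_inl, dif_neg α.2]
  rfl

lemma negProj_e_pos {α : S.R} (hα : α.1 ∈ S.pos) : S.negProj (S.e α) = 0 := by
  rw [negProj, e, Module.Basis.constr_basis, Sum.elim_inl, dif_pos hα]

lemma negProj_basis_inr (i) : S.negProj (S.basis (Sum.inr i)) = 0 := by
  rw [negProj, Module.Basis.constr_basis, Sum.elim_inr]

lemma negProj_lieMap (h : Cartan K X) : S.negProj (lieMap S.torus h) = 0 := by
  have hle : Submodule.span K (Set.range fun i => S.basis (Sum.inr i)) ≤ LinearMap.ker S.negProj :=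
    Submodule.span_le.mpr (Set.range_subset_iff.mpr negProj_basis_inr)
  exact hle (lieMap_mem_span_basis_inr h)

lemma negProj_coe (x : S.negLie) : S.negProj x = x := by
  refine Subtype.ext (LinearMap.eqOn_span'
    (f := S.negLie.toSubmodule.subtype ∘ₗ S.negProj) (g := LinearMap.id) ?_ x.2)
  rintro _ ⟨α, rfl⟩
  exact negProj_e_neg α

lemma posSpan_le_ker_negProj : S.posSpan ≤ LinearMap.ker S.negProj := by
  refine Submodule.span_le.mpr ?_
  rintro _ ⟨α, hα, rfl⟩
  exact negProj_e_pos hα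

lemma coproj_negProj_mem_span (x : lieAlg K O) :
    coproj S.negProj x ∈ Submodule.span K S.borelVecs := by
  suffices hbasis : ∀ b, coproj S.negProj (S.basis b) ∈ Submodule.span K S.borelVecs from
    Submodule.span_le (p := Submodule.comap (coproj S.negProj) (Submodule.span K S.borelVecs))
      |>.mpr (Set.range_subset_iff.mpr hbasis) (S.basis.mem_span x)
  rintro (α | i)
  · by_cases hα : α.1 ∈ S.pos
    · exact (coproj_eq_self (negProj_e_pos hα)).symm ▸ Submodule.subset_span (.inl ⟨α, hα, rfl⟩)
    · exact (coproj_coe negProj_coe ⟨_, e_mem_negLie ⟨α, hα⟩⟩).symm ▸ Submodule.zero_mem _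
  · rw [coproj_eq_self (negProj_basis_inr i)]
    exact Submodule.subset_span (.inr (S.basis_cartan i))

section Functional

variable {χ : Module.Dual K (lieAlg K O)} {I : Set X}
variable {A : Type x} [CommRing A] [Algebra K A] (π : U0 K X →ₐ[K] A) (lam : X)

lemma borelChar_lieMap (h : Cartan K X) :
    S.borelChar π lam (lieMap S.torus h) = π (tilde lam (UniversalEnvelopingAlgebra.ι K h)) := by
  let T : Cartan K X →ₗ[K] lieAlg K O := lieMap S.torus
  let highest : Cartan K X →ₗ[K] A := π.toLinearMap ∘ₗ (tilde lam).toLinearMap ∘ₗ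
    (UniversalEnvelopingAlgebra.ι K : Cartan K X →ₗ⁅K⁆ _).toLinearMap
  suffices S.borelChar π lam ∘ₗ T = highest from LinearMap.congr_fun this h
  refine LinearMap.ext_on_range S.span_range_cartanVec fun i => ?_
  change S.borelChar π lam (lieMap S.torus (S.cartanVec i)) = highest (S.cartanVec i)
  rw [lieMap_cartanVec, borelChar, Module.Basis.constr_basis]
  rfl

lemma IsStandardLevi.exists_functional (hχ : S.IsStandardLevi χ I) :
    ∃ θ : UniversalEnvelopingAlgebra K (lieAlg K O) →ₗ[K] A, θ 1 = 1 ∧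
      (∀ (α : S.Neg) u, θ (UniversalEnvelopingAlgebra.ι K (S.e α.1) * u) =
        algebraMap K A (χ (S.e α.1)) * θ u) ∧
      (∀ (α : S.R) u, α.1 ∈ S.pos → θ (u * UniversalEnvelopingAlgebra.ι K (S.e α)) = 0) ∧
      ∀ h u, θ (u * UniversalEnvelopingAlgebra.ι K (lieMap S.torus h)) =
        θ u * π (tilde lam (UniversalEnvelopingAlgebra.ι K h)) := by
  have lie_coproj_mem (x y : lieAlg K O) :
      ⁅coproj S.negProj x, coproj S.negProj y⁆ ∈ S.posSpan :=
    lie_mem_posSpan (coproj_negProj_mem_span x) (coproj_negProj_mem_span y)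
  obtain ⟨θ, θ_one, θ_neg, θ_borel⟩ := exists_whittaker_functional negProj_coe
    (fun x y => posSpan_le_ker_negProj (lie_coproj_mem x y))
    (fun x y => posSpan_le_ker_borelChar π lam (lie_coproj_mem x y))
    (χ ∘ₗ S.negLie.toSubmodule.subtype) hχ.apply_lie_negLie
  refine ⟨θ, θ_one, fun α u => θ_neg ⟨S.e α.1, e_mem_negLie α⟩ u, fun α u hα => ?_, fun h u => ?_⟩
  · rw [θ_borel u _ (negProj_e_pos hα), borelChar_e, mul_zero]
  · rw [θ_borel u _ (negProj_lieMap h), borelChar_lieMap]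

variable [Fact p.Prime] [CharP K p]

-- The relations are central because `p` is good, so they may be moved to the side where `θ` is
-- an eigenfunctional.
lemma IsStandardLevi.functional_eq_of_uRel (hχ : S.IsStandardLevi χ I) (hp : S.IsGood)
    {θ : UniversalEnvelopingAlgebra K (lieAlg K O) →ₗ[K] A}
    (hneg : ∀ (α : S.Neg) u, θ (UniversalEnvelopingAlgebra.ι K (S.e α.1) * u) =
      algebraMap K A (χ (S.e α.1)) * θ u)
    (hpos : ∀ (α : S.R) u, α.1 ∈ S.pos → θ (u * UniversalEnvelopingAlgebra.ι K (S.e α)) = 0)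
    {a b : UniversalEnvelopingAlgebra K (lieAlg K O)} (hab : S.uRel χ a b)
    (u v : UniversalEnvelopingAlgebra K (lieAlg K O)) : θ (u * a * v) = θ (u * b * v) := by
  obtain ⟨α, rfl, rfl⟩ := hab
  have hp_ne : p ≠ 0 := (Fact.out : p.Prime).ne_zero
  by_cases hα : α.1 ∈ S.pos
  · rw [hχ.borel _ (S.e_mem_borel hα), zero_pow hp_ne, map_zero, mul_zero, zero_mul, map_zero,
      mul_assoc, (hp.commute_ι_e_pow α v).eq, ← mul_assoc, ← pow_sub_one_mul hp_ne, ← mul_assoc,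
      hpos α _ hα]
  · have hneg_pow (n : ℕ) (w) : θ (UniversalEnvelopingAlgebra.ι K (S.e α) ^ n * w) =
        algebraMap K A (χ (S.e α) ^ n) * θ w := by
      induction n with
      | zero => simp
      | succ n ih => rw [pow_succ', mul_assoc, hneg ⟨α, hα⟩, ih, pow_succ', map_mul, mul_assoc]
    rw [← (hp.commute_ι_e_pow α u).eq, mul_assoc, hneg_pow, ← Algebra.smul_def,
      ← Algebra.commutes, mul_assoc, ← Algebra.smul_def, map_smul]

lemma IsStandardLevi.exists_functional_U (hχ : S.IsStandardLevi χ I) (hp : S.IsGood) :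
    ∃ θ : S.U χ →ₗ[K] A, θ 1 = 1 ∧ (∀ (α : S.R) u, α.1 ∈ S.pos → θ (u * S.ue χ α) = 0) ∧
      ∀ s u, θ (u * S.u0 χ s) = θ u * π (tilde lam s) := by
  obtain ⟨θ, θ_one, θ_neg, θ_pos, θ_cartan⟩ := hχ.exists_functional π lam
  obtain ⟨θ', hθ'⟩ : ∃ θ' : S.U χ →ₗ[K] A, ∀ z, θ' (S.toU χ z) = θ z :=
    exists_linearMap_comp_mkAlgHom_eq θ fun _ _ hab => hχ.functional_eq_of_uRel hp θ_neg θ_pos hab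
  have θ'_uh (h : Cartan K X) (u : S.U χ) :
      θ' (u * S.uh χ h) = θ' u * π (tilde lam (UniversalEnvelopingAlgebra.ι K h)) := by
    obtain ⟨u, rfl⟩ := S.toU_surjective χ u
    rw [← toUι_lieMap, toUι_apply, ← map_mul, hθ', hθ', θ_cartan]
  refine ⟨θ', ?_, fun α u hα => ?_, fun s => ?_⟩
  · rw [← map_one (S.toU χ), hθ', θ_one]
  · obtain ⟨u, rfl⟩ := S.toU_surjective χ u
    rw [ue, ← map_mul, hθ', θ_pos α u hα]
  · induction s using ι_mul_induction with
    | one => simp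
    | add s t hs ht => intro u; simp only [map_add, mul_add, hs, ht]
    | smul c s hs => intro u; simp only [map_smul, mul_smul_comm, hs]
    | ι_mul h s hs =>
      intro u
      rw [map_mul (S.u0 χ), ← mul_assoc, hs, ← uh, θ'_uh, mul_assoc, ← map_mul, ← map_mul]

theorem IsStandardLevi.verMk_one_ne_zero [Nontrivial A] (hχ : S.IsStandardLevi χ I)
    (hp : S.IsGood) : S.verMk χ π lam 1 1 ≠ 0 := by
  obtain ⟨θ, θ_one, θ_pos, θ_cartan⟩ := hχ.exists_functional_U π lam hp
  let Θ : S.Ver χ A π lam →ₗ[K] A := verLift (TensorProduct.lift ((LinearMap.mul K A).comp θ))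
    (fun y α a hα => by simp [θ_pos α y hα]) fun y s a => by
      simp only [TensorProduct.lift.tmul, LinearMap.comp_apply, LinearMap.mul_apply', θ_cartan]
      ring
  have Θ_one : Θ (S.verMk χ π lam 1 1) = 1 := by
    simp [Θ, verLift_verMk, θ_one]
  intro hzero
  rw [hzero, map_zero] at Θ_one
  exact zero_ne_one Θ_one

end Functional

end Setting

/-! ### Proper submodules of a baby Verma module -/

namespace Setting

variable {K : Type u} [Field K] {p : ℕ} {O : Type v} [CommRing O] [HopfAlgebra K O]
variable {X : Type w} [AddCommGroup X] {S : Setting K p O X}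
variable {χ : Module.Dual K (lieAlg K O)} {I : Set X}
variable {A : Type x} [CommRing A] [Algebra K A] {π : U0 K X →ₐ[K] A} {lam : X}

variable (S χ π lam) in
/-- The sum of the images of the elements `e_α - χ(e_α)`, for negative `α`, acting on the baby Verma
module. Over a field it contains every proper submodule, though it need not be one itself. -/
def verRad : AddSubgroup (S.Ver χ A π lam) :=
  AddSubgroup.closure {z | ∃ (α : S.Neg) (z' : S.Ver χ A π lam), z = (S.uy χ α ⊗ₜ[K] (1 : A)) • z'}

lemma uy_smul_mem_verRad (α : S.Neg) (z : S.Ver χ A π lam) :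
    (S.uy χ α ⊗ₜ[K] (1 : A)) • z ∈ S.verRad χ π lam :=
  AddSubgroup.subset_closure ⟨α, z, rfl⟩

lemma smul_mem_verRad (a : A) {z : S.Ver χ A π lam} (hz : z ∈ S.verRad χ π lam) :
    ((1 : S.U χ) ⊗ₜ[K] a) • z ∈ S.verRad χ π lam := by
  have hstable : S.verRad χ π lam ≤
      (S.verRad χ π lam).comap (DistribSMul.toAddMonoidHom _ ((1 : S.U χ) ⊗ₜ[K] a)) := by
    refine (AddSubgroup.closure_le _).mpr ?_
    rintro _ ⟨α, z', rfl⟩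
    change ((1 : S.U χ) ⊗ₜ[K] a) • (S.uy χ α ⊗ₜ[K] (1 : A)) • z' ∈ S.verRad χ π lam
    have hcomm : ((1 : S.U χ) ⊗ₜ[K] a) * (S.uy χ α ⊗ₜ[K] (1 : A)) =
        (S.uy χ α ⊗ₜ[K] (1 : A)) * ((1 : S.U χ) ⊗ₜ[K] a) := by
      simp only [Algebra.TensorProduct.tmul_mul_tmul, one_mul, mul_one]
    rw [smul_smul, hcomm, mul_smul]
    exact uy_smul_mem_verRad α _
  exact hstable hz

lemma range_verMk_one_sup_verRad :
    (LinearMap.range (S.verMk χ π lam 1)).toAddSubgroup ⊔ S.verRad χ π lam = ⊤ := by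
  rw [eq_top_iff, ← verWords_eq_top]
  refine (AddSubgroup.closure_le _).mpr ?_
  rintro _ ⟨_ | ⟨α, l⟩, a, rfl⟩
  · exact AddSubgroup.mem_sup_left ⟨a, by rw [word_nil]⟩
  · rw [word_cons, ← tmul_one_smul_verMk]
    exact AddSubgroup.mem_sup_right (uy_smul_mem_verRad α _)

section Nakayama

variable [Infinite K] [Module.Free ℤ X] [Fact p.Prime] [CharP K p] [Finite S.R]

/-- Nakayama's lemma: the words in the `e_α - χ(e_α)` of large length vanish. -/
lemma IsStandardLevi.eq_top_of_sup_verRad_eq_top (hχ : S.IsStandardLevi χ I)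
    {N : Submodule (S.U χ ⊗[K] A) (S.Ver χ A π lam)}
    (hN : N.toAddSubgroup ⊔ S.verRad χ π lam = ⊤) : N = ⊤ := by
  obtain ⟨k, hk⟩ := hχ.exists_word_eq_zero
  have word_smul_mem (m : ℕ) : ∀ l : List S.Neg, k ≤ l.length + m → ∀ z : S.Ver χ A π lam,
      (S.word χ l ⊗ₜ[K] (1 : A)) • z ∈ N := by
    induction m with
    | zero =>
      intro l hl z
      rw [hk l hl, TensorProduct.zero_tmul, zero_smul]
      exact N.zero_mem
    | succ m ih =>
      intro l hl z
      have hsup : N.toAddSubgroup ⊔ S.verRad χ π lam ≤ N.toAddSubgroup.comap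
          (DistribSMul.toAddMonoidHom _ (S.word χ l ⊗ₜ[K] (1 : A))) := by
        refine sup_le (fun n hn => N.smul_mem _ hn) ((AddSubgroup.closure_le _).mpr ?_)
        rintro _ ⟨α, z', rfl⟩
        change (S.word χ l ⊗ₜ[K] (1 : A)) • (S.uy χ α ⊗ₜ[K] (1 : A)) • z' ∈ N
        rw [smul_smul, Algebra.TensorProduct.tmul_mul_tmul, mul_one, ← word_concat]
        exact ih (l ++ [α]) (by rw [List.length_append, List.length_singleton]; omega) z'
      exact hsup (hN.ge (AddSubgroup.mem_top z))
  refine Submodule.eq_top_iff'.mpr fun z => ?_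
  simpa only [word_nil, ← Algebra.TensorProduct.one_def, one_smul] using
    word_smul_mem k [] (Nat.le_add_left k _) z

lemma IsStandardLevi.verRad_ne_top [Nontrivial A] (hχ : S.IsStandardLevi χ I) (hp : S.IsGood) :
    S.verRad χ π lam ≠ ⊤ := by
  intro hrad
  have hbot : (⊥ : Submodule (S.U χ ⊗[K] A) (S.Ver χ A π lam)) = ⊤ :=
    hχ.eq_top_of_sup_verRad_eq_top (by rw [hrad, sup_top_eq])
  exact hχ.verMk_one_ne_zero π lam hp ((Submodule.mem_bot _).mp (hbot ▸ Submodule.mem_top))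

end Nakayama

lemma IsStandardLevi.le_verRad [Infinite K] [Module.Free ℤ X] [Fact p.Prime] [CharP K p]
    [Finite S.R] {F : Type x} [Field F] [Algebra K F] {π : U0 K X →ₐ[K] F}
    (hχ : S.IsStandardLevi χ I) {N : Submodule (S.U χ ⊗[K] F) (S.Ver χ F π lam)} (hN : N ≠ ⊤) :
    N.toAddSubgroup ≤ S.verRad χ π lam := by
  intro n hn
  by_contra hnot
  obtain ⟨_, ⟨a, rfl⟩, j, hj, rfl⟩ := AddSubgroup.mem_sup.mp
    (range_verMk_one_sup_verRad.ge (AddSubgroup.mem_top n))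
  have ha : a ≠ 0 := by
    rintro rfl
    rw [map_zero, zero_add] at hnot
    exact hnot hj
  refine hN (hχ.eq_top_of_sup_verRad_eq_top (eq_top_iff.mpr ?_))
  rw [← range_verMk_one_sup_verRad]
  refine sup_le ?_ le_sup_right
  rintro _ ⟨b, rfl⟩
  have hscale : S.verMk χ π lam 1 b =
      ((1 : S.U χ) ⊗ₜ[K] (b * a⁻¹)) • (S.verMk χ π lam 1 a + j) -
        ((1 : S.U χ) ⊗ₜ[K] (b * a⁻¹)) • j := by
    rw [smul_add, add_sub_cancel_right, one_tmul_smul_verMk, inv_mul_cancel_right₀ ha]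
  rw [hscale]
  exact AddSubgroup.sub_mem _ (AddSubgroup.mem_sup_left (N.smul_mem _ hn))
    (AddSubgroup.mem_sup_right (smul_mem_verRad _ hj))

end Setting

/-! ### Graded subgroups -/

section GradedSubgroup

variable {V : Type u} [AddCommGroup V] {J : Type w} {E : J → AddSubgroup V}

lemma mem_iSup_addSubgroup_iff {v : V} :
    v ∈ ⨆ i, E i ↔ ∃ f : J →₀ V, (∀ i, f i ∈ E i) ∧ (f.sum fun _ w => w) = v := by
  change v ∈ AddSubgroup.toIntSubmodule (⨆ i, E i) ↔ _
  rw [OrderIso.map_iSup, Submodule.mem_iSup_iff_exists_finsupp]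
  rfl

lemma indicator_apply_mem {s : Finset J} {m : J → V} (hm : ∀ i ∈ s, m i ∈ E i) (i : J) :
    Finsupp.indicator s (fun i _ => m i) i ∈ E i := by
  classical
  rw [Finsupp.indicator_apply]
  split_ifs with hi
  exacts [hm i hi, (E i).zero_mem]

lemma iSupIndep_addSubgroup_iff_finsupp :
    iSupIndep E ↔ ∀ f : J →₀ V, (∀ i, f i ∈ E i) → (f.sum fun _ w => w) = 0 → f = 0 := by
  rw [iSupIndep_addSubgroup_iff]
  refine ⟨fun indep f hf hsum => Finsupp.ext fun i => ?_, fun indep s m hm hsum i hi => ?_⟩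
  · by_cases hi : i ∈ f.support
    · exact indep f.support f (fun i _ => hf i) hsum i hi
    · exact Finsupp.notMem_support_iff.mp hi
  · rw [← Finsupp.indicator_of_mem hi fun i _ => m i, indep _ (indicator_apply_mem hm),
      Finsupp.zero_apply]
    rwa [Finsupp.sum_indicator_index _ fun _ _ => rfl]

lemma finsupp_eq_of_sum_eq (hE : iSupIndep E) {f g : J →₀ V} (hf : ∀ i, f i ∈ E i)
    (hg : ∀ i, g i ∈ E i) (hsum : (f.sum fun _ w => w) = g.sum fun _ w => w) : f = g := by
  refine sub_eq_zero.mp (iSupIndep_addSubgroup_iff_finsupp.mp hE (f - g)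
    (fun i => (E i).sub_mem (hf i) (hg i)) ?_)
  rw [Finsupp.sum_sub_index fun _ _ _ => rfl, hsum, sub_self]

lemma iSupIndep_prod {J' : Type x} {E : J × J' → AddSubgroup V} {D : J → AddSubgroup V}
    (hD : iSupIndep D) (hE : ∀ j, iSupIndep fun k => E (j, k)) (hle : ∀ j k, E (j, k) ≤ D j) :
    iSupIndep E := by
  refine iSupIndep_addSubgroup_iff_finsupp.mpr fun f hf hsum => ?_
  let rowSum : J →₀ V := f.curry.mapRange (fun row => row.sum fun _ w => w) Finsupp.sum_zero_index
  have hrow : rowSum = 0 := by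
    refine iSupIndep_addSubgroup_iff_finsupp.mp hD rowSum
      (fun j => AddSubgroup.sum_mem _ fun k _ => hle j k (hf (j, k))) ?_
    rw [Finsupp.sum_mapRange_index fun _ => rfl, Finsupp.sum_curry_index, hsum]
  have hcurry (j : J) : f.curry j = 0 :=
    iSupIndep_addSubgroup_iff_finsupp.mp (hE j) (f.curry j) (fun k => hf (j, k))
      (DFunLike.congr_fun hrow j)
  exact Finsupp.ext fun q => DFunLike.congr_fun (hcurry q.1) q.2

/-- The subgroup `N` is homogeneous for the family `E` of subgroups: it is generated by its
intersections with them. -/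
def IsGradedSubgroup (E : J → AddSubgroup V) (N : AddSubgroup V) : Prop :=
  N ≤ ⨆ i, N ⊓ E i

lemma IsGradedSubgroup.mem_of_sum_mem {N : AddSubgroup V} (hN : IsGradedSubgroup E N)
    (hE : iSupIndep E) {f : J →₀ V} (hf : ∀ i, f i ∈ E i) (hsum : (f.sum fun _ w => w) ∈ N)
    (i : J) : f i ∈ N := by
  obtain ⟨g, hg, hgsum⟩ := mem_iSup_addSubgroup_iff.mp (hN hsum)
  rw [← finsupp_eq_of_sum_eq hE (fun i => (hg i).2) hf hgsum]
  exact (hg i).1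

variable {W : Type v} [AddCommGroup W] {E' : J → AddSubgroup W} {φ : V →+ W}

lemma IsGradedSubgroup.map {N : AddSubgroup V} (hN : IsGradedSubgroup E N)
    (hφ : ∀ i, ∀ m ∈ E i, φ m ∈ E' i) : IsGradedSubgroup E' (N.map φ) := by
  refine (AddSubgroup.map_mono hN).trans
    ((AddSubgroup.map_iSup φ _).le.trans (iSup_mono fun i => ?_))
  rintro _ ⟨m, hm, rfl⟩
  exact ⟨⟨m, hm.1, rfl⟩, hφ i m hm.2⟩

lemma IsGradedSubgroup.comap {N : AddSubgroup W} (hN : IsGradedSubgroup E' N)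
    (hE : ⨆ i, E i = ⊤) (hE' : iSupIndep E') (hφ : ∀ i, ∀ m ∈ E i, φ m ∈ E' i) :
    IsGradedSubgroup E (N.comap φ) := by
  intro v hv
  obtain ⟨f, hf, rfl⟩ := mem_iSup_addSubgroup_iff.mp (hE.ge (AddSubgroup.mem_top v))
  refine AddSubgroup.sum_mem _ fun i _ => AddSubgroup.mem_iSup_of_mem i ⟨?_, hf i⟩
  refine hN.mem_of_sum_mem hE' (f := f.mapRange φ φ.map_zero) (fun i => hφ i _ (hf i)) ?_ i
  rw [Finsupp.sum_mapRange_index fun _ => rfl, ← map_finsuppSum]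
  exact hv

lemma isGradedSubgroup_bot : IsGradedSubgroup E ⊥ := bot_le

lemma exists_mem_of_surjective (hE : ⨆ i, E i = ⊤) (hE' : iSupIndep E')
    (hφ : ∀ i, ∀ m ∈ E i, φ m ∈ E' i) (hsurj : Function.Surjective φ) {i : J} {y : W}
    (hy : y ∈ E' i) : ∃ m ∈ E i, φ m = y := by
  classical
  obtain ⟨v, rfl⟩ := hsurj y
  obtain ⟨f, hf, rfl⟩ := mem_iSup_addSubgroup_iff.mp (hE.ge (AddSubgroup.mem_top v))
  refine ⟨f i, hf i, ?_⟩
  have heq : f.mapRange φ φ.map_zero = Finsupp.single i (φ (f.sum fun _ w => w)) := by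
    refine finsupp_eq_of_sum_eq hE' (fun j => hφ j _ (hf j)) (fun j => ?_) ?_
    · rw [Finsupp.single_apply]
      split_ifs with hij
      exacts [hij ▸ hy, (E' j).zero_mem]
    · rw [Finsupp.sum_mapRange_index fun _ => rfl, Finsupp.sum_single_index rfl, map_finsuppSum]
  rw [← Finsupp.single_eq_same (a := i) (b := φ (f.sum fun _ w => w)), ← heq,
    Finsupp.mapRange_apply]

lemma iSupIndep_map_of_isGradedSubgroup_ker (hE : iSupIndep E)
    (hker : IsGradedSubgroup E φ.ker) : iSupIndep fun i => (E i).map φ := by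
  refine iSupIndep_addSubgroup_iff.mpr fun s m hm hsum i hi => ?_
  choose! g hg hgm using hm
  have hker_g := hker.mem_of_sum_mem hE (indicator_apply_mem hg) (by
    rw [Finsupp.sum_indicator_index _ fun _ _ => rfl, AddMonoidHom.mem_ker, map_sum,
      Finset.sum_congr rfl hgm, hsum]) i
  rw [Finsupp.indicator_of_mem hi, AddMonoidHom.mem_ker, hgm i hi] at hker_g
  exact hker_g

end GradedSubgroup

/-! ### Quotients in the category -/

namespace Setting

variable {K : Type u} [Field K] {p : ℕ} {O : Type v} [CommRing O] [HopfAlgebra K O]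
variable {X : Type w} [AddCommGroup X] {S : Setting K p O X}
variable {χ : Module.Dual K (lieAlg K O)} {I : Set X}
variable {A : Type x} [CommRing A] [Algebra K A] {π : U0 K X →ₐ[K] A}

namespace GrMod

variable {M : S.GrMod χ I A}

/-- The family of all weight spaces `M_σ^ξ`, indexed by pairs `(σ, ξ)`. -/
def wtPair (M : S.GrMod χ I A) (q : S.XI I × Module.Dual K (Cartan K X)) :
    AddSubgroup M.carrier :=
  M.wt q.1 q.2

lemma IsObject.wt_le_gr (hM : M.IsObject π) (σ : S.XI I) (ξ : Module.Dual K (Cartan K X)) :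
    M.wt σ ξ ≤ M.gr σ :=
  (le_iSup (M.wt σ) ξ).trans (hM.wt_sum σ).le

lemma IsObject.iSupIndep_wtPair (hM : M.IsObject π) : iSupIndep M.wtPair :=
  iSupIndep_prod hM.gr_indep hM.wt_indep hM.wt_le_gr

lemma IsObject.iSup_wtPair (hM : M.IsObject π) : ⨆ q, M.wtPair q = ⊤ := by
  rw [iSup_prod, ← hM.gr_top]
  exact iSup_congr hM.wt_sum

end GrMod

namespace Cat

variable {M L : S.Cat χ I A π}

lemma isSubobject_iff {N : Submodule (S.U χ ⊗[K] A) M.obj.carrier} :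
    M.IsSubobject N ↔ IsGradedSubgroup M.obj.wtPair N.toAddSubgroup := by
  rw [IsGradedSubgroup, iSup_prod]
  rfl

lemma isSubobject_sSup {T : Set (Submodule (S.U χ ⊗[K] A) M.obj.carrier)}
    (hT : ∀ N ∈ T, M.IsSubobject N) : M.IsSubobject (sSup T) := by
  intro n hn
  rw [Submodule.mem_toAddSubgroup, sSup_eq_iSup'] at hn
  refine Submodule.iSup_induction (fun N : T => N.1)
    (motive := (· ∈ ⨆ (σ) (ξ), (sSup T).toAddSubgroup ⊓ M.obj.wt σ ξ)) hn (fun N m hm => ?_)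
    (AddSubgroup.zero_mem _) fun _ _ => AddSubgroup.add_mem _
  have hmono : (⨆ (σ) (ξ), N.1.toAddSubgroup ⊓ M.obj.wt σ ξ) ≤
      ⨆ (σ) (ξ), (sSup T).toAddSubgroup ⊓ M.obj.wt σ ξ :=
    iSup₂_mono fun σ ξ => inf_le_inf_right _ (Submodule.toAddSubgroup_mono (le_sSup N.2))
  exact hmono (hT N.1 N.2 hm)

namespace Hom

variable (f : Hom M L)

lemma map_mem_wt {σ : S.XI I} {ξ : Module.Dual K (Cartan K X)} {m : M.obj.carrier}
    (hm : m ∈ M.obj.wt σ ξ) : f.map m ∈ L.obj.wt σ ξ := by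
  by_cases hξ : ξ ∈ S.weights I σ
  · exact f.map_wt σ ξ hξ m hm
  · rw [M.isObject.wt_bot σ ξ hξ, AddSubgroup.mem_bot] at hm
    rw [hm, map_zero]
    exact AddSubgroup.zero_mem _

lemma isSubobject_map {N : Submodule (S.U χ ⊗[K] A) M.obj.carrier} (hN : M.IsSubobject N) :
    L.IsSubobject (N.map f.map) :=
  isSubobject_iff.mpr ((isSubobject_iff.mp hN).map (φ := f.map.toAddMonoidHom)
    fun _ _ hm => f.map_mem_wt hm)

lemma isSubobject_comap {N : Submodule (S.U χ ⊗[K] A) L.obj.carrier} (hN : L.IsSubobject N) :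
    M.IsSubobject (N.comap f.map) :=
  isSubobject_iff.mpr ((isSubobject_iff.mp hN).comap (φ := f.map.toAddMonoidHom)
    M.isObject.iSup_wtPair L.isObject.iSupIndep_wtPair fun _ _ hm => f.map_mem_wt hm)

lemma isSubobject_ker : M.IsSubobject (LinearMap.ker f.map) :=
  f.isSubobject_comap (isSubobject_iff.mpr isGradedSubgroup_bot)

variable {f}

lemma exists_mem_wt (hf : Function.Surjective f.map) {σ : S.XI I}
    {ξ : Module.Dual K (Cartan K X)} {y : L.obj.carrier} (hy : y ∈ L.obj.wt σ ξ) :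
    ∃ m ∈ M.obj.wt σ ξ, f.map m = y :=
  exists_mem_of_surjective (φ := f.map.toAddMonoidHom) (i := (σ, ξ)) M.isObject.iSup_wtPair
    L.isObject.iSupIndep_wtPair (fun _ _ hm => f.map_mem_wt hm) hf hy

lemma isIrreducible_iff (hf : Function.Surjective f.map) : L.IsIrreducible ↔
    LinearMap.ker f.map ≠ ⊤ ∧ ∀ N, M.IsSubobject N → LinearMap.ker f.map ≤ N →
      N = LinearMap.ker f.map ∨ N = ⊤ := by
  have comap_inj := Submodule.comap_injective_of_surjective hf
  have nontrivial_iff : Nontrivial L.obj.carrier ↔ LinearMap.ker f.map ≠ ⊤ := by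
    rw [← Submodule.nontrivial_iff (S.U χ ⊗[K] A), ← not_subsingleton_iff_nontrivial,
      ← subsingleton_iff_bot_eq_top, ← ne_eq, ← comap_inj.ne_iff]
    rfl
  rw [IsIrreducible, nontrivial_iff]
  refine and_congr_right fun _ => ⟨fun hL N hN hle => ?_, fun hmax N hN => ?_⟩
  · rw [← Submodule.comap_map_eq_self hle]
    exact (hL _ (f.isSubobject_map hN)).imp (congrArg (Submodule.comap f.map))
      (congrArg (Submodule.comap f.map))
  · exact (hmax _ (f.isSubobject_comap hN) (LinearMap.ker_le_comap f.map)).imp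
      (fun h => comap_inj h) fun h => comap_inj h

end Hom

section Quotient

variable (M) in
/-- The quotient module `M ⧸ N` with the images of the graded components and weight spaces of
`M`. -/
def quotGrMod (N : Submodule (S.U χ ⊗[K] A) M.obj.carrier) : S.GrMod χ I A where
  carrier := M.obj.carrier ⧸ N
  gr σ := (M.obj.gr σ).map N.mkQ.toAddMonoidHom
  wt σ ξ := (M.obj.wt σ ξ).map N.mkQ.toAddMonoidHom

variable {N : Submodule (S.U χ ⊗[K] A) M.obj.carrier}

lemma IsSubobject.isGradedSubgroup_gr (hN : M.IsSubobject N) :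
    IsGradedSubgroup M.obj.gr N.toAddSubgroup :=
  le_trans hN (iSup_mono fun σ => iSup_le fun ξ =>
    inf_le_inf_left _ (M.isObject.wt_le_gr σ ξ))

lemma IsSubobject.iSupIndep_quotGrMod_gr (hN : M.IsSubobject N) :
    iSupIndep (M.quotGrMod N).gr := by
  refine iSupIndep_map_of_isGradedSubgroup_ker (φ := N.mkQ.toAddMonoidHom) M.isObject.gr_indep ?_
  rw [← LinearMap.ker_toAddSubgroup, Submodule.ker_mkQ]
  exact hN.isGradedSubgroup_gr

lemma iSup_quotGrMod_gr : ⨆ σ, (M.quotGrMod N).gr σ = ⊤ := by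
  change ⨆ σ, (M.obj.gr σ).map N.mkQ.toAddMonoidHom = ⊤
  rw [← AddSubgroup.map_iSup, M.isObject.gr_top]
  exact AddSubgroup.map_top_of_surjective _ N.mkQ_surjective

lemma finite_quotGrMod_gr_ne_bot : {σ | (M.quotGrMod N).gr σ ≠ ⊥}.Finite := by
  refine M.isObject.gr_finite.subset fun σ hσ hbot => hσ ?_
  change (M.obj.gr σ).map _ = ⊥
  rw [hbot, AddSubgroup.map_bot]

lemma quotGrMod_gr_fg (σ : S.XI I) : ∃ s : Finset (M.quotGrMod N).carrier, (M.quotGrMod N).gr σ =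
    AddSubgroup.closure {m | ∃ a : A, ∃ y ∈ s, m = ((1 : S.U χ) ⊗ₜ[K] a) • y} := by
  classical
  obtain ⟨s, hs⟩ := M.isObject.gr_fg σ
  refine ⟨s.image N.mkQ, ?_⟩
  change (M.obj.gr σ).map _ = _
  rw [hs, AddMonoidHom.map_closure]
  refine congrArg AddSubgroup.closure (Set.ext fun m => ⟨?_, ?_⟩)
  · rintro ⟨_, ⟨a, y, hy, rfl⟩, rfl⟩
    exact ⟨a, N.mkQ y, Finset.mem_image_of_mem _ hy, rfl⟩
  · rintro ⟨a, y, hy, rfl⟩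
    obtain ⟨z, hz, rfl⟩ := Finset.mem_image.mp hy
    exact ⟨_, ⟨a, z, hz, rfl⟩, rfl⟩

lemma quotGrMod_wt_eq_bot (σ : S.XI I) (ξ : Module.Dual K (Cartan K X)) (hξ : ξ ∉ S.weights I σ) :
    (M.quotGrMod N).wt σ ξ = ⊥ := by
  change (M.obj.wt σ ξ).map _ = ⊥
  rw [M.isObject.wt_bot σ ξ hξ, AddSubgroup.map_bot]

lemma u0_smul_of_mem_quotGrMod_wt (σ : S.XI I) (μ : X) (hμ : dchar μ ∈ S.weights I σ)
    (s : U0 K X) : ∀ m ∈ (M.quotGrMod N).wt σ (dchar μ),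
      (S.u0 χ s ⊗ₜ[K] (1 : A)) • m = ((1 : S.U χ) ⊗ₜ[K] π (tilde μ s)) • m := by
  rintro _ ⟨m, hm, rfl⟩
  exact congrArg N.mkQ (M.isObject.wt_act σ μ hμ s m hm)

lemma iSup_quotGrMod_wt (σ : S.XI I) :
    ⨆ ξ, (M.quotGrMod N).wt σ ξ = (M.quotGrMod N).gr σ := by
  change ⨆ ξ, (M.obj.wt σ ξ).map N.mkQ.toAddMonoidHom = (M.obj.gr σ).map _
  rw [← AddSubgroup.map_iSup, M.isObject.wt_sum]

lemma IsSubobject.quotGrMod_isObject (hN : M.IsSubobject N) : (M.quotGrMod N).IsObject π where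
  gr_indep := hN.iSupIndep_quotGrMod_gr
  gr_top := iSup_quotGrMod_gr
  gr_smul := by
    rintro σ a _ ⟨m, hm, rfl⟩
    exact ⟨_, M.isObject.gr_smul σ a m hm, rfl⟩
  gr_finite := finite_quotGrMod_gr_ne_bot
  gr_fg := quotGrMod_gr_fg
  gr_mul := by
    rintro σ τ y hy _ ⟨m, hm, rfl⟩
    exact ⟨_, M.isObject.gr_mul σ τ y hy m hm, rfl⟩
  wt_indep σ := GrMod.iSupIndep_wt_of_act _ σ (quotGrMod_wt_eq_bot σ)
    (u0_smul_of_mem_quotGrMod_wt σ)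
  wt_sum := iSup_quotGrMod_wt
  wt_bot := quotGrMod_wt_eq_bot
  wt_act := u0_smul_of_mem_quotGrMod_wt
  wt_root := by
    rintro σ μ α hμ _ ⟨m, hm, rfl⟩
    exact ⟨_, M.isObject.wt_root σ μ α hμ m hm, rfl⟩
  wt_smul := by
    rintro σ ξ a _ ⟨m, hm, rfl⟩
    exact ⟨_, M.isObject.wt_smul σ ξ a m hm, rfl⟩

/-- The quotient of an object by a subobject. -/
def quot (hN : M.IsSubobject N) : S.Cat χ I A π :=
  ⟨M.quotGrMod N, hN.quotGrMod_isObject⟩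

/-- The quotient morphism `M ⟶ M ⧸ N`. -/
def quotHom (hN : M.IsSubobject N) : Hom M (quot hN) where
  map := N.mkQ
  map_wt _ _ _ m hm := ⟨m, hm, rfl⟩

lemma quotHom_surjective (hN : M.IsSubobject N) : Function.Surjective (quotHom hN).map :=
  N.mkQ_surjective

lemma ker_quotHom (hN : M.IsSubobject N) : LinearMap.ker (quotHom hN).map = N := N.ker_mkQ

end Quotient

lemma Hom.exists_hom_of_ker_le {L' : S.Cat χ I A π} {f : Hom M L} (g : Hom M L')
    (hf : Function.Surjective f.map) (hker : LinearMap.ker f.map ≤ LinearMap.ker g.map) :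
    ∃ φ : Hom L L', ∀ m, φ.map (f.map m) = g.map m := by
  let e := f.map.quotKerEquivOfSurjective hf
  let φ : L.obj.carrier →ₗ[S.U χ ⊗[K] A] L'.obj.carrier :=
    Submodule.liftQ _ g.map hker ∘ₗ e.symm.toLinearMap
  have hφ (m : M.obj.carrier) : φ (f.map m) = g.map m := by
    have e_symm : e.symm (f.map m) = Submodule.Quotient.mk m := by
      rw [LinearEquiv.symm_apply_eq]
      rfl
    rw [LinearMap.comp_apply, LinearEquiv.coe_coe, e_symm, Submodule.liftQ_apply]
  refine ⟨⟨φ, fun σ ξ _ y hy => ?_⟩, hφ⟩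
  obtain ⟨m, hm, rfl⟩ := exists_mem_wt hf hy
  rw [hφ]
  exact g.map_mem_wt hm

lemma exists_iso_of_ker_eq {L' : S.Cat χ I A π} {f : M ⟶ L} {g : M ⟶ L'}
    (hf : Function.Surjective (Hom.map f)) (hg : Function.Surjective (Hom.map g))
    (hker : LinearMap.ker (Hom.map f) = LinearMap.ker (Hom.map g)) :
    ∃ φ : L ≅ L', CategoryTheory.CategoryStruct.comp f φ.hom = g := by
  obtain ⟨φ, hφ⟩ := Hom.exists_hom_of_ker_le g hf hker.le
  obtain ⟨ψ, hψ⟩ := Hom.exists_hom_of_ker_le f hg hker.ge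
  refine ⟨⟨φ, ψ, Hom.ext (LinearMap.ext fun y => ?_), Hom.ext (LinearMap.ext fun y => ?_)⟩,
    Hom.ext (LinearMap.ext hφ)⟩
  · obtain ⟨m, rfl⟩ := hf y
    exact (congrArg ψ.map (hφ m)).trans (hψ m)
  · obtain ⟨m, rfl⟩ := hg y
    exact (congrArg φ.map (hψ m)).trans (hφ m)

section Radical

variable (M) in
/-- The sum of all proper subobjects. -/
def radical : Submodule (S.U χ ⊗[K] A) M.obj.carrier :=
  sSup {N | M.IsSubobject N ∧ N ≠ ⊤}

lemma isSubobject_radical : M.IsSubobject M.radical :=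
  isSubobject_sSup fun _ hN => hN.1

lemma IsSubobject.le_radical {N : Submodule (S.U χ ⊗[K] A) M.obj.carrier} (hN : M.IsSubobject N)
    (hne : N ≠ ⊤) : N ≤ M.radical :=
  le_sSup ⟨hN, hne⟩

lemma radical_ne_top {J : AddSubgroup M.obj.carrier} (hJ : J ≠ ⊤)
    (hle : ∀ N, M.IsSubobject N → N ≠ ⊤ → N.toAddSubgroup ≤ J) : M.radical ≠ ⊤ := by
  intro htop
  refine hJ ((AddSubgroup.eq_top_iff' J).mpr fun n => ?_)
  have hn : n ∈ M.radical := htop ▸ Submodule.mem_top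
  rw [radical, sSup_eq_iSup'] at hn
  exact Submodule.iSup_induction _ (motive := (· ∈ J)) hn
    (fun N m hm => hle N.1 N.2.1 N.2.2 hm) J.zero_mem fun _ _ => J.add_mem

lemma isIrreducible_quot_radical (hM : M.radical ≠ ⊤) :
    (quot (isSubobject_radical (M := M))).IsIrreducible := by
  rw [Hom.isIrreducible_iff (quotHom_surjective _), ker_quotHom]
  refine ⟨hM, fun N hN hle => ?_⟩
  by_cases htop : N = ⊤
  · exact .inr htop
  · exact .inl ((hN.le_radical htop).antisymm hle)

lemma Hom.ker_eq_radical {f : Hom M L} (hM : M.radical ≠ ⊤) (hf : Function.Surjective f.map)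
    (hL : L.IsIrreducible) : LinearMap.ker f.map = M.radical := by
  obtain ⟨hne, hmax⟩ := (isIrreducible_iff hf).mp hL
  have hle := f.isSubobject_ker.le_radical hne
  exact ((hmax _ isSubobject_radical hle).resolve_right hM).symm

theorem exists_unique_irreducible_quotient (hM : M.radical ≠ ⊤) :
    ∃ (L : S.Cat χ I A π) (q : M ⟶ L), Function.Surjective (Hom.map q) ∧ L.IsIrreducible ∧
      ∀ (L' : S.Cat χ I A π) (q' : M ⟶ L'), Function.Surjective (Hom.map q') → L'.IsIrreducible →
        ∃ φ : L ≅ L', CategoryTheory.CategoryStruct.comp q φ.hom = q' :=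
  ⟨quot isSubobject_radical, quotHom isSubobject_radical, quotHom_surjective _,
    isIrreducible_quot_radical hM, fun _ _ hq' hL' =>
      exists_iso_of_ker_eq (quotHom_surjective _) hq'
        ((ker_quotHom _).trans (Hom.ker_eq_radical hM hq' hL').symm)⟩

end Radical

end Cat

end Setting

end BabyVerma

theorem mainTheorem5_general {K O X F : Type*} [Field K] [Infinite K] (p : ℕ) [Fact p.Prime]
    [CharP K p] [CommRing O] [HopfAlgebra K O] [Algebra.FiniteType K O]
    [AddCommGroup X] [Module.Free ℤ X]
    (S : BabyVerma.Setting K p O X) (hp : S.IsGood)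
    (χ : Module.Dual K (BabyVerma.lieAlg K O)) (I : Set X) (hχ : S.IsStandardLevi χ I)
    [Field F] [Algebra K F] (π : BabyVerma.U0 K X →ₐ[K] F) (lam : X) :
    ∃ hZ : (S.babyVerma χ I F π lam).IsObject π,
      ∃ (L : S.Cat χ I F π) (q : (⟨S.babyVerma χ I F π lam, hZ⟩ : S.Cat χ I F π) ⟶ L),
        Function.Surjective q.map ∧ L.IsIrreducible ∧
        ∀ (L' : S.Cat χ I F π) (q' : (⟨S.babyVerma χ I F π lam, hZ⟩ : S.Cat χ I F π) ⟶ L'),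
          Function.Surjective q'.map → L'.IsIrreducible →
          ∃ φ : L ≅ L', CategoryTheory.CategoryStruct.comp q φ.hom = q' := by
  have : Finite S.R := S.finite_roots
  have hZ := hχ.babyVerma_isObject π lam
  exact ⟨hZ, BabyVerma.Setting.Cat.exists_unique_irreducible_quotient
    (BabyVerma.Setting.Cat.radical_ne_top (hχ.verRad_ne_top hp) fun _ _ hN => hχ.le_verRad hN)⟩

/-- Every baby Verma module over a field `F` is an object of the category and has a unique
irreducible quotient in it. -/
theorem mainTheorem5 {K O X F : Type*} [Field K] [IsAlgClosed K] (p : ℕ) [Fact p.Prime] [CharP K p]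
    [CommRing O] [HopfAlgebra K O] (hG : BabyVerma.IsConnectedReductive K O)
    [AddCommGroup X] [Module.Free ℤ X] [Module.Finite ℤ X]
    (S : BabyVerma.Setting K p O X) (hp : S.IsGood)
    (χ : Module.Dual K (BabyVerma.lieAlg K O)) (I : Set X) (hχ : S.IsStandardLevi χ I)
    [Field F] [Algebra K F] (π : BabyVerma.U0 K X →ₐ[K] F) (lam : X) :
    ∃ hZ : (S.babyVerma χ I F π lam).IsObject π,
      ∃ (L : S.Cat χ I F π) (q : (⟨S.babyVerma χ I F π lam, hZ⟩ : S.Cat χ I F π) ⟶ L),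
        Function.Surjective q.map ∧ L.IsIrreducible ∧
        ∀ (L' : S.Cat χ I F π) (q' : (⟨S.babyVerma χ I F π lam, hZ⟩ : S.Cat χ I F π) ⟶ L'),
          Function.Surjective q'.map → L'.IsIrreducible →
          ∃ φ : L ≅ L', CategoryTheory.CategoryStruct.comp q φ.hom = q' := by
  have : Algebra.FiniteType K O := hG.finiteType
  exact mainTheorem5_general p S hp χ I hχ π lam
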